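/- Let $\mathscr G$ be an ample groupoid: a (not necessarily Hausdorff) topological groupoid whose unit space $X=\mathscr G^{(0)}$ is locally compact and Hausdorff in the relative topology, whose range map $\mathbf r:\mathscr G\to X$ is a local homeomorphism, and whose topology has a basis of compact open bisections (subsets on which the source map $\mathbf s$ and the range map $\mathbf r$ are injective). Assume that $X$ is compact. Let $K$ be a field and let $A_K(\mathscr G)$ be the Steinberg algebra, i.e. the $K$-subspace of $K^{\mathscr G}$ spanned by the characteristic functions of compact open bisections, with the convolution product $(f*g)(\gamma)=\sum_{\alpha\beta=\gamma}f(\alpha)g(\beta)$. Let $\mathcal L(X)$ be the algebra of locally constant functions $X\to K$, regarded as a subalgebra of $A_K(\mathscr G)$ through extension by zero. Let $\mathcal S^a(\mathscr G)$ be the inverse monoid of compact open bisections of $\mathscr G$, with the set-wise product and inverse. Let $M$ be an $A_K(\mathscr G)$-bimodule (on which the left and right actions of $K$ agree). For a compact open bisection $U$ and $\varphi\in\mathcal L(\mathbf r(U))$ let $\varphi\Delta_U\in A_K(\mathscr G)$ be the function that sends $\gamma\in U$ to $\varphi(\mathbf r(\gamma))$ and vanishes outside of $U$. Then $M$ is a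 left $K\mathcal S^a(\mathscr G)$-module via $$U\cdot x=(1_{\mathbf r(U)}\Delta_U)\cdot x\cdot(1_{\mathbf s(U)}\Delta_{U^{-1}}),\qquad U\in\mathcal S^a(\mathscr G),\ x\in M,$$ the $K$-subspace $[\mathcal L(X),M]$ spanned by all $f\cdot x-x\cdot f$ with $f\in\mathcal L(X)$, $x\in M$, is a $K\mathcal S^a(\mathscr G)$-submodule, and for every $n\ge 0$ there is an isomorphism of $K$-vector spaces $$H_n(A_K(\mathscr G),M)\;\cong\;H_n\bigl(\mathcal S^a(\mathscr G),\,M/[\mathcal L(X),M]\bigr).$$ Here, for a $K$-algebra $A$ and an $A$-bimodule $M$, $H_n(A,M)=\operatorname{Tor}_n^{A\otimes_K A^{\mathrm{op}}}(A,M)$ is Hochschild homology, where $M$ is a left module by $(a\otimes b)\cdot x=axb$ and $A$ is a right module by $x\cdot(a\otimes b)=bxa$. For an inverse monoid $S$ with set of idempotents $E(S)$ and a left module $V$ over the monoid algebra $KS$, $H_n(S,V)=\operatorname{Tor}_n^{KS}(KE(S),V)$, where $KE(S)$ is the free $K$-module on $E(S)$ with the right $KS$-action $e\cdot s=s^{-1}es$.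 -/

import Mathlib

open CategoryTheory

universe u v w x y z

noncomputable section

/-! ## Tensor products over a noncommutative ring, and `Tor` -/

namespace NCTensor

open scoped TensorProduct

/-- The `K`-submodule of `X ⊗_ℤ Y` generated by the elements `(x · r) ⊗ y - x ⊗ (r · y)`. Here `X`
is a right `R`-module (a module over `Rᵐᵒᵖ`) with a commuting action of `K`, and `Y` is a left
`R`-module. -/
def balancedRelations (K : Type z) (R : Type u) (X : Type x) (Y : Type y) [CommRing K] [Ring R]
    [AddCommGroup X] [Module K X] [Module Rᵐᵒᵖ X] [SMulCommClass K Rᵐᵒᵖ X]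
    [AddCommGroup Y] [Module R Y] :
    Submodule K (X ⊗[ℤ] Y) :=
  Submodule.span K
    {t | ∃ (a : X) (r : R) (b : Y), t = (MulOpposite.op r • a) ⊗ₜ[ℤ] b - a ⊗ₜ[ℤ] (r • b)}

/-- The tensor product `X ⊗_R Y` over a possibly noncommutative ring `R`, as a `K`-module. -/
abbrev TensorOver (K : Type z) (R : Type u) (X : Type x) (Y : Type y) [CommRing K] [Ring R]
    [AddCommGroup X] [Module K X] [Module Rᵐᵒᵖ X] [SMulCommClass K Rᵐᵒᵖ X]
    [AddCommGroup Y] [Module R Y] :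
    Type (max x y) :=
  (X ⊗[ℤ] Y) ⧸ balancedRelations K R X Y

/-- The `K`-linear map `X ⊗_R Y → X ⊗_R Y'` induced by an `R`-linear map `Y → Y'`. -/
def mapRight (K : Type z) (R : Type u) (X : Type x) {Y Y' : Type y} [CommRing K] [Ring R]
    [AddCommGroup X] [Module K X] [Module Rᵐᵒᵖ X] [SMulCommClass K Rᵐᵒᵖ X]
    [AddCommGroup Y] [Module R Y]
    [AddCommGroup Y'] [Module R Y'] (f : Y →ₗ[R] Y') :
    TensorOver K R X Y →ₗ[K] TensorOver K R X Y' :=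
  Submodule.mapQ _ _
    (TensorProduct.AlgebraTensorModule.map (LinearMap.id : X →ₗ[K] X)
      f.toAddMonoidHom.toIntLinearMap) (by
    rw [balancedRelations, Submodule.span_le]
    rintro _ ⟨a, r, b, rfl⟩
    refine Submodule.subset_span ⟨a, r, f b, ?_⟩
    simp)

section

variable (K : Type z) (R : Type u) (X : Type x) [CommRing K] [Ring R]
  [AddCommGroup X] [Module K X] [Module Rᵐᵒᵖ X] [SMulCommClass K Rᵐᵒᵖ X]

theorem hom_ext {Y : Type y} {Z : Type w} [AddCommGroup Y] [Module R Y] [AddCommGroup Z]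
    [Module K Z] {f g : TensorOver K R X Y →ₗ[K] Z}
    (h : ∀ a b, f (Submodule.Quotient.mk (a ⊗ₜ[ℤ] b)) = g (Submodule.Quotient.mk (a ⊗ₜ[ℤ] b))) :
    f = g := by
  refine LinearMap.ext fun t => ?_
  obtain ⟨t, rfl⟩ := Submodule.Quotient.mk_surjective _ t
  induction t with
  | zero => rw [Submodule.Quotient.mk_zero, map_zero, map_zero]
  | tmul a b => exact h a b
  | add s t hs ht => rw [Submodule.Quotient.mk_add, map_add, hs, ht, map_add]

theorem mapRight_mk {Y Y' : Type y} [AddCommGroup Y] [Module R Y] [AddCommGroup Y'] [Module R Y']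
    (f : Y →ₗ[R] Y') (a : X) (b : Y) :
    mapRight K R X f (Submodule.Quotient.mk (a ⊗ₜ[ℤ] b)) =
      Submodule.Quotient.mk (a ⊗ₜ[ℤ] (f b)) := rfl

/-- The functor `X ⊗_R -` from left `R`-modules to `K`-modules. -/
def tensorFunctor : ModuleCat.{y} R ⥤ ModuleCat.{max x y} K where
  obj Y := ModuleCat.of K (TensorOver K R X Y)
  map f := ModuleCat.ofHom (mapRight K R X f.hom)
  map_id _ := ModuleCat.hom_ext (hom_ext K R X fun _ _ => rfl)
  map_comp _ _ := ModuleCat.hom_ext (hom_ext K R X fun _ _ => rfl)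

instance : (tensorFunctor.{u, x, y, z} K R X).Additive where
  map_add {_ Y' _ _} := ModuleCat.hom_ext (hom_ext K R X fun a _ =>
    congrArg (Submodule.Quotient.mk (p := balancedRelations K R X Y')) (TensorProduct.tmul_add a _ _))

end

/-- A right module structure, given by an anti-homomorphism into the endomorphism ring. -/
abbrev rightModule {K : Type z} {R : Type u} {X : Type x} [CommRing K] [Ring R]
    [AddCommGroup X] [Module K X] (f : R →+* (Module.End K X)ᵐᵒᵖ) : Module Rᵐᵒᵖ X where
  smul r t := (f r.unop).unop t
  one_smul t := by
    change (f 1).unop t = t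
    simp
  mul_smul r s t := by
    change (f (s.unop * r.unop)).unop t = (f r.unop).unop ((f s.unop).unop t)
    simp
  smul_zero r := map_zero _
  smul_add r := map_add _
  add_smul r s t := by
    change (f (r.unop + s.unop)).unop t = (f r.unop).unop t + (f s.unop).unop t
    simp
  zero_smul t := by
    change (f 0).unop t = 0
    simp

/-- `Tor_n^R(X, Y)`: the `n`-th left derived functor of `X ⊗_R -` evaluated at `Y`. The module `Y`
is lifted to a universe in which the category of `R`-modules has enough projectives. -/
def Tor (K : Type z) (R : Type u) (X : Type x) (Y : Type y) [CommRing K] [Ring R]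
    [AddCommGroup X] [Module K X] [Module Rᵐᵒᵖ X] [SMulCommClass K Rᵐᵒᵖ X]
    [AddCommGroup Y] [Module R Y] (n : ℕ) :
    ModuleCat.{max x y u} K :=
  ((tensorFunctor.{u, x, max y u, z} K R X).leftDerived n).obj
    (ModuleCat.of R (ULift.{u, y} Y))

end NCTensor

/-! ## Hochschild homology -/

namespace Hochschild

open scoped TensorProduct

/-- The enveloping algebra `A ⊗_K Aᵒᵖ`. -/
abbrev Enveloping (K : Type z) (A : Type u) [CommRing K] [Ring A] [Algebra K A] : Type u :=
  A ⊗[K] Aᵐᵒᵖ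

/-- An `A`-bimodule `M`, regarded as a left module over the enveloping algebra. -/
def LeftEnv (_K : Type z) (_A : Type u) (M : Type w) : Type w := M

instance (K : Type z) (A : Type u) (M : Type w) [AddCommGroup M] : AddCommGroup (LeftEnv K A M) :=
  inferInstanceAs (AddCommGroup M)

/-- The left action `(a ⊗ b) · x = a · x · b` of the enveloping algebra on a bimodule. -/
instance (K : Type z) (A : Type u) (M : Type w) [CommRing K] [Ring A] [Algebra K A]
    [AddCommGroup M] [Module K M] [Module A M] [Module Aᵐᵒᵖ M] [SMulCommClass A Aᵐᵒᵖ M]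
    [IsScalarTower K A M] [IsScalarTower K Aᵐᵒᵖ M] :
    Module (Enveloping K A) (LeftEnv K A M) :=
  TensorProduct.Algebra.module (R := K) (A := A) (B := Aᵐᵒᵖ) (M := M)

/-- The algebra `A`, regarded as a right module over its enveloping algebra. -/
def RightEnv (_K : Type z) (A : Type u) : Type u := A

instance (K : Type z) (A : Type u) [Ring A] : AddCommGroup (RightEnv K A) :=
  inferInstanceAs (AddCommGroup A)

instance (K : Type z) (A : Type u) [CommRing K] [Ring A] [Algebra K A] :
    Module K (RightEnv K A) :=
  inferInstanceAs (Module K A)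

/-- The anti-homomorphism `a ↦ (x ↦ x * a)` from `A` to the `K`-linear endomorphisms of `A`. -/
def mulRightHom (K : Type z) (A : Type u) [CommRing K] [Ring A] [Algebra K A] :
    A →ₐ[K] (Module.End K A)ᵐᵒᵖ :=
  AlgHom.ofLinearMap
    ((MulOpposite.opLinearEquiv K).toLinearMap ∘ₗ (LinearMap.mul K A).flip)
    (MulOpposite.unop_injective (LinearMap.ext fun x => by simp))
    (fun a b => MulOpposite.unop_injective (LinearMap.ext fun x => by simp [mul_assoc]))

/-- The anti-homomorphism `b ↦ (x ↦ b * x)` from `Aᵒᵖ` to the `K`-linear endomorphisms of `A`. -/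
def mulLeftHom (K : Type z) (A : Type u) [CommRing K] [Ring A] [Algebra K A] :
    Aᵐᵒᵖ →ₐ[K] (Module.End K A)ᵐᵒᵖ :=
  AlgHom.ofLinearMap
    ((MulOpposite.opLinearEquiv K).toLinearMap ∘ₗ LinearMap.mul K A ∘ₗ
      (MulOpposite.opLinearEquiv K).symm.toLinearMap)
    (MulOpposite.unop_injective (LinearMap.ext fun x => by simp))
    (fun a b => MulOpposite.unop_injective (LinearMap.ext fun x => by simp [mul_assoc]))

theorem mulRightHom_commute (K : Type z) (A : Type u) [CommRing K] [Ring A] [Algebra K A]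
    (a : A) (b : Aᵐᵒᵖ) : Commute (mulRightHom K A a) (mulLeftHom K A b) :=
  MulOpposite.unop_injective
    (LinearMap.ext fun x => by simp [mulRightHom, mulLeftHom, mul_assoc])

/-- The anti-homomorphism from the enveloping algebra to the `K`-linear endomorphisms of `A`
that sends `a ⊗ b` to `x ↦ b * x * a`. -/
def rightEnvHom (K : Type z) (A : Type u) [CommRing K] [Ring A] [Algebra K A] :
    Enveloping K A →ₐ[K] (Module.End K A)ᵐᵒᵖ :=
  Algebra.TensorProduct.lift (mulRightHom K A) (mulLeftHom K A) (mulRightHom_commute K A)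

theorem rightEnvHom_tmul (K : Type z) (A : Type u) [CommRing K] [Ring A] [Algebra K A]
    (a : A) (b : Aᵐᵒᵖ) (t : A) :
    (rightEnvHom K A (a ⊗ₜ[K] b)).unop t = b.unop * t * a := by
  simp [rightEnvHom, mulRightHom, mulLeftHom, mul_assoc]

/-- The right action `x · (a ⊗ b) = b * x * a` of the enveloping algebra on `A`. -/
instance (K : Type z) (A : Type u) [CommRing K] [Ring A] [Algebra K A] :
    Module (Enveloping K A)ᵐᵒᵖ (RightEnv K A) :=
  NCTensor.rightModule (X := RightEnv K A) (K := K) (rightEnvHom K A).toRingHom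

instance (K : Type z) (A : Type u) [CommRing K] [Ring A] [Algebra K A] :
    SMulCommClass K (Enveloping K A)ᵐᵒᵖ (RightEnv K A) where
  smul_comm k r t := ((rightEnvHom K A r.unop).unop.map_smul k t).symm

theorem op_tmul_smul (K : Type z) (A : Type u) [CommRing K] [Ring A] [Algebra K A]
    (a : A) (b : Aᵐᵒᵖ) (t : A) :
    (MulOpposite.op (a ⊗ₜ[K] b : Enveloping K A) • (show RightEnv K A from t)) =
      (show RightEnv K A from b.unop * t * a) :=
  rightEnvHom_tmul K A a b t

/-- The Hochschild homology `H_n(A, M) = Tor_n^{A ⊗ Aᵒᵖ}(A, M)`. -/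
def homology (K : Type z) (A : Type u) (M : Type w) [CommRing K] [Ring A] [Algebra K A]
    [AddCommGroup M] [Module K M] [Module A M] [Module Aᵐᵒᵖ M] [SMulCommClass A Aᵐᵒᵖ M]
    [IsScalarTower K A M] [IsScalarTower K Aᵐᵒᵖ M] (n : ℕ) : ModuleCat K :=
  NCTensor.Tor K (Enveloping K A) (RightEnv K A) (LeftEnv K A M) n

end Hochschild

/-! ## Inverse monoids and their homology -/

/-- An inverse monoid: every `s` has a unique generalized inverse `s⁻¹`. -/
class InverseMonoid (S : Type u) extends Monoid S, Inv S where
  mul_inv_mul : ∀ s : S, s * s⁻¹ * s = s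
  inv_mul_inv : ∀ s : S, s⁻¹ * s * s⁻¹ = s⁻¹
  inv_unique : ∀ s t : S, s * t * s = s → t * s * t = t → t = s⁻¹

namespace InverseMonoid

section

variable {S : Type u} [InverseMonoid S]

theorem inv_idem {e : S} (he : e * e = e) : e⁻¹ = e :=
  (inv_unique e e (by rw [he, he]) (by rw [he, he])).symm

theorem idem_mul {e f : S} (he : e * e = e) (hf : f * f = f) : e * f * (e * f) = e * f := by
  have h1 := mul_inv_mul (e * f)
  have h2 := inv_mul_inv (e * f)
  have h3 : f * (e * f)⁻¹ * e = (e * f)⁻¹ := by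
    apply inv_unique
    · calc e * f * (f * (e * f)⁻¹ * e) * (e * f)
          = e * (f * f) * (e * f)⁻¹ * (e * e) * f := by simp only [mul_assoc]
        _ = e * f * (e * f)⁻¹ * (e * f) := by rw [he, hf]; simp only [mul_assoc]
        _ = e * f := h1
    · calc f * (e * f)⁻¹ * e * (e * f) * (f * (e * f)⁻¹ * e)
          = f * (e * f)⁻¹ * (e * e) * (f * f) * (e * f)⁻¹ * e := by simp only [mul_assoc]
        _ = f * ((e * f)⁻¹ * (e * f) * (e * f)⁻¹) * e := by rw [he, hf]; simp only [mul_assoc]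
        _ = f * (e * f)⁻¹ * e := by rw [h2]
  have h4 : (e * f)⁻¹ * (e * f)⁻¹ = (e * f)⁻¹ := by
    calc (e * f)⁻¹ * (e * f)⁻¹ = f * (e * f)⁻¹ * e * (f * (e * f)⁻¹ * e) := by rw [h3]
      _ = f * ((e * f)⁻¹ * (e * f) * (e * f)⁻¹) * e := by simp only [mul_assoc]
      _ = (e * f)⁻¹ := by rw [h2, h3]
  have h5 : e * f = (e * f)⁻¹ := by
    have := inv_unique (e * f)⁻¹ (e * f) h2 h1
    rw [this, inv_idem h4, inv_idem h4]
  rw [h5, h4]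

/-- Idempotents of an inverse monoid commute. -/
theorem idem_comm {e f : S} (he : e * e = e) (hf : f * f = f) : e * f = f * e := by
  have h1 := idem_mul he hf
  have h2 := idem_mul hf he
  have h3 : f * e = (e * f)⁻¹ := by
    apply inv_unique
    · calc e * f * (f * e) * (e * f) = e * (f * f) * (e * e) * f := by simp only [mul_assoc]
        _ = e * f := by rw [he, hf, mul_assoc (e * f), h1]
    · calc f * e * (e * f) * (f * e) = f * (e * e) * (f * f) * e := by simp only [mul_assoc]
        _ = f * e := by rw [he, hf, mul_assoc (f * e), h2]
  rw [h3, inv_idem h1]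

theorem mul_inv_idem (s : S) : s * s⁻¹ * (s * s⁻¹) = s * s⁻¹ := by
  rw [← mul_assoc, mul_inv_mul]

theorem inv_mul_idem (s : S) : s⁻¹ * s * (s⁻¹ * s) = s⁻¹ * s := by
  rw [← mul_assoc, inv_mul_inv]

theorem mul_inv_rev' (s t : S) : (s * t)⁻¹ = t⁻¹ * s⁻¹ := by
  have h := idem_comm (inv_mul_idem s) (mul_inv_idem t)
  symm
  apply inv_unique
  · calc s * t * (t⁻¹ * s⁻¹) * (s * t) = s * (t * t⁻¹ * (s⁻¹ * s)) * t := by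
          simp only [mul_assoc]
      _ = (s * s⁻¹ * s) * (t * t⁻¹ * t) := by rw [← h]; simp only [mul_assoc]
      _ = s * t := by rw [mul_inv_mul, mul_inv_mul]
  · calc t⁻¹ * s⁻¹ * (s * t) * (t⁻¹ * s⁻¹) = t⁻¹ * (s⁻¹ * s * (t * t⁻¹)) * s⁻¹ := by
          simp only [mul_assoc]
      _ = (t⁻¹ * t * t⁻¹) * (s⁻¹ * s * s⁻¹) := by rw [h]; simp only [mul_assoc]
      _ = t⁻¹ * s⁻¹ := by rw [inv_mul_inv, inv_mul_inv]

theorem conj_idem (s : S) {e : S} (he : e * e = e) :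
    s⁻¹ * e * s * (s⁻¹ * e * s) = s⁻¹ * e * s := by
  calc s⁻¹ * e * s * (s⁻¹ * e * s) = s⁻¹ * (e * (s * s⁻¹)) * e * s := by simp only [mul_assoc]
    _ = (s⁻¹ * s * s⁻¹) * (e * e) * s := by
        rw [idem_comm he (mul_inv_idem s)]; simp only [mul_assoc]
    _ = s⁻¹ * e * s := by rw [inv_mul_inv, he]

end

/-- The set `E(S)` of idempotents. -/
abbrev Idem (S : Type u) [InverseMonoid S] : Type u := {e : S // e * e = e}

/-- The map `e ↦ s⁻¹ * e * s` on idempotents. -/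
def conj {S : Type u} [InverseMonoid S] (s : S) (e : Idem S) : Idem S :=
  ⟨s⁻¹ * e.1 * s, conj_idem s e.2⟩

/-- The free `K`-module `K E(S)` on the idempotents of `S`. -/
def IdemModule (K : Type z) (S : Type u) [CommRing K] [InverseMonoid S] : Type (max u z) :=
  Idem S →₀ K

instance (K : Type z) (S : Type u) [CommRing K] [InverseMonoid S] :
    AddCommGroup (IdemModule K S) :=
  inferInstanceAs (AddCommGroup (Idem S →₀ K))

instance (K : Type z) (S : Type u) [CommRing K] [InverseMonoid S] : Module K (IdemModule K S) :=
  inferInstanceAs (Module K (Idem S →₀ K))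

/-- The anti-homomorphism sending `s` to the `K`-linear extension of `e ↦ s⁻¹ * e * s`. -/
def conjHom (K : Type z) (S : Type u) [CommRing K] [InverseMonoid S] :
    S →* (Module.End K (Idem S →₀ K))ᵐᵒᵖ where
  toFun s := MulOpposite.op (Finsupp.lmapDomain K K (conj s))
  map_one' := by
    apply MulOpposite.unop_injective
    refine Finsupp.lhom_ext' fun e => LinearMap.ext_ring ?_
    have h : (1 : S)⁻¹ = 1 := inv_idem (one_mul 1)
    have : conj (1 : S) e = e := Subtype.ext (by simp [conj, h])
    simp [this]
  map_mul' s t := by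
    apply MulOpposite.unop_injective
    refine Finsupp.lhom_ext' fun e => LinearMap.ext_ring ?_
    have : conj (s * t) e = conj t (conj s e) :=
      Subtype.ext (by simp [conj, mul_inv_rev', mul_assoc])
    simp [this]

/-- The right `K S`-module structure on `K E(S)` determined by `e · s = s⁻¹ * e * s`. -/
instance (K : Type z) (S : Type u) [CommRing K] [InverseMonoid S] :
    Module (MonoidAlgebra K S)ᵐᵒᵖ (IdemModule K S) :=
  NCTensor.rightModule (X := IdemModule K S) (K := K)
    (MonoidAlgebra.lift K (Module.End K (Idem S →₀ K))ᵐᵒᵖ S (conjHom K S)).toRingHom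

instance (K : Type z) (S : Type u) [CommRing K] [InverseMonoid S] :
    SMulCommClass K (MonoidAlgebra K S)ᵐᵒᵖ (IdemModule K S) where
  smul_comm k r t :=
    ((MonoidAlgebra.lift K (Module.End K (Idem S →₀ K))ᵐᵒᵖ S
      (conjHom K S) r.unop).unop.map_smul k t).symm

theorem op_of_smul_single (K : Type z) (S : Type u) [CommRing K] [InverseMonoid S]
    (s : S) (e : Idem S) :
    (MulOpposite.op (MonoidAlgebra.of K S s) •
      (show IdemModule K S from Finsupp.single e 1)) =
      (show IdemModule K S from Finsupp.single (conj s e) 1) := by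
  change (MonoidAlgebra.lift K (Module.End K (Idem S →₀ K))ᵐᵒᵖ S
      (conjHom K S) (MonoidAlgebra.of K S s)).unop (Finsupp.single e 1) = _
  simp [conjHom]

/-- The homology `H_n(S, V) = Tor_n^{K S}(K E(S), V)` of an inverse monoid `S` with values in a
left `K S`-module `V`. -/
def homology (K : Type z) (S : Type u) (V : Type w) [CommRing K] [InverseMonoid S]
    [AddCommGroup V] [Module (MonoidAlgebra K S) V] (n : ℕ) : ModuleCat K :=
  NCTensor.Tor K (MonoidAlgebra K S) (IdemModule K S) V n

end InverseMonoid
/-! ## Ample groupoids -/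

namespace AmpleGroupoid

/-- The set of arrows of a groupoid. The elements of `X` are the objects. -/
abbrev Arr (X : Type u) [Groupoid.{v} X] : Type (max u v) := Quiver.Total X

/-- The space of objects of a groupoid, identified with the units; see `unit`. -/
def UnitSpace (X : Type u) : Type u := X

section Algebra

variable {X : Type u} [Groupoid.{v} X]

/-- The source of an arrow. -/
def src (a : Arr X) : UnitSpace X := a.left

/-- The range of an arrow. -/
def rng (a : Arr X) : UnitSpace X := a.right

/-- The identity arrow of an object. -/
def unit (x : UnitSpace X) : Arr X := ⟨x, x, 𝟙 (show X from x)⟩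

/-- The product `αβ` of two arrows with `s(α) = r(β)`: first `β`, then `α`. -/
def comp (a b : Arr X) (h : src a = rng b) : Arr X :=
  ⟨b.left, a.right, b.hom ≫ eqToHom (show b.right = a.left from h.symm) ≫ a.hom⟩

/-- The inverse of an arrow. -/
def inv (a : Arr X) : Arr X := ⟨a.right, a.left, Groupoid.inv a.hom⟩

@[simp] theorem src_unit (x : UnitSpace X) : src (unit x) = x := rfl
@[simp] theorem rng_unit (x : UnitSpace X) : rng (unit x) = x := rfl
@[simp] theorem src_comp (a b : Arr X) (h : src a = rng b) : src (comp a b h) = src b := rfl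
@[simp] theorem rng_comp (a b : Arr X) (h : src a = rng b) : rng (comp a b h) = rng a := rfl
@[simp] theorem src_inv (a : Arr X) : src (inv a) = rng a := rfl
@[simp] theorem rng_inv (a : Arr X) : rng (inv a) = src a := rfl

theorem comp_mk {x y t : X} (a : y ⟶ t) (b : x ⟶ y)
    (h : src (⟨y, t, a⟩ : Arr X) = rng (⟨x, y, b⟩ : Arr X)) :
    comp ⟨y, t, a⟩ ⟨x, y, b⟩ h = ⟨x, t, b ≫ a⟩ := by
  have : b ≫ eqToHom (rfl : y = y) ≫ a = b ≫ a := by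
    rw [eqToHom_refl, Category.id_comp]
  exact congrArg (Quiver.Total.mk x t) this

theorem comp_assoc (a b c : Arr X) (h : src a = rng b) (k : src b = rng c) :
    comp (comp a b h) c ((src_comp a b h).trans k) =
      comp a (comp b c k) (h.trans (rng_comp b c k).symm) := by
  obtain ⟨al, ar, a⟩ := a
  obtain ⟨bl, br, b⟩ := b
  obtain ⟨cl, cr, c⟩ := c
  cases h
  cases k
  have e := Category.assoc c b a
  calc _ = comp (⟨bl, ar, b ≫ a⟩ : Arr X) ⟨cl, bl, c⟩ rfl := by
        congr 1; exact comp_mk a b rfl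
    _ = ⟨cl, ar, c ≫ b ≫ a⟩ := comp_mk _ _ _
    _ = ⟨cl, ar, (c ≫ b) ≫ a⟩ := by rw [e]
    _ = comp (⟨al, ar, a⟩ : Arr X) ⟨cl, al, c ≫ b⟩ rfl := (comp_mk _ _ _).symm
    _ = _ := by
        congr 1; exact (comp_mk b c rfl).symm

theorem unit_comp (a : Arr X) (x : UnitSpace X) (h : src (unit x) = rng a) :
    comp (unit x) a h = a := by
  obtain ⟨al, ar, a⟩ := a
  cases h
  exact (comp_mk _ _ _).trans (congrArg (Quiver.Total.mk _ _) (Category.comp_id _))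

theorem comp_unit (a : Arr X) (x : UnitSpace X) (h : src a = rng (unit x)) :
    comp a (unit x) h = a := by
  obtain ⟨al, ar, a⟩ := a
  cases h
  exact (comp_mk _ _ _).trans (congrArg (Quiver.Total.mk _ _) (Category.id_comp _))

theorem inv_comp (a : Arr X) (h : src (inv a) = rng a) :
    comp (inv a) a h = unit (src a) := by
  obtain ⟨al, ar, a⟩ := a
  exact (comp_mk _ _ _).trans (congrArg (Quiver.Total.mk _ _) (Groupoid.comp_inv _))

theorem comp_inv (a : Arr X) (h : src a = rng (inv a)) :
    comp a (inv a) h = unit (rng a) := by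
  obtain ⟨al, ar, a⟩ := a
  exact (comp_mk _ _ _).trans (congrArg (Quiver.Total.mk _ _) (Groupoid.inv_comp _))

@[simp] theorem inv_inv (a : Arr X) : inv (inv a) = a := by
  obtain ⟨al, ar, a⟩ := a
  simp [inv]

theorem inv_comp_cancel_left (a b : Arr X) (h : src a = rng b) :
    comp (inv a) (comp a b h) rfl = b := by
  have h1 := comp_assoc (inv a) a b rfl h
  rw [← h1]
  have h2 : ∀ (c : Arr X), c = unit (src a) → ∀ k : src c = rng b, comp c b k = b := by
    rintro _ rfl k
    exact unit_comp _ _ _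
  exact h2 _ (inv_comp a rfl) _

theorem inv_comp_cancel (a b : Arr X) (h : rng a = rng b) :
    comp a (comp (inv a) b h) rfl = b := by
  have h1 := inv_comp_cancel_left (inv a) b h
  have h2 : ∀ (c : Arr X), c = inv (inv a) → ∀ k, comp c (comp (inv a) b h) k = b := by
    rintro _ rfl k
    exact h1
  exact h2 a (inv_inv a).symm _

theorem comp_left_cancel {a b c : Arr X} (h : src a = rng b) (k : src a = rng c)
    (e : comp a b h = comp a c k) : b = c := by
  have h2 : ∀ (d e : Arr X), d = e → ∀ (p : src (inv a) = rng d) (q : src (inv a) = rng e),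
      comp (inv a) d p = comp (inv a) e q := by
    rintro d _ rfl p q
    rfl
  rw [← inv_comp_cancel_left a b h, ← inv_comp_cancel_left a c k]
  exact h2 _ _ e _ _

/-- A bisection: a set of arrows on which the source and range maps are injective. -/
def IsBisection (U : Set (Arr X)) : Prop := Set.InjOn src U ∧ Set.InjOn rng U

/-- The product `UV` of two sets of arrows. -/
def setMul (U V : Set (Arr X)) : Set (Arr X) :=
  {c | ∃ a ∈ U, ∃ b ∈ V, ∃ h : src a = rng b, comp a b h = c}

theorem setMul_assoc (U V W : Set (Arr X)) :
    setMul (setMul U V) W = setMul U (setMul V W) := by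
  ext c
  constructor
  · rintro ⟨_, ⟨a, ha, b, hb, h, rfl⟩, d, hd, k, rfl⟩
    exact ⟨a, ha, comp b d k, ⟨b, hb, d, hd, k, rfl⟩, h, (comp_assoc _ _ _ _ _).symm⟩
  · rintro ⟨a, ha, _, ⟨b, hb, d, hd, k, rfl⟩, h, rfl⟩
    exact ⟨comp a b h, ⟨a, ha, b, hb, h, rfl⟩, d, hd, k, comp_assoc _ _ _ _ _⟩

theorem setMul_units (U : Set (Arr X)) : setMul U (Set.range unit) = U := by
  ext c
  constructor
  · rintro ⟨a, ha, _, ⟨x, rfl⟩, h, rfl⟩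
    rwa [comp_unit]
  · intro hc
    exact ⟨c, hc, unit (src c), ⟨_, rfl⟩, rfl, comp_unit _ _ _⟩

theorem units_setMul (U : Set (Arr X)) : setMul (Set.range unit) U = U := by
  ext c
  constructor
  · rintro ⟨_, ⟨x, rfl⟩, a, ha, h, rfl⟩
    rwa [unit_comp]
  · intro hc
    exact ⟨unit (rng c), ⟨_, rfl⟩, c, hc, rfl, unit_comp _ _ _⟩

theorem IsBisection.setMul {U V : Set (Arr X)} (hU : IsBisection U) (hV : IsBisection V) :
    IsBisection (setMul U V) := by
  constructor
  · rintro _ ⟨a, ha, b, hb, h, rfl⟩ _ ⟨a', ha', b', hb', h', rfl⟩ e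
    obtain rfl := hV.1 hb hb' e
    obtain rfl := hU.1 ha ha' (h.trans h'.symm)
    rfl
  · rintro _ ⟨a, ha, b, hb, h, rfl⟩ _ ⟨a', ha', b', hb', h', rfl⟩ e
    obtain rfl := hU.2 ha ha' e
    obtain rfl := hV.2 hb hb' (h.symm.trans h')
    rfl

theorem IsBisection.inv {U : Set (Arr X)} (hU : IsBisection U) :
    IsBisection (inv ⁻¹' U) := by
  constructor
  · intro a ha b hb e
    have := hU.2 ha hb e
    rw [← inv_inv a, this, inv_inv]
  · intro a ha b hb e
    have := hU.1 ha hb e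
    rw [← inv_inv a, this, inv_inv]

theorem isBisection_range_unit : IsBisection (Set.range (unit : UnitSpace X → Arr X)) := by
  constructor
  · rintro _ ⟨x, rfl⟩ _ ⟨y, rfl⟩ e
    exact congrArg unit e
  · rintro _ ⟨x, rfl⟩ _ ⟨y, rfl⟩ e
    exact congrArg unit e

theorem setMul_inv_setMul {U : Set (Arr X)} (hU : IsBisection U) :
    setMul (setMul U (AmpleGroupoid.inv ⁻¹' U)) U = U := by
  ext c
  constructor
  · rintro ⟨_, ⟨a, ha, b, hb, h, rfl⟩, d, hd, k, rfl⟩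
    have h1 : a = AmpleGroupoid.inv b := hU.1 ha hb h
    subst h1
    have h2 : ∀ (e : Arr X), e = unit (src b) → ∀ k : src e = rng d, comp e d k = d := by
      rintro _ rfl k
      exact unit_comp _ _ _
    rwa [h2 _ (inv_comp b _)]
  · intro hc
    exact ⟨unit (rng c), ⟨c, hc, AmpleGroupoid.inv c, by simpa using hc, rfl, comp_inv _ _⟩,
      c, hc, rfl, unit_comp _ _ _⟩

theorem eq_inv_of_setMul {U V : Set (Arr X)} (hU : IsBisection U) (hV : IsBisection V)
    (h1 : setMul (setMul U V) U = U) (h2 : setMul (setMul V U) V = V) :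
    V = AmpleGroupoid.inv ⁻¹' U := by
  have key : ∀ {U V : Set (Arr X)}, IsBisection U → setMul (setMul U V) U = U →
      ∀ a ∈ U, AmpleGroupoid.inv a ∈ V := by
    intro U V hU h1 a ha
    have ha' := ha
    rw [← h1] at ha'
    obtain ⟨_, ⟨b, hb, c, hc, h, rfl⟩, d, hd, k, e⟩ := ha'
    have e1 : d = a := hU.1 hd ha (by rw [← e]; rfl)
    have e2 : b = a := hU.2 hb ha (by rw [← e]; rfl)
    subst e1
    subst e2
    have e3 : c = AmpleGroupoid.inv b := by
      have k' : src c = rng b := k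
      have e0 : comp b (comp c b k') h = b := (comp_assoc b c b h k').symm.trans e
      have h4 : comp c b k' = unit (src b) :=
        comp_left_cancel h rfl (e0.trans (comp_unit b (src b) rfl).symm)
      have e6 := inv_comp_cancel_left c b k'
      have h7 : ∀ (d : Arr X), d = unit (src b) → ∀ p, comp (AmpleGroupoid.inv c) d p = b →
          AmpleGroupoid.inv c = b := by
        rintro _ rfl p q
        rwa [comp_unit] at q
      have h8 := h7 _ h4 _ e6
      rw [← h8, inv_inv]
    rwa [← e3]
  ext a
  constructor
  · exact key hV h2 a
  · intro ha
    have := key hU h1 _ ha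
    rwa [inv_inv] at this

theorem preimage_inv_eq_image (U : Set (Arr X)) : inv ⁻¹' U = inv '' U :=
  (congrFun (Set.image_eq_preimage_of_inverse inv_inv inv_inv) U).symm

end Algebra

section Topology

variable (X : Type u) [Groupoid.{v} X] [TopologicalSpace (Arr X)]

/-- The unit space carries the topology induced from the space of arrows. -/
instance : TopologicalSpace (UnitSpace X) :=
  TopologicalSpace.induced (unit : UnitSpace X → Arr X) inferInstance

/-- A topological groupoid: the product, on composable pairs, and the inversion are continuous. -/
class IsTopologicalGroupoid : Prop where
  continuous_comp : Continuous
    (fun p : {p : Arr X × Arr X // src p.1 = rng p.2} => comp p.1.1 p.1.2 p.2)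
  continuous_inv : Continuous (inv : Arr X → Arr X)

/-- An étale groupoid: the unit space is locally compact and Hausdorff, and the range map is a
local homeomorphism. The space of arrows need not be Hausdorff. -/
class IsEtale : Prop extends IsTopologicalGroupoid X where
  locallyCompactSpace_unitSpace : LocallyCompactSpace (UnitSpace X)
  t2Space_unitSpace : T2Space (UnitSpace X)
  isLocalHomeomorph_rng : IsLocalHomeomorph (rng : Arr X → UnitSpace X)

/-- An ample groupoid: an étale groupoid whose topology has a basis of compact open bisections. -/
class IsAmple : Prop extends IsEtale X where
  isTopologicalBasis : TopologicalSpace.IsTopologicalBasis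
    {U : Set (Arr X) | IsCompact U ∧ IsOpen U ∧ IsBisection U}

attribute [instance] IsEtale.locallyCompactSpace_unitSpace IsEtale.t2Space_unitSpace

variable {X}

theorem continuous_unit : Continuous (unit : UnitSpace X → Arr X) := continuous_induced_dom

theorem isCompact_range_unit [CompactSpace (UnitSpace X)] :
    IsCompact (Set.range (unit : UnitSpace X → Arr X)) :=
  isCompact_range continuous_unit

variable [IsEtale X]

theorem continuous_rng : Continuous (rng : Arr X → UnitSpace X) :=
  (IsEtale.isLocalHomeomorph_rng (X := X)).continuous

theorem continuous_inv : Continuous (inv : Arr X → Arr X) :=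
  IsTopologicalGroupoid.continuous_inv

theorem continuous_src : Continuous (src : Arr X → UnitSpace X) :=
  (continuous_rng.comp continuous_inv : Continuous fun a : Arr X => rng (inv a))

theorem isOpen_range_unit : IsOpen (Set.range (unit : UnitSpace X → Arr X)) := by
  rw [isOpen_iff_mem_nhds]
  rintro _ ⟨x, rfl⟩
  obtain ⟨e, he, hr⟩ := IsEtale.isLocalHomeomorph_rng (X := X) (unit x)
  have hW : IsOpen (e.source ∩ (fun a => unit (rng a)) ⁻¹' e.source) :=
    e.open_source.inter (e.open_source.preimage (continuous_unit.comp continuous_rng))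
  refine Filter.mem_of_superset (hW.mem_nhds ⟨he, he⟩) ?_
  rintro a ⟨ha, hb⟩
  refine ⟨rng a, ?_⟩
  apply e.injOn hb ha
  rw [← hr]
  rfl

theorem isOpen_setMul {U V : Set (Arr X)} (hU : IsOpen U) (hV : IsOpen V) :
    IsOpen (setMul U V) := by
  rw [isOpen_iff_mem_nhds]
  rintro _ ⟨a, ha, b, hb, h, rfl⟩
  obtain ⟨e, he, hr⟩ := IsEtale.isLocalHomeomorph_rng (X := X) a
  have hrng : ∀ x ∈ e.target, rng (e.symm x) = x := fun x hx => by
    rw [hr]; exact e.right_inv hx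
  have hWo : IsOpen (rng ⁻¹' e.target : Set (Arr X)) := e.open_target.preimage continuous_rng
  have hae : rng a ∈ e.target := by rw [hr]; exact e.map_source he
  have hsym : e.symm (rng a) = a := by rw [hr]; exact e.left_inv he
  let t : (rng ⁻¹' e.target : Set (Arr X)) → Arr X := fun c => e.symm (rng c.1)
  have ht : Continuous t :=
    e.continuousOn_symm.comp_continuous (continuous_rng.comp continuous_subtype_val)
      (fun c => c.2)
  let F : (rng ⁻¹' e.target : Set (Arr X)) → {p : Arr X × Arr X // src p.1 = rng p.2} :=
    fun c => ⟨(inv (t c), c.1), hrng _ c.2⟩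
  have hF : Continuous F :=
    Continuous.subtype_mk ((continuous_inv.comp ht).prodMk continuous_subtype_val) _
  have hG := IsTopologicalGroupoid.continuous_comp.comp hF
  have hO : IsOpen (Subtype.val '' (t ⁻¹' U ∩ ((fun p : {p : Arr X × Arr X // src p.1 = rng p.2} =>
      comp p.1.1 p.1.2 p.2) ∘ F) ⁻¹' V)) :=
    hWo.isOpenMap_subtype_val _ ((hU.preimage ht).inter (hV.preimage hG))
  refine Filter.mem_of_superset (hO.mem_nhds ?_) ?_
  · refine ⟨⟨comp a b h, hae⟩, ⟨?_, ?_⟩, rfl⟩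
    · change e.symm (rng a) ∈ U
      rwa [hsym]
    · change comp (inv (e.symm (rng a))) (comp a b h) (hrng _ hae) ∈ V
      have : ∀ (d : Arr X) (hd : d = a) (k : src (inv d) = rng (comp a b h)),
          comp (inv d) (comp a b h) k = b := by
        rintro d rfl k
        exact inv_comp_cancel_left _ _ _
      rwa [this _ hsym (hrng _ hae)]
  · rintro _ ⟨c, ⟨hc, hd⟩, rfl⟩
    exact ⟨t c, hc, _, hd, rfl, inv_comp_cancel (t c) c.1 (hrng _ c.2)⟩

theorem isCompact_setMul {U V : Set (Arr X)} (hU : IsCompact U) (hV : IsCompact V) :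
    IsCompact (setMul U V) := by
  have hcl : IsClosed {p : Arr X × Arr X | src p.1 = rng p.2} :=
    isClosed_eq (continuous_src.comp continuous_fst) (continuous_rng.comp continuous_snd)
  have h1 : IsCompact ((Subtype.val : {p : Arr X × Arr X // src p.1 = rng p.2} → _) ⁻¹'
      (U ×ˢ V)) :=
    hcl.isClosedEmbedding_subtypeVal.isCompact_preimage (hU.prod hV)
  have h2 := h1.image (IsTopologicalGroupoid.continuous_comp (X := X))
  convert h2 using 1
  ext c
  constructor
  · rintro ⟨a, ha, b, hb, h, rfl⟩
    exact ⟨⟨(a, b), h⟩, ⟨ha, hb⟩, rfl⟩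
  · rintro ⟨⟨⟨a, b⟩, h⟩, ⟨ha, hb⟩, rfl⟩
    exact ⟨a, ha, b, hb, h, rfl⟩

end Topology

/-- The compact open bisections of a topological groupoid. -/
structure Bisection (X : Type u) [Groupoid.{v} X] [TopologicalSpace (Arr X)] where
  /-- the underlying set of arrows -/
  carrier : Set (Arr X)
  isCompact : IsCompact carrier
  isOpen : IsOpen carrier
  isBisection : IsBisection carrier

section Bisections

variable {X : Type u} [Groupoid.{v} X] [TopologicalSpace (Arr X)]

theorem Bisection.ext {U V : Bisection X} (h : U.carrier = V.carrier) : U = V := by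
  cases U; cases V; cases h; rfl

variable [IsEtale X]

instance : Mul (Bisection X) where
  mul U V := ⟨setMul U.carrier V.carrier, isCompact_setMul U.isCompact V.isCompact,
    isOpen_setMul U.isOpen V.isOpen, U.isBisection.setMul V.isBisection⟩

/-- The inverse `U⁻¹ = {u⁻¹ | u ∈ U}`. -/
instance : Inv (Bisection X) where
  inv U := ⟨inv ⁻¹' U.carrier, by
    rw [preimage_inv_eq_image]; exact U.isCompact.image continuous_inv,
    U.isOpen.preimage continuous_inv, U.isBisection.inv⟩

instance [CompactSpace (UnitSpace X)] : One (Bisection X) where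
  one := ⟨Set.range unit, isCompact_range_unit, isOpen_range_unit, isBisection_range_unit⟩

theorem Bisection.carrier_mul (U V : Bisection X) :
    (U * V).carrier = setMul U.carrier V.carrier := rfl

theorem Bisection.carrier_inv (U : Bisection X) : (U⁻¹).carrier = inv ⁻¹' U.carrier := rfl

theorem Bisection.carrier_one [CompactSpace (UnitSpace X)] :
    (1 : Bisection X).carrier = Set.range unit := rfl

/-- The inverse monoid of compact open bisections of an étale groupoid with compact unit space. -/
instance [CompactSpace (UnitSpace X)] : InverseMonoid (Bisection X) where
  mul_assoc U V W := Bisection.ext (setMul_assoc _ _ _)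
  one_mul U := Bisection.ext (units_setMul _)
  mul_one U := Bisection.ext (setMul_units _)
  mul_inv_mul U := Bisection.ext (setMul_inv_setMul U.isBisection)
  inv_mul_inv U := Bisection.ext (by
    have := setMul_inv_setMul (U⁻¹).isBisection
    have h : (inv ⁻¹' (U⁻¹).carrier : Set (Arr X)) = U.carrier := by
      ext a; simp [Bisection.carrier_inv]
    rwa [h] at this)
  inv_unique U V h1 h2 := Bisection.ext (eq_inv_of_setMul U.isBisection V.isBisection
    (congrArg Bisection.carrier h1) (congrArg Bisection.carrier h2))

end Bisections
/-! ## Steinberg algebras -/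

section Steinberg

variable (K : Type z) [Field K] (X : Type u) [Groupoid.{v} X]

open Classical in
/-- The function `φ Δ_U`: it sends `γ ∈ U` to `φ (r(γ))`, and vanishes outside of `U`. -/
def delta {K : Type z} [Field K] {X : Type u} [Groupoid.{v} X] (φ : UnitSpace X → K)
    (U : Set (Arr X)) : Arr X → K :=
  fun c => if c ∈ U then φ (rng c) else 0

/-- The characteristic function of a set of arrows. -/
def charFn {X : Type u} [Groupoid.{v} X] (U : Set (Arr X)) : Arr X → K :=
  U.indicator 1

/-- The convolution product `(f * g)(γ) = ∑_{αβ = γ} f(α) g(β)`. -/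
def convolve {K : Type z} [Field K] {X : Type u} [Groupoid.{v} X] (f g : Arr X → K) : Arr X → K :=
  fun c => ∑ᶠ p : {p : Arr X × Arr X // ∃ h : src p.1 = rng p.2, comp p.1 p.2 h = c},
    f p.1.1 * g p.1.2

/-- The `K`-subspace of `K^𝒢` spanned by the characteristic functions of compact open
bisections. -/
def steinbergSubmodule [TopologicalSpace (Arr X)] : Submodule K (Arr X → K) :=
  Submodule.span K (Set.range fun U : Bisection X => charFn K U.carrier)

/-- The underlying vector space of the Steinberg algebra. -/
def SteinbergAlgebra [TopologicalSpace (Arr X)] : Type (max u v z) :=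
  steinbergSubmodule K X

instance [TopologicalSpace (Arr X)] : AddCommGroup (SteinbergAlgebra K X) :=
  inferInstanceAs (AddCommGroup (steinbergSubmodule K X))

instance [TopologicalSpace (Arr X)] : Module K (SteinbergAlgebra K X) :=
  inferInstanceAs (Module K (steinbergSubmodule K X))

variable {K X}

/-- The functions which have finite support on each fibre of the range map. -/
def rowFinite (K : Type z) [Field K] (X : Type u) [Groupoid.{v} X] :
    Submodule K (Arr X → K) where
  carrier := {f | ∀ x : UnitSpace X, {a | rng a = x ∧ f a ≠ 0}.Finite}
  zero_mem' x := by simp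
  add_mem' {f g} hf hg x := ((hf x).union (hg x)).subset (by
    rintro a ⟨ha, h⟩
    by_cases h0 : f a = 0
    · exact Or.inr ⟨ha, fun h1 => h (by simp [h0, h1])⟩
    · exact Or.inl ⟨ha, h0⟩)
  smul_mem' k f hf x := (hf x).subset (by
    rintro a ⟨ha, h⟩
    exact ⟨ha, fun h1 => h (by simp [h1])⟩)

theorem steinbergSubmodule_le_rowFinite [TopologicalSpace (Arr X)] :
    steinbergSubmodule K X ≤ rowFinite K X := by
  refine Submodule.span_le.2 ?_
  rintro _ ⟨U, rfl⟩ x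
  refine Set.Subsingleton.finite ?_
  rintro a ⟨ha, ha'⟩ b ⟨hb, hb'⟩
  have h1 : ∀ c, charFn K U.carrier c ≠ 0 → c ∈ U.carrier := fun c hc =>
    Set.mem_of_indicator_ne_zero hc
  exact U.isBisection.2 (h1 a ha') (h1 b hb') (ha.trans hb.symm)

theorem finite_support {f : Arr X → K} (hf : f ∈ rowFinite K X) (g : Arr X → K) (c : Arr X) :
    (Function.support fun p : {p : Arr X × Arr X //
      ∃ h : src p.1 = rng p.2, comp p.1 p.2 h = c} => f p.1.1 * g p.1.2).Finite := by
  refine Set.Finite.of_finite_image (f := fun p => p.1.1) ((hf (rng c)).subset ?_) ?_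
  · rintro _ ⟨⟨⟨a, b⟩, h, rfl⟩, hp, rfl⟩
    exact ⟨rfl, left_ne_zero_of_mul hp⟩
  · rintro ⟨⟨a, b⟩, h, e⟩ _ ⟨⟨a', b'⟩, h', e'⟩ _ (rfl : a = a')
    obtain rfl := comp_left_cancel h h' (e.trans e'.symm)
    rfl

theorem convolve_add_left {f f' : Arr X → K} (hf : f ∈ rowFinite K X) (hf' : f' ∈ rowFinite K X)
    (g : Arr X → K) : convolve (f + f') g = convolve f g + convolve f' g := by
  funext c
  change _ = convolve f g c + convolve f' g c
  simp only [convolve]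
  rw [← finsum_add_distrib (finite_support hf g c) (finite_support hf' g c)]
  simp [add_mul]

theorem convolve_add_right {f : Arr X → K} (hf : f ∈ rowFinite K X) (g g' : Arr X → K) :
    convolve f (g + g') = convolve f g + convolve f g' := by
  funext c
  change _ = convolve f g c + convolve f g' c
  simp only [convolve]
  rw [← finsum_add_distrib (finite_support hf g c) (finite_support hf g' c)]
  simp [mul_add]

theorem convolve_smul_left (k : K) (f g : Arr X → K) :
    convolve (k • f) g = k • convolve f g := by
  funext c
  change _ = k • convolve f g c
  simp only [convolve]
  rw [smul_finsum]
  simp [mul_assoc]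

theorem convolve_smul_right (k : K) (f g : Arr X → K) :
    convolve f (k • g) = k • convolve f g := by
  funext c
  change _ = k • convolve f g c
  simp only [convolve]
  rw [smul_finsum]
  simp [mul_left_comm]

theorem convolve_zero_left (g : Arr X → K) : convolve 0 g = 0 := by
  funext c
  simp [convolve]

theorem convolve_zero_right (f : Arr X → K) : convolve f 0 = 0 := by
  funext c
  simp [convolve]

theorem convolve_charFn {U V : Set (Arr X)} (hU : IsBisection U) :
    convolve (charFn K U) (charFn K V) = charFn K (setMul U V) := by
  classical
  funext c
  by_cases hc : c ∈ setMul U V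
  · have hc' := hc
    obtain ⟨a, ha, b, hb, h, rfl⟩ := hc'
    rw [convolve, finsum_eq_single _ ⟨(a, b), h, rfl⟩]
    · simp [charFn, ha, hb, hc]
    · rintro ⟨⟨a', b'⟩, h', e⟩ hne
      by_contra h0
      have ha' : a' ∈ U := Set.mem_of_indicator_ne_zero (left_ne_zero_of_mul h0)
      obtain rfl : a' = a := hU.2 ha' ha (congrArg rng e :)
      obtain rfl := comp_left_cancel h' h e
      exact hne rfl
  · have h1 : charFn K (setMul U V) c = 0 := Set.indicator_of_notMem hc _
    rw [h1, convolve]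
    refine finsum_eq_zero_of_forall_eq_zero ?_
    rintro ⟨⟨a, b⟩, h, rfl⟩
    by_contra h0
    exact hc ⟨a, Set.mem_of_indicator_ne_zero (left_ne_zero_of_mul h0), b,
      Set.mem_of_indicator_ne_zero (right_ne_zero_of_mul h0), h, rfl⟩

theorem delta_indicator (U : Set (Arr X)) :
    delta ((rng '' U).indicator (1 : UnitSpace X → K)) U = charFn K U := by
  classical
  funext c
  by_cases hc : c ∈ U
  · simp [delta, charFn, hc, Set.mem_image_of_mem rng hc]
  · simp [delta, charFn, hc]

open Classical in
/-- The extension by zero of a function on the unit space to the space of arrows. -/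
def extendFn (f : UnitSpace X → K) : Arr X → K :=
  fun c => if c = unit (rng c) then f (rng c) else 0

theorem extendFn_indicator (E : Set (UnitSpace X)) :
    extendFn (E.indicator (1 : UnitSpace X → K)) = charFn K (unit '' E) := by
  classical
  funext c
  by_cases hc : c ∈ (unit '' E : Set (Arr X))
  · obtain ⟨x, hx, rfl⟩ := hc
    have : unit x ∈ (unit '' E : Set (Arr X)) := ⟨x, hx, rfl⟩
    simp [extendFn, charFn, hx, this]
  · rw [charFn, Set.indicator_of_notMem hc, extendFn]
    split_ifs with h
    · refine Set.indicator_of_notMem (fun hx => hc ?_) _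
      exact ⟨_, hx, h.symm⟩
    · rfl

variable [TopologicalSpace (Arr X)]

theorem charFn_mem (U : Bisection X) : charFn K U.carrier ∈ steinbergSubmodule K X :=
  Submodule.subset_span ⟨U, rfl⟩

theorem convolve_mem [IsEtale X] {f g : Arr X → K} (hf : f ∈ steinbergSubmodule K X)
    (hg : g ∈ steinbergSubmodule K X) : convolve f g ∈ steinbergSubmodule K X := by
  refine Submodule.span_induction (p := fun f _ => convolve f g ∈ steinbergSubmodule K X)
    ?_ ?_ ?_ ?_ hf
  · rintro _ ⟨U, rfl⟩
    have hU := steinbergSubmodule_le_rowFinite (charFn_mem (K := K) U)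
    refine Submodule.span_induction
      (p := fun g _ => convolve (charFn K U.carrier) g ∈ steinbergSubmodule K X) ?_ ?_ ?_ ?_ hg
    · rintro _ ⟨V, rfl⟩
      change convolve _ (charFn K V.carrier) ∈ _
      rw [convolve_charFn U.isBisection]
      exact charFn_mem (U * V)
    · rw [convolve_zero_right]; exact zero_mem _
    · intro g g' _ _ h h'
      rw [convolve_add_right hU]; exact add_mem h h'
    · intro k g _ h
      rw [convolve_smul_right]; exact Submodule.smul_mem _ k h
  · rw [convolve_zero_left]; exact zero_mem _
  · intro f f' hf hf' h h'
    rw [convolve_add_left (steinbergSubmodule_le_rowFinite hf)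
      (steinbergSubmodule_le_rowFinite hf')]
    exact add_mem h h'
  · intro k f _ h
    rw [convolve_smul_left]; exact Submodule.smul_mem _ k h

namespace SteinbergAlgebra

/-- The function on arrows underlying an element of the Steinberg algebra. -/
def toFun (f : SteinbergAlgebra K X) : Arr X → K := f.1

theorem ext {f g : SteinbergAlgebra K X} (h : f.toFun = g.toFun) : f = g := Subtype.ext h

theorem toFun_mem (f : SteinbergAlgebra K X) : f.toFun ∈ rowFinite K X :=
  steinbergSubmodule_le_rowFinite f.2

/-- The characteristic function `1_U` as an element of the Steinberg algebra. -/
def char (K : Type z) [Field K] (U : Bisection X) : SteinbergAlgebra K X :=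
  ⟨charFn K U.carrier, charFn_mem U⟩

theorem induction {p : SteinbergAlgebra K X → Prop} (hc : ∀ U, p (char K U)) (h0 : p 0)
    (ha : ∀ f g, p f → p g → p (f + g)) (hs : ∀ (k : K) f, p f → p (k • f))
    (f : SteinbergAlgebra K X) : p f := by
  obtain ⟨f, hf⟩ := f
  refine Submodule.span_induction (p := fun f hf => p ⟨f, hf⟩) ?_ h0 ?_ ?_ hf
  · rintro _ ⟨U, rfl⟩
    exact hc U
  · intro f g hf hg h h'
    exact ha ⟨f, hf⟩ ⟨g, hg⟩ h h'
  · intro k f hf h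
    exact hs k ⟨f, hf⟩ h

variable [IsEtale X]

instance : Mul (SteinbergAlgebra K X) where
  mul f g := ⟨convolve f.toFun g.toFun, convolve_mem f.2 g.2⟩

theorem toFun_mul (f g : SteinbergAlgebra K X) :
    (f * g).toFun = convolve f.toFun g.toFun := rfl

protected theorem add_mul (f g h : SteinbergAlgebra K X) : (f + g) * h = f * h + g * h :=
  ext (convolve_add_left f.toFun_mem g.toFun_mem h.toFun)

protected theorem mul_add (f g h : SteinbergAlgebra K X) : f * (g + h) = f * g + f * h :=
  ext (convolve_add_right f.toFun_mem g.toFun h.toFun)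

protected theorem zero_mul (f : SteinbergAlgebra K X) : 0 * f = 0 :=
  ext (convolve_zero_left f.toFun)

protected theorem mul_zero (f : SteinbergAlgebra K X) : f * 0 = 0 :=
  ext (convolve_zero_right f.toFun)

protected theorem smul_mul (k : K) (f g : SteinbergAlgebra K X) : k • f * g = k • (f * g) :=
  ext (convolve_smul_left k f.toFun g.toFun)

protected theorem mul_smul (k : K) (f g : SteinbergAlgebra K X) : f * k • g = k • (f * g) :=
  ext (convolve_smul_right k f.toFun g.toFun)

theorem char_mul (U V : Bisection X) : char K U * char K V = char K (U * V) :=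
  ext (convolve_charFn U.isBisection)

variable [CompactSpace (UnitSpace X)]

protected theorem mul_assoc (f g h : SteinbergAlgebra K X) : f * g * h = f * (g * h) := by
  induction f using induction with
  | h0 => simp only [SteinbergAlgebra.zero_mul]
  | ha f f' hf hf' => simp only [SteinbergAlgebra.add_mul, hf, hf']
  | hs k f hf => simp only [SteinbergAlgebra.smul_mul, hf]
  | hc U =>
    induction g using induction with
    | h0 => simp only [SteinbergAlgebra.zero_mul, SteinbergAlgebra.mul_zero]
    | ha f f' hf hf' => simp only [SteinbergAlgebra.add_mul, SteinbergAlgebra.mul_add, hf, hf']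
    | hs k f hf => simp only [SteinbergAlgebra.smul_mul, SteinbergAlgebra.mul_smul, hf]
    | hc V =>
      induction h using induction with
      | h0 => simp only [SteinbergAlgebra.mul_zero]
      | ha f f' hf hf' => simp only [SteinbergAlgebra.mul_add, hf, hf']
      | hs k f hf => simp only [SteinbergAlgebra.mul_smul, hf]
      | hc W => rw [char_mul, char_mul, char_mul, char_mul, mul_assoc]

protected theorem one_mul' (f : SteinbergAlgebra K X) : char K 1 * f = f := by
  induction f using induction with
  | h0 => rw [SteinbergAlgebra.mul_zero]
  | ha f f' hf hf' => rw [SteinbergAlgebra.mul_add, hf, hf']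
  | hs k f hf => rw [SteinbergAlgebra.mul_smul, hf]
  | hc U => rw [char_mul, one_mul]

protected theorem mul_one' (f : SteinbergAlgebra K X) : f * char K 1 = f := by
  induction f using induction with
  | h0 => rw [SteinbergAlgebra.zero_mul]
  | ha f f' hf hf' => rw [SteinbergAlgebra.add_mul, hf, hf']
  | hs k f hf => rw [SteinbergAlgebra.smul_mul, hf]
  | hc U => rw [char_mul, mul_one]

/-- The Steinberg algebra is unital, with unit the characteristic function of the unit space. -/
instance : Ring (SteinbergAlgebra K X) where
  __ := (inferInstance : AddCommGroup (SteinbergAlgebra K X))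
  mul_assoc := SteinbergAlgebra.mul_assoc
  one := char K 1
  one_mul := SteinbergAlgebra.one_mul'
  mul_one := SteinbergAlgebra.mul_one'
  left_distrib := SteinbergAlgebra.mul_add
  right_distrib := SteinbergAlgebra.add_mul
  zero_mul := SteinbergAlgebra.zero_mul
  mul_zero := SteinbergAlgebra.mul_zero

instance : Algebra K (SteinbergAlgebra K X) :=
  Algebra.ofModule SteinbergAlgebra.smul_mul SteinbergAlgebra.mul_smul

theorem char_one : char K (1 : Bisection X) = 1 := rfl

end SteinbergAlgebra

/-! ## Locally constant functions on the unit space -/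

section LocallyConstant

variable [IsEtale X]

theorem isOpen_image_unit {E : Set (UnitSpace X)} (hE : IsOpen E) : IsOpen (unit '' E) :=
  (Topology.IsInducing.mk rfl : Topology.IsInducing (unit : UnitSpace X → Arr X)).isOpenMap
    isOpen_range_unit E hE

variable [CompactSpace (UnitSpace X)]

/-- A clopen subset of the unit space, as a compact open bisection. -/
def Bisection.ofClopen (E : Set (UnitSpace X)) (hE : IsClopen E) : Bisection X where
  carrier := unit '' E
  isCompact := hE.1.isCompact.image continuous_unit
  isOpen := isOpen_image_unit hE.2
  isBisection := ⟨isBisection_range_unit.1.mono (Set.image_subset_range _ _),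
    isBisection_range_unit.2.mono (Set.image_subset_range _ _)⟩

theorem extendFn_eq_sum (f : LocallyConstant (UnitSpace X) K) :
    extendFn f = ∑ k ∈ f.range_finite.toFinset,
      k • charFn K (Bisection.ofClopen (f ⁻¹' {k}) (f.2.isClopen_fiber k)).carrier := by
  classical
  funext c
  rw [Finset.sum_apply]
  simp only [Bisection.ofClopen, ← extendFn_indicator, Pi.smul_apply, smul_eq_mul]
  by_cases h : c = unit (rng c)
  · simp only [extendFn, if_pos h]
    rw [Finset.sum_eq_single (f (rng c))]
    · simp
    · intro k _ hk
      have : rng c ∉ f ⁻¹' {k} := fun h' => hk h'.symm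
      rw [Set.indicator_of_notMem this, mul_zero]
    · intro h'
      exact absurd (by simp) h'
  · simp [extendFn, if_neg h]

theorem extendFn_mem (f : LocallyConstant (UnitSpace X) K) :
    extendFn f ∈ steinbergSubmodule K X := by
  rw [extendFn_eq_sum]
  exact Submodule.sum_mem _ fun k _ => Submodule.smul_mem _ k (charFn_mem _)

/-- A locally constant function on the unit space, regarded as an element of the Steinberg
algebra. -/
def ofLocallyConstant (f : LocallyConstant (UnitSpace X) K) : SteinbergAlgebra K X :=
  ⟨extendFn f, extendFn_mem f⟩

theorem ofLocallyConstant_eq_sum (f : LocallyConstant (UnitSpace X) K) :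
    ofLocallyConstant f = ∑ k ∈ f.range_finite.toFinset,
      k • SteinbergAlgebra.char K (Bisection.ofClopen (f ⁻¹' {k}) (f.2.isClopen_fiber k)) := by
  apply Subtype.ext
  refine (extendFn_eq_sum f).trans ?_
  exact (map_sum (steinbergSubmodule K X).subtype (fun k : K => k • SteinbergAlgebra.char K
    (Bisection.ofClopen (f ⁻¹' {k}) (f.2.isClopen_fiber k))) f.range_finite.toFinset).symm

theorem exists_ofLocallyConstant_eq_char {W : Bisection X} (hW : W * W = W) :
    ∃ f : LocallyConstant (UnitSpace X) K, ofLocallyConstant f = SteinbergAlgebra.char K W := by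
  have h1 : W.carrier ⊆ Set.range unit := by
    intro a ha
    have hW' : setMul W.carrier W.carrier = W.carrier := congrArg Bisection.carrier hW
    have ha' := ha
    rw [← hW'] at ha'
    obtain ⟨b, hb, c, hc, h, e⟩ := ha'
    have e1 : b = a := W.isBisection.2 hb ha (by rw [← e]; rfl)
    subst e1
    have h3 : c = unit (src b) :=
      comp_left_cancel h rfl (e.trans (comp_unit b (src b) rfl).symm)
    have h4 : c = b := W.isBisection.1 hc hb (by rw [← e]; rfl)
    exact ⟨src b, h3.symm.trans h4⟩
  have h2 : IsOpen (unit ⁻¹' W.carrier : Set (UnitSpace X)) := W.isOpen.preimage continuous_unit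
  have h3 : (unit '' (unit ⁻¹' W.carrier) : Set (Arr X)) = W.carrier :=
    Set.image_preimage_eq_of_subset h1
  have h4 : IsCompact (unit ⁻¹' W.carrier : Set (UnitSpace X)) := by
    have := W.isCompact
    rw [← h3] at this
    exact (Topology.IsInducing.mk rfl : Topology.IsInducing
      (unit : UnitSpace X → Arr X)).isCompact_iff.2 this
  have h5 : IsClopen (unit ⁻¹' W.carrier : Set (UnitSpace X)) := ⟨h4.isClosed, h2⟩
  refine ⟨LocallyConstant.charFn K h5, ?_⟩
  apply Subtype.ext
  change extendFn _ = charFn K W.carrier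
  rw [LocallyConstant.coe_charFn, extendFn_indicator, h3]

end LocallyConstant

/-! ## The action of compact open bisections on a bimodule -/

section Action

/-- The element `1_{r(U)} Δ_U` of the Steinberg algebra. -/
def sliceElt (K : Type z) [Field K] (U : Bisection X) : SteinbergAlgebra K X :=
  ⟨delta ((rng '' U.carrier).indicator 1) U.carrier, by
    rw [delta_indicator]; exact charFn_mem U⟩

theorem sliceElt_eq_char (U : Bisection X) : sliceElt K U = SteinbergAlgebra.char K U :=
  Subtype.ext (delta_indicator U.carrier)

variable [IsEtale X] [CompactSpace (UnitSpace X)]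

theorem sliceElt_mul (U V : Bisection X) : sliceElt K (U * V) = sliceElt K U * sliceElt K V := by
  simp only [sliceElt_eq_char, SteinbergAlgebra.char_mul]

theorem sliceElt_one : sliceElt K (1 : Bisection X) = 1 := sliceElt_eq_char 1

open InverseMonoid in
theorem slice_comm (U : Bisection X) (f : LocallyConstant (UnitSpace X) K) :
    ∃ g ∈ Submodule.span K (Set.range (ofLocallyConstant : LocallyConstant (UnitSpace X) K → _)),
      sliceElt K U * ofLocallyConstant f = g * sliceElt K U ∧
      ofLocallyConstant f * sliceElt K U⁻¹ = sliceElt K U⁻¹ * g := by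
  simp only [sliceElt_eq_char, ofLocallyConstant_eq_sum f]
  refine Finset.sum_induction _ (fun a => ∃ g ∈ Submodule.span K
    (Set.range (ofLocallyConstant : LocallyConstant (UnitSpace X) K → _)),
      SteinbergAlgebra.char K U * a = g * SteinbergAlgebra.char K U ∧
      a * SteinbergAlgebra.char K U⁻¹ = SteinbergAlgebra.char K U⁻¹ * g) ?_ ?_ ?_
  · rintro a b ⟨g, hg, h1, h2⟩ ⟨g', hg', h1', h2'⟩
    exact ⟨g + g', add_mem hg hg', by rw [mul_add, add_mul, h1, h1'],
      by rw [mul_add, add_mul, h2, h2']⟩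
  · exact ⟨0, zero_mem _, by simp, by simp⟩
  · intro k _
    generalize hE : Bisection.ofClopen (f ⁻¹' {k}) (f.2.isClopen_fiber k) = E
    have hEE : E * E = E := by
      subst hE
      apply Bisection.ext
      ext c
      constructor
      · rintro ⟨_, ⟨x, hx, rfl⟩, b, hb, h, rfl⟩
        rwa [unit_comp]
      · rintro ⟨x, hx, rfl⟩
        exact ⟨unit x, ⟨x, hx, rfl⟩, unit x, ⟨x, hx, rfl⟩, rfl, unit_comp _ _ _⟩
    have hc := idem_comm hEE (inv_mul_idem U)
    have e1 : U * E * U⁻¹ * U = U * E := by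
      calc U * E * U⁻¹ * U = U * (E * (U⁻¹ * U)) := by simp only [mul_assoc]
        _ = U * U⁻¹ * U * E := by rw [hc]; simp only [mul_assoc]
        _ = U * E := by rw [mul_inv_mul]
    have e2 : U⁻¹ * (U * E * U⁻¹) = E * U⁻¹ := by
      calc U⁻¹ * (U * E * U⁻¹) = (U⁻¹ * U * E) * U⁻¹ := by simp only [mul_assoc]
        _ = E * (U⁻¹ * U * U⁻¹) := by rw [← hc]; simp only [mul_assoc]
        _ = E * U⁻¹ := by rw [inv_mul_inv]
    have e3 : U * E * U⁻¹ * (U * E * U⁻¹) = U * E * U⁻¹ := by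
      calc U * E * U⁻¹ * (U * E * U⁻¹) = (U * E * U⁻¹ * U) * (E * U⁻¹) := by
            simp only [mul_assoc]
        _ = U * (E * E) * U⁻¹ := by rw [e1]; simp only [mul_assoc]
        _ = U * E * U⁻¹ := by rw [hEE]
    obtain ⟨g, hg⟩ := exists_ofLocallyConstant_eq_char (K := K) e3
    refine ⟨k • SteinbergAlgebra.char K (U * E * U⁻¹), Submodule.smul_mem _ _
      (Submodule.subset_span ⟨g, hg⟩), ?_, ?_⟩
    · rw [mul_smul_comm, smul_mul_assoc, SteinbergAlgebra.char_mul, SteinbergAlgebra.char_mul, e1]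
    · rw [mul_smul_comm, smul_mul_assoc, SteinbergAlgebra.char_mul, SteinbergAlgebra.char_mul, e2]

variable (K X) (M : Type w) [AddCommGroup M] [Module K M]
  [Module (SteinbergAlgebra K X) M] [Module (SteinbergAlgebra K X)ᵐᵒᵖ M]
  [SMulCommClass (SteinbergAlgebra K X) (SteinbergAlgebra K X)ᵐᵒᵖ M]
  [IsScalarTower K (SteinbergAlgebra K X) M] [IsScalarTower K (SteinbergAlgebra K X)ᵐᵒᵖ M]

/-- The `K`-subspace `[L, M]` of a bimodule `M` generated by the elements `f · x - x · f`, for `f`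
a locally constant function on the unit space. -/
def commutator : Submodule K M :=
  Submodule.span K {y | ∃ (f : LocallyConstant (UnitSpace X) K) (x : M),
    y = ofLocallyConstant f • x - MulOpposite.op (ofLocallyConstant f) • x}

/-- The action `U · x = (1_{r(U)} Δ_U) · x · (1_{s(U)} Δ_{U⁻¹})` of compact open bisections on a
bimodule. -/
def bisectionRep : Representation K (Bisection X) M where
  toFun U :=
    { toFun := fun x => sliceElt K U • MulOpposite.op (sliceElt K U⁻¹) • x
      map_add' := fun x y => by simp only [smul_add]
      map_smul' := fun k x => by
        simp only [RingHom.id_apply]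
        rw [smul_comm _ k x, smul_comm _ k] }
  map_one' := by
    ext x
    have : (1 : Bisection X)⁻¹ = 1 := InverseMonoid.inv_idem (by simp)
    simp [this, sliceElt_one]
  map_mul' U V := by
    ext x
    simp only [LinearMap.coe_mk, AddHom.coe_mk, Module.End.mul_apply, sliceElt_mul,
      InverseMonoid.mul_inv_rev', MulOpposite.op_mul, mul_smul]
    rw [smul_comm (sliceElt K V) (MulOpposite.op (sliceElt K U⁻¹))]

theorem commutator_le_comap (U : Bisection X) :
    commutator K X M ≤ (commutator K X M).comap (bisectionRep K X M U) := by
  refine Submodule.span_le.2 ?_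
  rintro _ ⟨f, x, rfl⟩
  obtain ⟨g, hg, h1, h2⟩ := slice_comm U f
  change sliceElt K U • MulOpposite.op (sliceElt K U⁻¹) • (_ - _) ∈ commutator K X M
  have key : ∀ g ∈ Submodule.span K
      (Set.range (ofLocallyConstant : LocallyConstant (UnitSpace X) K → _)), ∀ y : M,
      g • y - MulOpposite.op g • y ∈ commutator K X M := by
    intro g hg y
    refine Submodule.span_induction
      (p := fun g _ => g • y - MulOpposite.op g • y ∈ commutator K X M) ?_ ?_ ?_ ?_ hg
    · rintro _ ⟨f, rfl⟩
      exact Submodule.subset_span ⟨f, y, rfl⟩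
    · simp
    · intro a b _ _ ha hb
      have := add_mem ha hb
      rw [add_smul, MulOpposite.op_add, add_smul]
      convert this using 1
      abel
    · intro k a _ ha
      have := Submodule.smul_mem _ k ha
      rw [smul_assoc, MulOpposite.op_smul, smul_assoc, ← smul_sub]
      exact this
  convert key g hg (sliceElt K U • MulOpposite.op (sliceElt K U⁻¹) • x) using 1
  rw [smul_sub, smul_sub]
  congr 1
  · rw [← smul_comm (ofLocallyConstant f) (MulOpposite.op (sliceElt K U⁻¹)) x, smul_smul, h1,
      mul_smul]
  · rw [smul_smul (MulOpposite.op (sliceElt K U⁻¹)), ← MulOpposite.op_mul, h2,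
      MulOpposite.op_mul, mul_smul, smul_comm (sliceElt K U) (MulOpposite.op g)]

/-- The induced action of compact open bisections on the quotient `M / [L, M]`. -/
def quotientRep : Representation K (Bisection X) (M ⧸ commutator K X M) :=
  (bisectionRep K X M).quotient (commutator K X M) (commutator_le_comap K X M)

end Action

end Steinberg

end AmpleGroupoid

end

/-! Write `A` for the Steinberg algebra, `Aᵉ` for its enveloping algebra and `S` for the monoid of
compact open bisections. The theorem is a change of rings along the functor `M ↦ M / [L, M]` from
`Aᵉ`-modules to `KS`-modules. Three facts about this functor suffice: it is exact, it sends
projectives to flat modules, and `A ⊗_{Aᵉ} M` is naturally `KE(S) ⊗_{KS} M / [L, M]`. Applied to a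
projective resolution of `M`, it then yields a flat resolution of `M / [L, M]`, and tensoring that
with `KE(S)` gives the Hochschild complex up to isomorphism. A flat resolution computes `Tor` by
dimension shifting (`exists_homology_equiv`).

Exactness. The subspace `[L, M]` is the sum of the images of the operators `d_E = 1_E ⊗ 1 - 1 ⊗
1_E`, with `E` idempotent. Each is a difference of two commuting idempotents, so `d_E³ = d_E`, and
they commute with each other. Hence `1 - d_E²` kills the image of `d_E` and is the identity modulo
that image. A finite product of such operators kills any given element of `[L, N]`; applying the
same product to a preimage corrects this preimage by an element of `[L, M]`
(`exists_mem_iSup_range_of_map_mem`, `coinvMap_exact`).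

Flatness. For a right `KS`-module `W` and a free module `Aᵉ ⊗ V`, the rule `w ⊗ [1_U ⊗ a ⊗ v] ↦ wU ⊗
a 1_U ⊗ v` embeds the tensor product over `KS` into the quotient of `W ⊗ A ⊗ V` by `wE ⊗ a ⊗ v = w ⊗
aE ⊗ v`. The operators defining this quotient again commute and satisfy `d³ = d`, so it preserves
injections in `W` (`isFlat_coinvariants_free`). That the rule is linear in `1_U` needs the universal
property of the Steinberg algebra (`exists_linearMap_char`): a function of bisections that is
additive under clopen partitions of the source extends linearly. This is proved over small clopen
sets and globalized by compactness, without assuming the arrow space Hausdorff.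

Degree zero. In `KE(S) ⊗_{KS} M / [L, M]` every tensor can be written with the idempotent `1` on the
left, and there `1 ⊗ [am] = 1 ⊗ [ma]` for all `a` in `A`. This gives mutually inverse maps `a ⊗ m ↦
1 ⊗ [am]` and `E ⊗ [m] ↦ 1_E ⊗ m` (`envEquivIdem`). -/

noncomputable section

/-! ### Exactness of tensor products over a noncommutative ring -/

namespace NCTensor

open scoped TensorProduct
open Function (Injective Surjective Exact)

/-- The condition `hr` allows a representative `n` with `g n ∈ r` to be changed by an element of `q`
until it lies in the kernel of `g`; exactness upstairs then applies. -/
theorem mapQ_exact {K : Type*} [Ring K] {M N P : Type*} [AddCommGroup M] [AddCommGroup N]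
    [AddCommGroup P] [Module K M] [Module K N] [Module K P] {f : M →ₗ[K] N} {g : N →ₗ[K] P}
    {p : Submodule K M} {q : Submodule K N} {r : Submodule K P} (hfg : Exact f g)
    (hp : p ≤ q.comap f) (hq : q ≤ r.comap g) (hr : ∀ n, g n ∈ r → g n ∈ q.map g) :
    Exact (p.mapQ q f hp) (q.mapQ r g hq) := by
  intro t
  obtain ⟨n, rfl⟩ := Submodule.Quotient.mk_surjective _ t
  constructor
  · intro h
    rw [Submodule.mapQ_apply, Submodule.Quotient.mk_eq_zero] at h
    obtain ⟨n', hn', e⟩ := hr n h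
    obtain ⟨m, hm⟩ := (hfg (n - n')).1 (by rw [map_sub, e, sub_self])
    refine ⟨Submodule.Quotient.mk m, ?_⟩
    rw [Submodule.mapQ_apply, hm, Submodule.Quotient.eq]
    simpa using hn'
  · rintro ⟨s, hs⟩
    obtain ⟨m, rfl⟩ := Submodule.Quotient.mk_surjective _ s
    rw [← hs, Submodule.mapQ_apply, Submodule.mapQ_apply, hfg.apply_apply_eq_zero,
      Submodule.Quotient.mk_zero]

section Basic

variable {K : Type z} {R : Type u} {X : Type x} {Y : Type y} [CommRing K] [Ring R]
  [AddCommGroup X] [Module K X] [Module Rᵐᵒᵖ X] [SMulCommClass K Rᵐᵒᵖ X]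
  [AddCommGroup Y] [Module R Y]

variable (K R) in
/-- The class of the pure tensor `a ⊗ b`. -/
def tmul (a : X) (b : Y) : TensorOver K R X Y := Submodule.Quotient.mk (a ⊗ₜ[ℤ] b)

theorem op_smul_tmul (a : X) (r : R) (b : Y) :
    tmul K R (MulOpposite.op r • a) b = tmul K R a (r • b) :=
  (Submodule.Quotient.eq _).2 (Submodule.subset_span ⟨a, r, b, rfl⟩)

theorem tmul_add (a : X) (b b' : Y) : tmul K R a (b + b') = tmul K R a b + tmul K R a b' :=
  congrArg Submodule.Quotient.mk (TensorProduct.tmul_add a b b')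

theorem add_tmul (a a' : X) (b : Y) : tmul K R (a + a') b = tmul K R a b + tmul K R a' b :=
  congrArg Submodule.Quotient.mk (TensorProduct.add_tmul a a' b)

theorem smul_tmul (k : K) (a : X) (b : Y) : tmul K R (k • a) b = k • tmul K R a b := rfl

theorem tmul_zero (a : X) : tmul K R a (0 : Y) = 0 :=
  congrArg Submodule.Quotient.mk (TensorProduct.tmul_zero Y a)

theorem zero_tmul (b : Y) : tmul K R (0 : X) b = 0 :=
  congrArg Submodule.Quotient.mk (TensorProduct.zero_tmul X b)

theorem tensorOver_induction {p : TensorOver K R X Y → Prop} (h0 : p 0)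
    (ht : ∀ a b, p (tmul K R a b)) (ha : ∀ s t, p s → p t → p (s + t)) (t : TensorOver K R X Y) :
    p t := by
  obtain ⟨t, rfl⟩ := Submodule.Quotient.mk_surjective _ t
  induction t with
  | zero => exact h0
  | tmul a b => exact ht a b
  | add s t hs ht => exact ha _ _ hs ht

/-- The linear map on `X ⊗_R Y` induced by a balanced biadditive map. -/
def lift {Z : Type w} [AddCommGroup Z] [Module K Z] (f : X →ₗ[K] Y →ₗ[ℤ] Z)
    (hf : ∀ a (r : R) b, f (MulOpposite.op r • a) b = f a (r • b)) : TensorOver K R X Y →ₗ[K] Z :=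
  (balancedRelations K R X Y).liftQ (TensorProduct.AlgebraTensorModule.lift f) (by
    rw [balancedRelations, Submodule.span_le]
    rintro _ ⟨a, r, b, rfl⟩
    simp [hf])

@[simp] theorem lift_tmul {Z : Type w} [AddCommGroup Z] [Module K Z] (f : X →ₗ[K] Y →ₗ[ℤ] Z)
    (hf : ∀ a (r : R) b, f (MulOpposite.op r • a) b = f a (r • b)) (a : X) (b : Y) :
    lift f hf (tmul K R a b) = f a b := by
  simp [lift, tmul]

@[simp] theorem mapRight_tmul {Y' : Type y} [AddCommGroup Y'] [Module R Y'] (f : Y →ₗ[R] Y')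
    (a : X) (b : Y) : mapRight K R X f (tmul K R a b) = tmul K R a (f b) := rfl

variable {Y' Y'' : Type y} [AddCommGroup Y'] [Module R Y'] [AddCommGroup Y''] [Module R Y'']

theorem mapRight_surjective {f : Y →ₗ[R] Y'} (hf : Surjective f) :
    Surjective (mapRight K R X f) := by
  intro t
  induction t using tensorOver_induction with
  | h0 => exact ⟨0, map_zero _⟩
  | ht a b =>
    obtain ⟨b, rfl⟩ := hf b
    exact ⟨tmul K R a b, rfl⟩
  | ha s t hs ht =>
    obtain ⟨s, rfl⟩ := hs
    obtain ⟨t, rfl⟩ := ht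
    exact ⟨s + t, map_add _ _ _⟩

/-- Right exactness over `ℤ` descends to the balanced quotient: as `g` is surjective, every
balancing relation for `Y''` lifts to one for `Y'`, which is the condition `mapQ_exact` asks for. -/
theorem mapRight_exact {f : Y →ₗ[R] Y'} {g : Y' →ₗ[R] Y''} (hfg : Exact f g)
    (hg : Surjective g) : Exact (mapRight K R X f) (mapRight K R X g) := by
  refine mapQ_exact ?_ _ _ fun _ h => (?_ : _ ≤ Submodule.map _ _) h
  · exact lTensor_exact X (f := f.toAddMonoidHom.toIntLinearMap)
      (g := g.toAddMonoidHom.toIntLinearMap) hfg hg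
  · rw [balancedRelations, Submodule.span_le]
    rintro _ ⟨a, r, b, rfl⟩
    obtain ⟨b, rfl⟩ := hg b
    exact ⟨_, Submodule.subset_span ⟨a, r, b, rfl⟩, by simp⟩

end Basic

section Left

variable (K : Type z) (R : Type u) {X X' X'' : Type x} (Y : Type y) [CommRing K] [Ring R]
  [Algebra K R]
  [AddCommGroup X] [Module K X] [Module Rᵐᵒᵖ X] [IsScalarTower K Rᵐᵒᵖ X]
  [AddCommGroup X'] [Module K X'] [Module Rᵐᵒᵖ X'] [IsScalarTower K Rᵐᵒᵖ X']
  [AddCommGroup X''] [Module K X''] [Module Rᵐᵒᵖ X''] [IsScalarTower K Rᵐᵒᵖ X'']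
  [AddCommGroup Y] [Module R Y]

/-- The map `X ⊗_R Y → X' ⊗_R Y` induced by a map `X → X'` of right `R`-modules. -/
def mapLeft (f : X →ₗ[Rᵐᵒᵖ] X') : TensorOver K R X Y →ₗ[K] TensorOver K R X' Y :=
  Submodule.mapQ _ _
    (TensorProduct.AlgebraTensorModule.map (f.restrictScalars K) (LinearMap.id : Y →ₗ[ℤ] Y)) (by
    rw [balancedRelations, Submodule.span_le]
    rintro _ ⟨a, r, b, rfl⟩
    refine Submodule.subset_span ⟨f a, r, b, ?_⟩
    simp)

@[simp] theorem mapLeft_tmul (f : X →ₗ[Rᵐᵒᵖ] X') (a : X) (b : Y) :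
    mapLeft K R Y f (tmul K R a b) = tmul K R (f a) b := rfl

theorem mapLeft_surjective {f : X →ₗ[Rᵐᵒᵖ] X'} (hf : Surjective f) :
    Surjective (mapLeft K R Y f) := by
  intro t
  induction t using tensorOver_induction with
  | h0 => exact ⟨0, map_zero _⟩
  | ht a b =>
    obtain ⟨a, rfl⟩ := hf a
    exact ⟨tmul K R a b, rfl⟩
  | ha s t hs ht =>
    obtain ⟨s, rfl⟩ := hs
    obtain ⟨t, rfl⟩ := ht
    exact ⟨s + t, map_add _ _ _⟩

theorem mapLeft_exact {f : X →ₗ[Rᵐᵒᵖ] X'} {g : X' →ₗ[Rᵐᵒᵖ] X''} (hfg : Exact f g)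
    (hg : Surjective g) : Exact (mapLeft K R Y f) (mapLeft K R Y g) := by
  refine mapQ_exact ?_ _ _ fun _ h => (?_ : _ ≤ Submodule.map _ _) h
  · exact rTensor_exact Y (f := f.toAddMonoidHom.toIntLinearMap)
      (g := g.toAddMonoidHom.toIntLinearMap) hfg hg
  · rw [balancedRelations, Submodule.span_le]
    rintro _ ⟨a, r, b, rfl⟩
    obtain ⟨a, rfl⟩ := hg a
    exact ⟨_, Submodule.subset_span ⟨a, r, b, rfl⟩, by simp⟩

theorem mapLeft_mapRight {Y Y' : Type y} [AddCommGroup Y] [Module R Y] [AddCommGroup Y']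
    [Module R Y'] (f : X →ₗ[Rᵐᵒᵖ] X') (g : Y →ₗ[R] Y') (t : TensorOver K R X Y) :
    mapLeft K R Y' f (mapRight K R X g t) = mapRight K R X' g (mapLeft K R Y f t) := by
  induction t using tensorOver_induction with
  | h0 => simp only [map_zero]
  | ht a b => rfl
  | ha s t hs ht => simp only [map_add, hs, ht]

/-- The natural transformation `X ⊗_R - ⟶ X' ⊗_R -` induced by a map of right `R`-modules. -/
def tensorFunctorMap (f : X →ₗ[Rᵐᵒᵖ] X') :
    tensorFunctor.{u, x, y, z} K R X ⟶ tensorFunctor.{u, x, y, z} K R X' where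
  app Y := ModuleCat.ofHom (mapLeft K R Y f)
  naturality _ _ g := ModuleCat.hom_ext (LinearMap.ext fun t =>
    mapLeft_mapRight K R f g.hom t)

end Left

/-! ### Flat left modules, and free modules on either side -/

section Flat

/-- A left `R`-module is flat if tensoring with it preserves injectivity of maps between right
`R`-modules. -/
def IsFlat (K : Type z) (R : Type u) (N : Type y) [CommRing K] [Ring R] [Algebra K R]
    [AddCommGroup N] [Module R N] : Prop :=
  ∀ ⦃X X' : Type u⦄ [AddCommGroup X] [Module K X] [Module Rᵐᵒᵖ X] [IsScalarTower K Rᵐᵒᵖ X]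
    [AddCommGroup X'] [Module K X'] [Module Rᵐᵒᵖ X'] [IsScalarTower K Rᵐᵒᵖ X']
    (f : X →ₗ[Rᵐᵒᵖ] X'), Injective f → Injective (mapLeft K R N f)

variable {K : Type z} {R : Type u} [Ring R]

/-- After composition with the map induced by `i`, the map in question factors as a split injection
followed by the injection that flatness of `N'` provides. -/
theorem IsFlat.of_retract [CommRing K] [Algebra K R] {N N' : Type y} [AddCommGroup N]
    [Module R N] [AddCommGroup N'] [Module R N'] (hN : IsFlat K R N') (i : N →ₗ[R] N')
    (p : N' →ₗ[R] N) (hpi : ∀ n, p (i n) = n) : IsFlat K R N := by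
  intro X X' _ _ _ _ _ _ _ _ f hf
  have h1 : ∀ t, mapRight K R X p (mapRight K R X i t) = t := by
    intro t
    induction t using tensorOver_induction with
    | h0 => simp only [map_zero]
    | ht a b => simp [hpi]
    | ha s t hs ht => simp only [map_add, hs, ht]
  refine Injective.of_comp (f := mapRight K R X' i) ?_
  have h2 : ⇑(mapRight K R X' i) ∘ ⇑(mapLeft K R N f) =
      ⇑(mapLeft K R N' f) ∘ ⇑(mapRight K R X i) :=
    funext fun t => (mapLeft_mapRight K R f i t).symm
  rw [h2]
  exact (hN f hf).comp (Function.LeftInverse.injective h1)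

variable [Field K] [Algebra K R]

section Free

variable {X : Type x} [AddCommGroup X] [Module K X] [Module Rᵐᵒᵖ X] [IsScalarTower K Rᵐᵒᵖ X]
  (V : Type y) [AddCommGroup V] [Module K V]

variable (K R X) in
/-- The map `X ⊗_R (R ⊗_K V) → X ⊗_K V`. -/
def tensorFree : TensorOver K R X (R ⊗[K] V) →ₗ[K] X ⊗[K] V :=
  lift
    (LinearMap.restrictScalarsₗ ℤ K _ _ K ∘ₗ LinearMap.rTensorHom V ∘ₗ
      LinearMap.mk₂ K (fun (a : X) (r : R) => MulOpposite.op r • a)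
        (fun a b r => smul_add _ _ _) (fun k a r => smul_comm _ _ _)
        (fun a r s => by rw [MulOpposite.op_add, add_smul])
        (fun k a r => by rw [MulOpposite.op_smul, smul_assoc]))
    (by
      intro a r t
      induction t with
      | zero => simp
      | add s t hs ht => simp only [map_add, smul_add, hs, ht]
      | tmul s v => simp [TensorProduct.smul_tmul', mul_smul])

theorem tensorFree_tmul (a : X) (r : R) (v : V) :
    tensorFree K R X V (tmul K R a (r ⊗ₜ v)) = (MulOpposite.op r • a) ⊗ₜ v := by
  simp [tensorFree]

/-- The left inverse is `a ⊗ v ↦ a ⊗ (1 ⊗ v)`. Flatness uses injectivity only, so the other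
composite is not examined. -/
theorem tensorFree_injective : Injective (tensorFree K R X V) := by
  let β : X ⊗[K] V →ₗ[K] TensorOver K R X (R ⊗[K] V) :=
    TensorProduct.lift (LinearMap.mk₂ K (fun (a : X) (v : V) => tmul K R a ((1 : R) ⊗ₜ[K] v))
      (fun a b r => add_tmul _ _ _) (fun k a r => rfl)
      (fun a r s => by rw [TensorProduct.tmul_add, tmul_add])
      (fun k a v => by
        rw [← smul_tmul, ← TensorProduct.smul_tmul, ← algebraMap_smul (A := Rᵐᵒᵖ) k a,
          MulOpposite.algebraMap_apply, op_smul_tmul, TensorProduct.smul_tmul',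
          smul_eq_mul, mul_one, Algebra.algebraMap_eq_smul_one]))
  refine Function.LeftInverse.injective (g := β) fun t => ?_
  induction t using tensorOver_induction with
  | h0 => simp only [map_zero]
  | ha s t hs ht => simp only [map_add, hs, ht]
  | ht a b =>
    induction b with
    | zero => simp only [tmul_zero, map_zero]
    | add s t hs ht => rw [tmul_add, map_add, map_add, hs, ht]
    | tmul r v =>
      rw [tensorFree_tmul]
      change tmul K R (MulOpposite.op r • a) ((1 : R) ⊗ₜ[K] v) = _
      rw [op_smul_tmul, TensorProduct.smul_tmul', smul_eq_mul, mul_one]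

/-- Through `tensorFree` the induced map becomes `f ⊗ V` over `K`, which is injective because `K` is
a field. -/
theorem isFlat_free : IsFlat K R (R ⊗[K] V) := by
  intro X X' _ _ _ _ _ _ _ _ f hf
  refine Injective.of_comp (f := tensorFree K R X' V) ?_
  have h2 : ⇑(tensorFree K R X' V) ∘ ⇑(mapLeft K R (R ⊗[K] V) f) =
      ⇑((f.restrictScalars K).rTensor V) ∘ ⇑(tensorFree K R X V) := by
    funext t
    simp only [Function.comp_apply]
    induction t using tensorOver_induction with
    | h0 => simp only [map_zero]
    | ha s t hs ht => simp only [map_add, hs, ht]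
    | ht a b =>
      induction b with
      | zero => simp only [tmul_zero, map_zero]
      | add s t hs ht => simp only [tmul_add, map_add, hs, ht]
      | tmul r v => simp [tensorFree_tmul]
  rw [h2]
  exact (Module.Flat.rTensor_preserves_injective_linearMap (M := V) (f.restrictScalars K) hf).comp
    (tensorFree_injective V)

variable (K R) in
/-- The map `R ⊗_K P → P` for a left `R`-module `P`. -/
def freeCover (P : Type y) [AddCommGroup P] [Module K P] [Module R P] [IsScalarTower K R P] :
    R ⊗[K] P →ₗ[R] P :=
  TensorProduct.AlgebraTensorModule.lift
    (LinearMap.toSpanSingleton R (P →ₗ[K] P) LinearMap.id)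

@[simp] theorem freeCover_tmul {P : Type y} [AddCommGroup P] [Module K P] [Module R P]
    [IsScalarTower K R P] (r : R) (p : P) : freeCover K R P (r ⊗ₜ p) = r • p := by
  simp [freeCover]

theorem freeCover_surjective {P : Type y} [AddCommGroup P] [Module K P] [Module R P]
    [IsScalarTower K R P] : Surjective (freeCover K R P) := fun p => ⟨1 ⊗ₜ p, by simp⟩

/-- The cover `R ⊗_K P → P` splits. The universe of `P` absorbs that of `R`, so that the retract and
the free module live in the same universe. -/
theorem isFlat_of_projective {P : Type (max y u)} [AddCommGroup P] [Module K P] [Module R P]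
    [IsScalarTower K R P] [Module.Projective R P] : IsFlat K R P := by
  obtain ⟨i, hi⟩ := Module.projective_lifting_property (freeCover K R P) LinearMap.id
    freeCover_surjective
  exact (isFlat_free P).of_retract i (freeCover K R P) fun n => LinearMap.congr_fun hi n

end Free

section FreeRight

variable (K R) (V : Type x) [AddCommGroup V] [Module K V]

/-- The map from the free right `R`-module on a vector space to `V ⊗_K Y`. -/
def freeTensor (Y : Type y) [AddCommGroup Y] [Module R Y] [Module K Y] [IsScalarTower K R Y] :
    TensorOver K R (R ⊗[K] V) Y →ₗ[K] V ⊗[K] Y :=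
  lift
    (LinearMap.restrictScalarsₗ ℤ K _ _ K ∘ₗ TensorProduct.lift
      (LinearMap.mk₂ K (fun (r : R) (v : V) =>
        TensorProduct.mk K V Y v ∘ₗ Algebra.lsmul K K Y r)
        (fun a b r => by ext; simp [TensorProduct.tmul_add])
        (fun k a r => by ext; simp)
        (fun a r s => by ext; simp)
        (fun k a r => by ext; simp [TensorProduct.smul_tmul'])))
    (by
      intro t r b
      induction t with
      | zero => simp
      | add s t hs ht => simp only [map_add, smul_add, LinearMap.add_apply, hs, ht]
      | tmul s v => simp [TensorProduct.smul_tmul'])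

variable {K R V}

theorem freeTensor_tmul {Y : Type y} [AddCommGroup Y] [Module R Y] [Module K Y]
    [IsScalarTower K R Y] (r : R) (v : V) (b : Y) :
    freeTensor K R V Y (tmul K R (r ⊗ₜ v) b) = v ⊗ₜ (r • b) := by
  simp [freeTensor]

theorem freeTensor_injective (Y : Type y) [AddCommGroup Y] [Module R Y] [Module K Y]
    [IsScalarTower K R Y] : Injective (freeTensor K R V Y) := by
  let β : V ⊗[K] Y →ₗ[K] TensorOver K R (R ⊗[K] V) Y :=
    TensorProduct.lift (LinearMap.mk₂ K (fun (v : V) (b : Y) => tmul K R ((1 : R) ⊗ₜ[K] v) b)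
      (fun a b r => by rw [TensorProduct.tmul_add, add_tmul])
      (fun k a r => by rw [TensorProduct.tmul_smul]; rfl)
      (fun a r s => tmul_add _ _ _)
      (fun k v b => by
        rw [← smul_tmul, ← algebraMap_smul R k b, ← op_smul_tmul, TensorProduct.smul_tmul',
          TensorProduct.smul_tmul', Algebra.algebraMap_eq_smul_one]
        simp))
  refine Function.LeftInverse.injective (g := β) fun t => ?_
  induction t using tensorOver_induction with
  | h0 => simp only [map_zero]
  | ha s t hs ht => simp only [map_add, hs, ht]
  | ht a b =>
    induction a with
    | zero => simp only [zero_tmul, map_zero]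
    | add s t hs ht => rw [add_tmul, map_add, map_add, hs, ht]
    | tmul r v =>
      rw [freeTensor_tmul]
      simp [β, ← op_smul_tmul, TensorProduct.smul_tmul']

/-- Mirror image of `isFlat_free`: tensoring with a free right module is tensoring over the field
`K`. -/
theorem mapRight_free_injective {Y Y' : Type y} [AddCommGroup Y] [Module R Y] [Module K Y]
    [IsScalarTower K R Y] [AddCommGroup Y'] [Module R Y'] [Module K Y'] [IsScalarTower K R Y']
    {f : Y →ₗ[R] Y'} (hf : Injective f) : Injective (mapRight K R (R ⊗[K] V) f) := by
  refine Injective.of_comp (f := freeTensor K R V Y') ?_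
  have h2 : ⇑(freeTensor K R V Y') ∘ ⇑(mapRight K R (R ⊗[K] V) f) =
      ⇑((f.restrictScalars K).lTensor V) ∘ ⇑(freeTensor K R V Y) := by
    funext t
    simp only [Function.comp_apply]
    induction t using tensorOver_induction with
    | h0 => simp only [map_zero]
    | ha s t hs ht => simp only [map_add, hs, ht]
    | ht a b =>
      induction a with
      | zero => simp only [zero_tmul, map_zero]
      | add s t hs ht => simp only [add_tmul, map_add, hs, ht]
      | tmul r v => simp [freeTensor_tmul]
  rw [h2]
  exact (Module.Flat.lTensor_preserves_injective_linearMap (M := V) (f.restrictScalars K) hf).comp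
    (freeTensor_injective Y)

variable (K R) in
/-- The map `R ⊗_K X → X` of right `R`-modules. -/
def freeCoverRight (X : Type x) [AddCommGroup X] [Module K X] [Module Rᵐᵒᵖ X]
    [IsScalarTower K Rᵐᵒᵖ X] : R ⊗[K] X →ₗ[Rᵐᵒᵖ] X :=
  TensorProduct.AlgebraTensorModule.lift
    { toFun := fun r => (Algebra.lsmul K K X (MulOpposite.op r) : X →ₗ[K] X)
      map_add' := fun r s => by ext; simp
      map_smul' := fun r s => by ext; simp }

theorem freeCoverRight_surjective (X : Type x) [AddCommGroup X] [Module K X] [Module Rᵐᵒᵖ X]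
    [IsScalarTower K Rᵐᵒᵖ X] : Surjective (freeCoverRight K R X) :=
  fun p => ⟨1 ⊗ₜ p, by simp [freeCoverRight]⟩

end FreeRight

end Flat

end NCTensor

/-! ### Flat resolutions compute `Tor` -/

namespace NCTensor

open scoped TensorProduct ModuleCat
open Function (Injective Surjective Exact)

variable (K : Type z) (R : Type u) [Field K] [Ring R] [Algebra K R]

/-- A resolution of a left `R`-module by flat modules. -/
structure FlatResolution (Y : ModuleCat.{y} R) where
  /-- the underlying complex -/
  complex : ChainComplex (ModuleCat.{y} R) ℕ
  /-- the augmentation -/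
  augmentation : complex.X 0 ⟶ Y
  flat : ∀ n, IsFlat K R (complex.X n)
  exact_succ : ∀ n, Exact (complex.d (n + 2) (n + 1)).hom (complex.d (n + 1) n).hom
  exact_zero : Exact (complex.d 1 0).hom augmentation.hom
  surjective : Surjective augmentation.hom

variable {K R}

/-- As `g` need not be surjective, it is factored through its range: right exactness handles the
surjection, and the inclusion of the range stays injective because the right module is free. -/
theorem mapRight_free_exact (V : Type x) [AddCommGroup V] [Module K V]
    {Y₁ Y₂ Y₃ : ModuleCat.{y} R} {f : Y₁ ⟶ Y₂} {g : Y₂ ⟶ Y₃} (h : Exact f.hom g.hom) :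
    Exact (mapRight K R (R ⊗[K] V) f.hom) (mapRight K R (R ⊗[K] V) g.hom) := by
  have h1 : Exact f.hom g.hom.rangeRestrict := fun t => by
    rw [← h t, ← Subtype.val_inj]
    rfl
  have h2 := mapRight_exact (K := K) (X := R ⊗[K] V) h1 g.hom.surjective_rangeRestrict
  have h3 : Injective (mapRight K R (R ⊗[K] V) (LinearMap.range g.hom).subtype) :=
    mapRight_free_injective (Submodule.subtype_injective _)
  have h4 : ∀ t, mapRight K R (R ⊗[K] V) g.hom t =
      mapRight K R (R ⊗[K] V) (LinearMap.range g.hom).subtype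
        (mapRight K R (R ⊗[K] V) g.hom.rangeRestrict t) := by
    intro t
    induction t using tensorOver_induction with
    | h0 => simp only [map_zero]
    | ht a b => rfl
    | ha s t hs ht => simp only [map_add, hs, ht]
  intro t
  rw [h4, ← h2 t]
  exact ⟨fun h => h3 (by rw [h, map_zero]), fun h => by rw [h, map_zero]⟩

variable (K) in
/-- The complex `X ⊗_R C`. -/
abbrev tensorComplex (X : Type x) [AddCommGroup X] [Module K X] [Module Rᵐᵒᵖ X]
    [IsScalarTower K Rᵐᵒᵖ X] (C : ChainComplex (ModuleCat.{y} R) ℕ) :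
    ChainComplex (ModuleCat.{max x y} K) ℕ :=
  ((tensorFunctor.{u, x, y, z} K R X).mapHomologicalComplex (ComplexShape.down ℕ)).obj C

variable (K) in
/-- The map `X ⊗_R C ⟶ X' ⊗_R C` induced by a map `X → X'` of right modules. -/
abbrev tensorComplexMap {X X' : Type x} [AddCommGroup X] [Module K X] [Module Rᵐᵒᵖ X]
    [IsScalarTower K Rᵐᵒᵖ X] [AddCommGroup X'] [Module K X'] [Module Rᵐᵒᵖ X']
    [IsScalarTower K Rᵐᵒᵖ X'] (f : X →ₗ[Rᵐᵒᵖ] X') (C : ChainComplex (ModuleCat.{y} R) ℕ) :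
    tensorComplex K X C ⟶ tensorComplex K X' C :=
  (NatTrans.mapHomologicalComplex (tensorFunctorMap.{u, x, y, z} K R f)
    (ComplexShape.down ℕ)).app C

namespace FlatResolution

section Free

variable (V : Type x) [AddCommGroup V] [Module K V] {Y : ModuleCat.{y} R}

theorem isZero_homology_free (C : FlatResolution K R Y) (n : ℕ) :
    Limits.IsZero ((tensorComplex K (R ⊗[K] V) C.complex).homology (n + 1)) := by
  rw [← HomologicalComplex.exactAt_iff_isZero_homology,
    HomologicalComplex.exactAt_iff' _ (n + 2) (n + 1) n (by simp) (by simp)]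
  exact ModuleCat.shortComplex_exact _ (mapRight_free_exact V (C.exact_succ n))

end Free

section Zero

variable (X : Type x) [AddCommGroup X] [Module K X] [Module Rᵐᵒᵖ X] [IsScalarTower K Rᵐᵒᵖ X]
  {Y : ModuleCat.{y} R}

/-- The augmentation of the complex `X ⊗_R C`. -/
def tensorAugmentation (C : FlatResolution K R Y) :
    (tensorComplex K X C.complex).opcycles 0 ⟶ (tensorFunctor.{u, x, y, z} K R X).obj Y :=
  HomologicalComplex.descOpcycles _
    ((tensorFunctor.{u, x, y, z} K R X).map C.augmentation) 1 (by simp) (by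
      have h : C.complex.d 1 0 ≫ C.augmentation = 0 :=
        ModuleCat.hom_ext (LinearMap.ext fun t => C.exact_zero.apply_apply_eq_zero t)
      change (tensorFunctor.{u, x, y, z} K R X).map (C.complex.d 1 0) ≫ _ = 0
      rw [← Functor.map_comp, h, Functor.map_zero])

theorem pOpcycles_tensorAugmentation (C : FlatResolution K R Y) :
    (tensorComplex K X C.complex).pOpcycles 0 ≫ C.tensorAugmentation X =
      (tensorFunctor.{u, x, y, z} K R X).map C.augmentation :=
  HomologicalComplex.p_descOpcycles _ _ _ _ _

/-- The opcycles in degree zero are the cokernel of `X ⊗ C₁ → X ⊗ C₀`, and right exactness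
identifies this cokernel with `X ⊗ Y`. Flatness plays no role here. -/
instance (C : FlatResolution K R Y) : IsIso (C.tensorAugmentation X) := by
  have he : Exact (mapRight K R X (C.complex.d 1 0).hom)
    (mapRight K R X C.augmentation.hom) := mapRight_exact C.exact_zero C.surjective
  have hs : Surjective (mapRight K R X C.augmentation.hom) := mapRight_surjective C.surjective
  have hp : ∀ t, C.tensorAugmentation X ((tensorComplex K X C.complex).pOpcycles 0 t) =
      mapRight K R X C.augmentation.hom t := fun t =>
    ConcreteCategory.congr_hom (C.pOpcycles_tensorAugmentation X) t
  have hsurj : Surjective ((tensorComplex K X C.complex).pOpcycles 0) :=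
    (ModuleCat.epi_iff_surjective _).1 inferInstance
  rw [ConcreteCategory.isIso_iff_bijective]
  constructor
  · refine (injective_iff_map_eq_zero (C.tensorAugmentation X).hom).2 fun t ht => ?_
    obtain ⟨t, rfl⟩ := hsurj t
    obtain ⟨s, rfl⟩ := (he t).1 ((hp t).symm.trans ht)
    exact ConcreteCategory.congr_hom ((tensorComplex K X C.complex).d_pOpcycles 1 0) s
  · intro t
    obtain ⟨s, hs⟩ := hs t
    exact ⟨_, (hp s).trans hs⟩

/-- `H₀(X ⊗_R C)` is `X ⊗_R Y`. -/
def homologyZeroIso (C : FlatResolution K R Y) :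
    (tensorComplex K X C.complex).homology 0 ≅ (tensorFunctor.{u, x, y, z} K R X).obj Y :=
  (tensorComplex K X C.complex).isoHomologyι₀ ≪≫ asIso (C.tensorAugmentation X)

variable {X} {X' : Type x} [AddCommGroup X'] [Module K X'] [Module Rᵐᵒᵖ X']
  [IsScalarTower K Rᵐᵒᵖ X']

theorem homologyZeroIso_naturality (C : FlatResolution K R Y) (f : X →ₗ[Rᵐᵒᵖ] X') :
    HomologicalComplex.homologyMap (tensorComplexMap K f C.complex) 0 ≫
        (C.homologyZeroIso X').hom =
      (C.homologyZeroIso X).hom ≫ (tensorFunctorMap.{u, x, y, z} K R f).app Y := by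
  have h : HomologicalComplex.opcyclesMap (tensorComplexMap K f C.complex) 0 ≫
        C.tensorAugmentation X' =
      C.tensorAugmentation X ≫ (tensorFunctorMap.{u, x, y, z} K R f).app Y := by
    rw [← cancel_epi (HomologicalComplex.pOpcycles _ _)]
    rw [HomologicalComplex.p_opcyclesMap_assoc, pOpcycles_tensorAugmentation, ← Category.assoc,
      pOpcycles_tensorAugmentation]
    exact ((tensorFunctorMap.{u, x, y, z} K R f).naturality C.augmentation).symm
  simp only [homologyZeroIso, Iso.trans_hom, asIso_hom, Category.assoc, ← h]
  simp

end Zero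

section Sequence

variable {X' X X'' : Type u} [AddCommGroup X] [Module K X] [Module Rᵐᵒᵖ X]
  [IsScalarTower K Rᵐᵒᵖ X]
  [AddCommGroup X'] [Module K X'] [Module Rᵐᵒᵖ X'] [IsScalarTower K Rᵐᵒᵖ X']
  [AddCommGroup X''] [Module K X''] [Module Rᵐᵒᵖ X''] [IsScalarTower K Rᵐᵒᵖ X'']
  {Y : ModuleCat.{y} R}

/-- The sequence of complexes induced by an exact sequence of right modules. -/
def sequence (C : FlatResolution K R Y) {f : X' →ₗ[Rᵐᵒᵖ] X} {g : X →ₗ[Rᵐᵒᵖ] X''}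
    (hfg : Exact f g) (hg : Surjective g) : ShortComplex (ChainComplex (ModuleCat K) ℕ) :=
  ShortComplex.mk (tensorComplexMap K f C.complex) (tensorComplexMap K g C.complex) (by
    ext i : 1
    exact ModuleCat.hom_ext (LinearMap.ext
      (mapLeft_exact K R (C.complex.X i) hfg hg).apply_apply_eq_zero))

/-- Flatness of the terms of `C` enters exactly here, for injectivity on the left in each degree. -/
theorem sequence_shortExact (C : FlatResolution K R Y) {f : X' →ₗ[Rᵐᵒᵖ] X}
    {g : X →ₗ[Rᵐᵒᵖ] X''} (hf : Injective f) (hfg : Exact f g) (hg : Surjective g) :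
    (C.sequence hfg hg).ShortExact :=
  HomologicalComplex.shortExact_of_degreewise_shortExact _ fun i =>
    ModuleCat.shortComplex_shortExact _ (mapLeft_exact K R (C.complex.X i) hfg hg)
      (C.flat i f hf) (mapLeft_surjective K R (C.complex.X i) hg)

end Sequence

variable {Y : ModuleCat.{y} R}

/-- The kernel of the free cover of a right module. -/
abbrev syzygy (K : Type z) (R : Type u) [Field K] [Ring R] [Algebra K R] (X : Type u)
    [AddCommGroup X] [Module K X] [Module Rᵐᵒᵖ X] [IsScalarTower K Rᵐᵒᵖ X] :
    Submodule Rᵐᵒᵖ (R ⊗[K] X) := LinearMap.ker (freeCoverRight K R X)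

variable (X : Type u) [AddCommGroup X] [Module K X] [Module Rᵐᵒᵖ X] [IsScalarTower K Rᵐᵒᵖ X]

theorem syzygy_exact : Exact (syzygy K R X).subtype (freeCoverRight K R X) :=
  LinearMap.exact_subtype_ker_map _

/-- Dimension shifting in positive degrees. -/
def homologyShift (C : FlatResolution K R Y) (n : ℕ) :
    (tensorComplex K X C.complex).homology (n + 2) ≅
      (tensorComplex K (syzygy K R X) C.complex).homology (n + 1) :=
  (C.sequence_shortExact (Submodule.subtype_injective _) (syzygy_exact (K := K) (R := R) X)
    (freeCoverRight_surjective X)).δIso (n + 2) (n + 1) (by simp)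
    (C.isZero_homology_free X (n + 1)) (C.isZero_homology_free X n)

/-- The long exact sequence of `0 → syzygy → R ⊗ X → X → 0` embeds `H₁` into `H₀` of the syzygy with
image the kernel of the map to `H₀` of the free module. By `homologyZeroIso` this kernel depends on
`Y` and no longer on `C`. -/
theorem exists_homology_one_equiv (C : FlatResolution K R Y) :
    Nonempty ((tensorComplex K X C.complex).homology 1 ≃ₗ[K]
      LinearMap.ker (mapLeft (X := syzygy K R X) (X' := R ⊗[K] X) K R Y
        (syzygy K R X).subtype)) := by
  have hS := C.sequence_shortExact (Submodule.subtype_injective _)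
    (syzygy_exact (K := K) (R := R) X) (freeCoverRight_surjective X)
  let δ := hS.δ 1 0 (by simp)
  -- The connecting map is injective because `H₁` of the free module vanishes.
  have hm : Mono δ := hS.mono_δ _ _ _ (C.isZero_homology_free X 0)
  let j : (tensorComplex K X C.complex).homology 1 →ₗ[K] TensorOver K R (syzygy K R X) Y :=
    (δ ≫ (C.homologyZeroIso (syzygy K R X)).hom).hom
  have hj : Injective j :=
    (C.homologyZeroIso (syzygy K R X)).toLinearEquiv.injective.comp
      ((ModuleCat.mono_iff_injective _).1 hm)
  have hδ := (ShortComplex.ShortExact.moduleCat_exact_iff_function_exact _).1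
    (hS.homology_exact₁ 1 0 (by simp))
  -- Exactness at `H₀` of the syzygy, carried over to tensor products with `Y` by naturality of
  -- `homologyZeroIso`.
  have hr : LinearMap.range j =
      LinearMap.ker (mapLeft (X := syzygy K R X) (X' := R ⊗[K] X) K R Y
        (syzygy K R X).subtype) := by
    ext t
    obtain ⟨s, rfl⟩ := (C.homologyZeroIso (syzygy K R X)).toLinearEquiv.surjective t
    have h := ConcreteCategory.congr_hom
      (C.homologyZeroIso_naturality (syzygy K R X).subtype) s
    constructor
    · rintro ⟨r, hr⟩
      have h1 : δ.hom r = s := (C.homologyZeroIso (syzygy K R X)).toLinearEquiv.injective hr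
      refine h.symm.trans (Eq.trans (congrArg (C.homologyZeroIso (R ⊗[K] X)).hom.hom ?_)
        (map_zero _))
      exact (hδ s).2 ⟨r, h1⟩
    · intro hs
      obtain ⟨r, hr⟩ := (hδ s).1 ((C.homologyZeroIso (R ⊗[K] X)).toLinearEquiv.injective
        ((h.trans hs).trans (map_zero _).symm))
      exact ⟨r, congrArg (C.homologyZeroIso (syzygy K R X)).hom.hom hr⟩
  exact ⟨(LinearEquiv.ofInjective j hj).trans (LinearEquiv.ofEq _ _ hr)⟩

/-- Dimension shifting lowers the degree at the cost of replacing `X` by its syzygy, so `X` must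
vary in the induction. Degree one is a separate base case since `H₀` of a free module need not
vanish. -/
theorem exists_homology_equiv (C C' : FlatResolution K R Y) (n : ℕ) (X : Type u)
    [AddCommGroup X] [Module K X] [Module Rᵐᵒᵖ X] [IsScalarTower K Rᵐᵒᵖ X] :
    Nonempty ((tensorComplex K X C.complex).homology n ≃ₗ[K]
      (tensorComplex K X C'.complex).homology n) := by
  match n with
  | 0 => exact ⟨(C.homologyZeroIso X ≪≫ (C'.homologyZeroIso X).symm).toLinearEquiv⟩
  | 1 =>
    obtain ⟨e⟩ := C.exists_homology_one_equiv X
    obtain ⟨e'⟩ := C'.exists_homology_one_equiv X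
    exact ⟨e.trans e'.symm⟩
  | n + 2 =>
    obtain ⟨e⟩ := exists_homology_equiv C C' (n + 1) (syzygy K R X)
    exact ⟨(C.homologyShift X n).toLinearEquiv.trans
      (e.trans (C'.homologyShift X n).toLinearEquiv.symm)⟩

end FlatResolution

/-- A projective resolution is a flat resolution. -/
def FlatResolution.ofProjective {Y : ModuleCat.{max y u} R} (P : ProjectiveResolution Y) :
    FlatResolution K R Y where
  complex := P.complex
  augmentation := P.π.f 0
  flat n := by
    have : Module.Projective R (P.complex.X n) :=
      (IsProjective.iff_projective _).2 (P.projective n)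
    exact isFlat_of_projective
  exact_succ n := (ShortComplex.ShortExact.moduleCat_exact_iff_function_exact _).1 (P.exact_succ n)
  exact_zero := (ShortComplex.ShortExact.moduleCat_exact_iff_function_exact _).1 P.exact₀
  surjective := (ModuleCat.epi_iff_surjective _).1 (inferInstanceAs (Epi (P.π.f 0)))

end NCTensor

/-! ### Restricting bisections to clopen sets of sources -/

namespace AmpleGroupoid

variable {X : Type u} [Groupoid.{v} X] [TopologicalSpace (Arr X)]

section Topology

variable [IsEtale X]

theorem isOpenMap_src : IsOpenMap (src : Arr X → UnitSpace X) := by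
  have h : IsOpenMap (inv : Arr X → Arr X) := fun U hU => by
    rw [← preimage_inv_eq_image]
    exact hU.preimage continuous_inv
  exact (IsEtale.isLocalHomeomorph_rng (X := X)).isOpenMap.comp h

end Topology

/-- A basic compact open bisection contained in the open set of units over `O` is a compact open
subset of the Hausdorff unit space, hence clopen. -/
theorem exists_isClopen_subset [IsAmple X] {O : Set (UnitSpace X)} (hO : IsOpen O)
    {x : UnitSpace X} (hx : x ∈ O) : ∃ E, IsClopen E ∧ x ∈ E ∧ E ⊆ O := by
  obtain ⟨V, ⟨h1, h2, -⟩, hV, hVO⟩ :=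
    (IsAmple.isTopologicalBasis (X := X)).exists_subset_of_mem_open
      (Set.mem_image_of_mem unit hx) (isOpen_image_unit hO)
  refine ⟨unit ⁻¹' V, ⟨?_, h2.preimage continuous_unit⟩, hV, fun y hy => ?_⟩
  · have h3 : (unit '' (unit ⁻¹' V) : Set (Arr X)) = V :=
      Set.image_preimage_eq_of_subset (hVO.trans (Set.image_subset_range _ _))
    rw [← h3] at h1
    exact ((Topology.IsInducing.mk rfl : Topology.IsInducing
      (unit : UnitSpace X → Arr X)).isCompact_iff.2 h1).isClosed
  · obtain ⟨y', hy', e⟩ := hVO hy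
    rwa [← show y' = y from congrArg src e]

section Restriction

variable [IsEtale X] [CompactSpace (UnitSpace X)]

theorem Bisection.mem_mul_ofClopen {U : Bisection X} {E : Set (UnitSpace X)} (hE : IsClopen E)
    {c : Arr X} : c ∈ (U * ofClopen E hE).carrier ↔ c ∈ U.carrier ∧ src c ∈ E := by
  constructor
  · rintro ⟨a, ha, _, ⟨x, hx, rfl⟩, h, rfl⟩
    rw [comp_unit]
    exact ⟨ha, by rwa [h]⟩
  · rintro ⟨hc, hE⟩
    exact ⟨c, hc, _, ⟨src c, hE, rfl⟩, rfl, comp_unit _ _ _⟩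

theorem Bisection.mul_ofClopen_univ (U : Bisection X) : U * ofClopen Set.univ isClopen_univ = U :=
  Bisection.ext (Set.ext fun c => by simp [mem_mul_ofClopen])

theorem Bisection.mul_ofClopen_mul_ofClopen (U : Bisection X) {E F : Set (UnitSpace X)}
    (hE : IsClopen E) (hF : IsClopen F) :
    U * ofClopen E hE * ofClopen F hF = U * ofClopen (E ∩ F) (hE.inter hF) :=
  Bisection.ext (Set.ext fun c => by simp [mem_mul_ofClopen, and_assoc])

/-- The sources of `U ∩ V` form an open set, and over it both bisections consist of the arrows of `U
∩ V`, as an arrow of a bisection is determined by its source. The filter of small sets lets finitely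
many such conditions be imposed at once. -/
theorem eventually_mul_ofClopen_eq {U V : Bisection X} {c : Arr X} (hU : c ∈ U.carrier)
    (hV : c ∈ V.carrier) : ∀ᶠ T in (nhds (src c)).smallSets, ∀ E (hE : IsClopen E), E ⊆ T →
      U * Bisection.ofClopen E hE = V * Bisection.ofClopen E hE := by
  rw [Filter.eventually_smallSets]
  have hO : IsOpen (src '' (U.carrier ∩ V.carrier) : Set (UnitSpace X)) :=
    isOpenMap_src _ (U.isOpen.inter V.isOpen)
  refine ⟨_, hO.mem_nhds ⟨c, ⟨hU, hV⟩, rfl⟩, fun T hT E hE hET => ?_⟩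
  apply Bisection.ext
  ext d
  rw [Bisection.mem_mul_ofClopen, Bisection.mem_mul_ofClopen]
  refine and_congr_left fun hd => ?_
  obtain ⟨a, ⟨ha, ha'⟩, e⟩ := hT (hET hd)
  constructor
  · intro hd
    rwa [← U.isBisection.1 ha hd e]
  · intro hd
    rwa [← V.isBisection.1 ha' hd e]

/-- The image of `U` under the source map is compact, hence closed in the Hausdorff unit space, so
its complement is a neighbourhood of `x`. -/
theorem eventually_mul_ofClopen_empty {U : Bisection X} {x : UnitSpace X}
    (hU : ∀ c ∈ U.carrier, src c ≠ x) :
    ∀ᶠ T in (nhds x).smallSets, ∀ E (hE : IsClopen E), E ⊆ T →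
      (U * Bisection.ofClopen E hE).carrier = ∅ := by
  rw [Filter.eventually_smallSets]
  have hO : IsOpen (src '' U.carrier : Set (UnitSpace X))ᶜ :=
    (U.isCompact.image continuous_src).isClosed.isOpen_compl
  refine ⟨_, hO.mem_nhds ?_, fun T hT E hE hET => ?_⟩
  · rintro ⟨c, hc, e⟩
    exact hU c hc e
  · ext d
    rw [Bisection.mem_mul_ofClopen]
    simp only [Set.mem_empty_iff_false, iff_false, not_and]
    exact fun hd hE => hT (hET hE) ⟨d, hd, rfl⟩

end Restriction

/-! ### The universal property of the Steinberg algebra as a vector space -/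

section UniversalProperty

variable [IsAmple X] [CompactSpace (UnitSpace X)] {K : Type z} [Field K] {V : Type w}
  [AddCommGroup V] [Module K V] {g : Bisection X → V}

/-- Every restriction of the empty bisection is itself, so additivity reads `g U = g U + g U`. -/
theorem apply_eq_zero_of_carrier_eq_empty
    (hg : ∀ U E (hE : IsClopen E),
      g U = g (U * Bisection.ofClopen E hE) + g (U * Bisection.ofClopen Eᶜ hE.compl))
    {U : Bisection X} (hU : U.carrier = ∅) : g U = 0 := by
  have h : ∀ E (hE : IsClopen E), U * Bisection.ofClopen E hE = U := fun E hE =>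
    Bisection.ext (Set.ext fun c => by simp [Bisection.mem_mul_ofClopen, hU])
  have := hg U Set.univ isClopen_univ
  rw [h, h] at this
  simpa using this

/-- A linear relation between characteristic functions holds near every unit for every function
that is additive under restriction to clopen sets. -/
theorem exists_clopen_linearCombination_eq_zero
    (hg : ∀ U E (hE : IsClopen E),
      g U = g (U * Bisection.ofClopen E hE) + g (U * Bisection.ofClopen Eᶜ hE.compl))
    {b : Bisection X →₀ K} (hb : Finsupp.linearCombination K (SteinbergAlgebra.char K) b = 0)
    (x : UnitSpace X) : ∃ T, IsClopen T ∧ x ∈ T ∧ ∀ E (hE : IsClopen E), E ⊆ T →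
      Finsupp.linearCombination K (fun U => g (U * Bisection.ofClopen E hE)) b = 0 := by
  classical
  have h1 : ∀ᶠ T in (nhds x).smallSets, ∀ U ∈ b.support, ∀ V ∈ b.support,
      (∃ c, c ∈ U.carrier ∧ c ∈ V.carrier ∧ src c = x) → ∀ E (hE : IsClopen E), E ⊆ T →
      U * Bisection.ofClopen E hE = V * Bisection.ofClopen E hE := by
    rw [Filter.eventually_all_finset]
    intro U _
    rw [Filter.eventually_all_finset]
    intro V _
    by_cases h : ∃ c, c ∈ U.carrier ∧ c ∈ V.carrier ∧ src c = x
    · obtain ⟨c, hU, hV, rfl⟩ := h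
      exact (eventually_mul_ofClopen_eq hU hV).mono fun T hT _ => hT
    · exact Filter.Eventually.of_forall fun T h' => absurd h' h
  have h2 : ∀ᶠ T in (nhds x).smallSets, ∀ U ∈ b.support,
      (∀ c ∈ U.carrier, src c ≠ x) → ∀ E (hE : IsClopen E), E ⊆ T →
      (U * Bisection.ofClopen E hE).carrier = ∅ := by
    rw [Filter.eventually_all_finset]
    intro U _
    by_cases h : ∀ c ∈ U.carrier, src c ≠ x
    · exact (eventually_mul_ofClopen_empty h).mono fun T hT _ => hT
    · exact Filter.Eventually.of_forall fun T h' => absurd h' h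
  obtain ⟨O, hO, hOT⟩ := Filter.eventually_smallSets.1 (h1.and h2)
  obtain ⟨O', hO', hO'o, hxO'⟩ := mem_nhds_iff.1 hO
  obtain ⟨T, hT, hxT, hTO⟩ := exists_isClopen_subset hO'o hxO'
  obtain ⟨h1, h2⟩ := hOT T (hTO.trans hO')
  refine ⟨T, hT, hxT, fun E hE hET => ?_⟩
  -- Each bisection in the finite support has at most one arrow with source `x`.
  have hfin : {c : Arr X | src c = x ∧ ∃ U ∈ b.support, c ∈ U.carrier}.Finite := by
    have : {c : Arr X | src c = x ∧ ∃ U ∈ b.support, c ∈ U.carrier} =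
        ⋃ U ∈ b.support, {c | src c = x ∧ c ∈ U.carrier} := by
      ext c
      simp
    rw [this]
    refine b.support.finite_toSet.biUnion fun U _ => Set.Subsingleton.finite ?_
    rintro c ⟨hc, hcU⟩ d ⟨hd, hdU⟩
    exact U.isBisection.1 hcU hdU (hc.trans hd.symm)
  have hex : ∀ c ∈ hfin.toFinset, ∃ U ∈ b.support, c ∈ U.carrier := fun c hc =>
    (hfin.mem_toFinset.1 hc).2
  have : Nonempty (Bisection X) := ⟨1⟩
  choose! W hW hcW using hex
  -- With one bisection `W c` chosen for each arrow `c` over `x`, a bisection of the support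
  -- restricted to `E` is either empty or equal to the restricted `W c` of its only arrow over `x`.
  -- The value of `g` is thereby governed by the characteristic function on the fibre over `x`.
  have key : ∀ U ∈ b.support, g (U * Bisection.ofClopen E hE) =
      ∑ c ∈ hfin.toFinset, charFn K U.carrier c • g (W c * Bisection.ofClopen E hE) := by
    intro U hU
    by_cases h : ∀ c ∈ U.carrier, src c ≠ x
    · rw [apply_eq_zero_of_carrier_eq_empty hg (h2 U hU h E hE hET), Finset.sum_eq_zero]
      intro c hc
      rw [charFn, Set.indicator_of_notMem (fun hc' => h c hc' (hfin.mem_toFinset.1 hc).1),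
        zero_smul]
    · push Not at h
      obtain ⟨c, hcU, hcx⟩ := h
      have hc : c ∈ hfin.toFinset := hfin.mem_toFinset.2 ⟨hcx, U, hU, hcU⟩
      rw [Finset.sum_eq_single c, charFn, Set.indicator_of_mem hcU, Pi.one_apply, one_smul,
        h1 U hU (W c) (hW c hc) ⟨c, hcU, hcW c hc, hcx⟩ E hE hET]
      · intro d hd hdc
        rw [charFn, Set.indicator_of_notMem, zero_smul]
        exact fun hdU => hdc (U.isBisection.1 hdU hcU
          ((hfin.mem_toFinset.1 hd).1.trans hcx.symm))
      · exact fun h => absurd hc h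
  -- The given relation evaluated at a single arrow; these are the coefficients of `g (W c * E)`
  -- once the sums are exchanged.
  have hb' : ∀ c, ∑ U ∈ b.support, b U * charFn K U.carrier c = 0 := by
    intro c
    have h3 : (steinbergSubmodule K X).subtype
        (Finsupp.linearCombination K (SteinbergAlgebra.char K) b) = 0 := by
      rw [hb]
      exact map_zero _
    rw [Finsupp.linearCombination_apply, Finsupp.sum] at h3
    have h4 := congrFun ((map_sum (steinbergSubmodule K X).subtype _ _).symm.trans h3) c
    rw [Finset.sum_apply] at h4
    exact h4
  rw [Finsupp.linearCombination_apply, Finsupp.sum, Finset.sum_congr rfl fun U hU => by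
    rw [key U hU, Finset.smul_sum], Finset.sum_comm]
  refine Finset.sum_eq_zero fun c _ => ?_
  simp only [smul_smul]
  rw [← Finset.sum_smul, hb', zero_smul]

/-- Compactness of the unit space passes from local to global. The property of holding over every
clopen subset of `T` is stable under unions: a clopen `E ⊆ T ∪ T'` splits into `E ∩ T` and `E ∩ Tᶜ ⊆
T'`, and `g` is additive for this splitting. -/
theorem linearCombination_eq_zero
    (hg : ∀ U E (hE : IsClopen E),
      g U = g (U * Bisection.ofClopen E hE) + g (U * Bisection.ofClopen Eᶜ hE.compl))
    {b : Bisection X →₀ K} (hb : Finsupp.linearCombination K (SteinbergAlgebra.char K) b = 0) :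
    Finsupp.linearCombination K g b = 0 := by
  have h : ∃ T : Set (UnitSpace X), IsClopen T ∧ Set.univ ⊆ T ∧ ∀ E (hE : IsClopen E), E ⊆ T →
      Finsupp.linearCombination K (fun U => g (U * Bisection.ofClopen E hE)) b = 0 := by
    refine isCompact_univ.induction_on
      (p := fun s => ∃ T : Set (UnitSpace X), IsClopen T ∧ s ⊆ T ∧ ∀ E (hE : IsClopen E), E ⊆ T →
      Finsupp.linearCombination K (fun U => g (U * Bisection.ofClopen E hE)) b = 0) ?_ ?_ ?_ ?_
    · refine ⟨∅, isClopen_empty, subset_rfl, fun E hE hE0 => ?_⟩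
      rw [Finsupp.linearCombination_apply]
      refine Finset.sum_eq_zero fun U _ => ?_
      change b U • g (U * Bisection.ofClopen E hE) = 0
      rw [apply_eq_zero_of_carrier_eq_empty hg, smul_zero]
      ext c
      simp [Bisection.mem_mul_ofClopen, Set.subset_empty_iff.1 hE0]
    · rintro s t hst ⟨T, hT, htT, h⟩
      exact ⟨T, hT, hst.trans htT, h⟩
    · rintro s t ⟨T, hT, hsT, h⟩ ⟨T', hT', htT', h'⟩
      refine ⟨T ∪ T', hT.union hT', Set.union_subset_union hsT htT', fun E hE hET => ?_⟩
      have e : ∀ U, g (U * Bisection.ofClopen E hE) =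
          g (U * Bisection.ofClopen (E ∩ T) (hE.inter hT)) +
          g (U * Bisection.ofClopen (E ∩ Tᶜ) (hE.inter hT.compl)) := by
        intro U
        rw [hg (U * Bisection.ofClopen E hE) T hT, Bisection.mul_ofClopen_mul_ofClopen,
          Bisection.mul_ofClopen_mul_ofClopen]
      have e1 := h (E ∩ T) (hE.inter hT) Set.inter_subset_right
      have e2 := h' (E ∩ Tᶜ) (hE.inter hT.compl) (fun y hy => (hET hy.1).resolve_left hy.2)
      rw [Finsupp.linearCombination_apply, Finsupp.sum] at e1 e2 ⊢
      simp only [e, smul_add, Finset.sum_add_distrib, e1, e2, add_zero]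
    · intro x _
      obtain ⟨T, hT, hxT, h⟩ := exists_clopen_linearCombination_eq_zero hg hb x
      exact ⟨T, mem_nhdsWithin_of_mem_nhds (hT.isOpen.mem_nhds hxT), T, hT, subset_rfl, h⟩
  obtain ⟨T, hT, hT1, h⟩ := h
  have := h Set.univ isClopen_univ hT1
  simpa only [Bisection.mul_ofClopen_univ] using this

theorem linearCombination_char_surjective :
    Function.Surjective (Finsupp.linearCombination K (SteinbergAlgebra.char K (X := X))) := by
  intro f
  induction f using SteinbergAlgebra.induction with
  | hc U => exact ⟨Finsupp.single U 1, by simp⟩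
  | h0 => exact ⟨0, map_zero _⟩
  | ha f f' hf hf' =>
    obtain ⟨a, rfl⟩ := hf
    obtain ⟨a', rfl⟩ := hf'
    exact ⟨a + a', map_add _ _ _⟩
  | hs k f hf =>
    obtain ⟨a, rfl⟩ := hf
    exact ⟨k • a, map_smul _ _ _⟩

/-- The universal property of the Steinberg algebra as a vector space: a function on compact open
bisections that is additive under restriction to clopen sets extends linearly. -/
theorem exists_linearMap_char (K : Type z) [Field K] {V : Type w} [AddCommGroup V] [Module K V]
    (g : Bisection X → V)
    (hg : ∀ U E (hE : IsClopen E),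
      g U = g (U * Bisection.ofClopen E hE) + g (U * Bisection.ofClopen Eᶜ hE.compl)) :
    ∃ φ : SteinbergAlgebra K X →ₗ[K] V, ∀ U, φ (SteinbergAlgebra.char K U) = g U := by
  -- Over a field the surjection from the free space on bisections has a linear section. The
  -- extension is defined through it, and its value at `1_U` is forced because `s(1_U) - U` is a
  -- relation between characteristic functions.
  obtain ⟨s, hs⟩ := LinearMap.exists_rightInverse_of_surjective
    (Finsupp.linearCombination K (SteinbergAlgebra.char K (X := X)))
    (LinearMap.range_eq_top.2 linearCombination_char_surjective)
  refine ⟨Finsupp.linearCombination K g ∘ₗ s, fun U => ?_⟩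
  have h := linearCombination_eq_zero (K := K) hg
    (b := s (SteinbergAlgebra.char K U) - Finsupp.single U 1) (by
      rw [map_sub, ← LinearMap.comp_apply, hs]
      simp)
  rw [map_sub, sub_eq_zero] at h
  simpa using h

end UniversalProperty

end AmpleGroupoid

/-! ### Quotients by images of commuting operators with `d³ = d` -/

section CommutingEndomorphisms

variable {k : Type*} [CommRing k] {M M' ι : Type*} [AddCommGroup M] [Module k M]
  [AddCommGroup M'] [Module k M']

/-- Here `(p - q)² = p + q - 2pq`, and multiplying by `p - q` cancels the mixed terms. -/
theorem sub_mul_sub_mul_sub {B : Type*} [Ring B] {p q : B} (hp : p * p = p) (hq : q * q = q)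
    (h : p * q = q * p) : (p - q) * (p - q) * (p - q) = p - q := by
  have h1 : (p - q) * (p - q) = p + q - (p * q + p * q) := by
    rw [sub_mul, mul_sub, mul_sub, hp, hq, ← h]
    abel
  have h2 : p * q * p = p * q := by rw [h, mul_assoc, hp]
  have h3 : p * q * q = p * q := by rw [mul_assoc, hq]
  rw [h1, sub_mul, add_mul, add_mul, mul_sub, mul_sub, mul_sub, h2, h3, hp, hq, ← h]
  abel

/-- Each factor `1 - d²` is the identity modulo the image of `d`. No commutation is needed. -/
theorem sub_listProd_mem (d : ι → Module.End k M) (l : List ι) (x : M) :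
    x - (l.map fun i => 1 - d i * d i).prod x ∈ ⨆ i, LinearMap.range (d i) := by
  induction l with
  | nil => simp
  | cons i l ih =>
    have h : d i (d i ((l.map fun i => 1 - d i * d i).prod x)) ∈ ⨆ i, LinearMap.range (d i) :=
      Submodule.mem_iSup_of_mem i ⟨_, rfl⟩
    convert add_mem ih h using 1
    simp only [List.map_cons, List.prod_cons, Module.End.mul_apply, LinearMap.sub_apply,
      Module.End.one_apply]
    abel

/-- The operator `1 - d²` kills the image of `d` because `d³ = d`. For a sum the two lists are
concatenated; the products commute, so each can be made to act first on the summand that it kills.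
-/
theorem exists_listProd_eq_zero {d : ι → Module.End k M} (hc : ∀ i j, Commute (d i) (d j))
    (h3 : ∀ i, d i * d i * d i = d i) {x : M} (hx : x ∈ ⨆ i, LinearMap.range (d i)) :
    ∃ l : List ι, (l.map fun i => 1 - d i * d i).prod x = 0 := by
  have hP : ∀ i j, Commute (1 - d i * d i) (1 - d j * d j) := fun i j =>
    (Commute.one_left _).sub_left ((Commute.one_right _).sub_right
      (((hc i j).mul_right (hc i j)).mul_left ((hc i j).mul_right (hc i j))))
  have hl : ∀ l l' : List ι, Commute (l.map fun i => 1 - d i * d i).prod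
      (l'.map fun i => 1 - d i * d i).prod := by
    intro l l'
    refine Commute.list_prod_left _ _ fun a ha => Commute.list_prod_right _ _ fun b hb => ?_
    obtain ⟨i, -, rfl⟩ := List.mem_map.1 ha
    obtain ⟨j, -, rfl⟩ := List.mem_map.1 hb
    exact hP i j
  induction hx using Submodule.iSup_induction' with
  | mem i x hx =>
    obtain ⟨y, rfl⟩ := hx
    refine ⟨[i], ?_⟩
    simp only [List.map_cons, List.map_nil, List.prod_cons, List.prod_nil, mul_one]
    rw [← Module.End.mul_apply, sub_mul, one_mul, h3, sub_self, LinearMap.zero_apply]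
  | zero => exact ⟨[], map_zero _⟩
  | add x y _ _ hx hy =>
    obtain ⟨l, hl1⟩ := hx
    obtain ⟨l', hl2⟩ := hy
    refine ⟨l ++ l', ?_⟩
    rw [List.map_append, List.prod_append, map_add, Module.End.mul_apply _ _ y, hl2, map_zero,
      add_zero, (hl l l').eq, Module.End.mul_apply, hl1, map_zero]

/-- Passing to the quotient by the images of commuting endomorphisms `d` with `d³ = d` is exact. -/
theorem exists_mem_iSup_range_of_map_mem {d : ι → Module.End k M} {d' : ι → Module.End k M'}
    (hc : ∀ i j, Commute (d' i) (d' j)) (h3 : ∀ i, d' i * d' i * d' i = d' i) {f : M →ₗ[k] M'}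
    (hf : ∀ i x, f (d i x) = d' i (f x)) {x : M} (hx : f x ∈ ⨆ i, LinearMap.range (d' i)) :
    ∃ y ∈ ⨆ i, LinearMap.range (d i), f y = f x := by
  obtain ⟨l, hl⟩ := exists_listProd_eq_zero hc h3 hx
  -- The witness is `x` minus the product of the `1 - dᵢ²` applied to `x`. As `f` intertwines `d`
  -- and `d'`, it sends the subtracted term to zero.
  refine ⟨_, sub_listProd_mem d l x, ?_⟩
  have h : ∀ l : List ι, f ((l.map fun i => 1 - d i * d i).prod x) =
      (l.map fun i => 1 - d' i * d' i).prod (f x) := by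
    intro l
    induction l with
    | nil => rfl
    | cons i l ih => simp [hf, ih]
  rw [map_sub, h, hl, sub_zero]

end CommutingEndomorphisms

/-! ### Conjugation of idempotents in an inverse monoid -/

namespace InverseMonoid

variable {S : Type u} [InverseMonoid S]

theorem inv_inv' (s : S) : s⁻¹⁻¹ = s := (inv_unique _ _ (inv_mul_inv s) (mul_inv_mul s)).symm

theorem mul_conj_mul (s : S) {e : S} (he : e * e = e) : s * e * s⁻¹ * s = s * e := by
  rw [mul_assoc s e, mul_assoc, mul_assoc e, idem_comm he (inv_mul_idem s), ← mul_assoc,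
    ← mul_assoc, mul_inv_mul]

theorem inv_mul_conj (s : S) {e : S} (he : e * e = e) : s⁻¹ * (s * e * s⁻¹) = e * s⁻¹ := by
  rw [← mul_assoc, ← mul_assoc, ← idem_comm he (inv_mul_idem s), mul_assoc, inv_mul_inv]

/-- The idempotent `s * e * s⁻¹`. -/
def conjInv (s : S) (e : Idem S) : Idem S :=
  ⟨s * e.1 * s⁻¹, by simpa [inv_inv'] using conj_idem s⁻¹ e.2⟩

theorem one_inv : (1 : S)⁻¹ = 1 := inv_idem (one_mul 1)

end InverseMonoid

/-! ### The quotient of a bimodule by commutators as an exact functor -/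

namespace AmpleGroupoid

open scoped TensorProduct
open InverseMonoid Hochschild

variable (K : Type z) [Field K] (X : Type u) [Groupoid.{v} X] [TopologicalSpace (Arr X)]
  [IsEtale X] [CompactSpace (UnitSpace X)]

/-- The enveloping algebra of the Steinberg algebra. -/
abbrev Env : Type (max u v z) := Enveloping K (SteinbergAlgebra K X)

variable {X}

/-- The element `1_U ⊗ 1_V` of the enveloping algebra. -/
abbrev charTmul (U V : Bisection X) : Env K X :=
  SteinbergAlgebra.char K U ⊗ₜ[K] MulOpposite.op (SteinbergAlgebra.char K V)

theorem charTmul_mul (U V U' V' : Bisection X) :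
    charTmul K U V * charTmul K U' V' = charTmul K (U * U') (V' * V) := by
  rw [Algebra.TensorProduct.tmul_mul_tmul, SteinbergAlgebra.char_mul, ← MulOpposite.op_mul,
    SteinbergAlgebra.char_mul]

variable (X) in
/-- The homomorphism `K S → A ⊗ Aᵒᵖ` that sends `U` to `1_U ⊗ 1_{U⁻¹}`. -/
def conjAlgHom : MonoidAlgebra K (Bisection X) →ₐ[K] Env K X :=
  MonoidAlgebra.lift K (Env K X) (Bisection X)
    { toFun := fun U => charTmul K U U⁻¹
      map_one' := by rw [one_inv]; rfl
      map_mul' := fun U V => by rw [charTmul_mul, mul_inv_rev'] }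

@[simp] theorem conjAlgHom_of (U : Bisection X) :
    conjAlgHom K X (MonoidAlgebra.of K _ U) = charTmul K U U⁻¹ := by
  simp [conjAlgHom]

/-- The element `1_E ⊗ 1 - 1 ⊗ 1_E` of the enveloping algebra. -/
def idemComm (E : Idem (Bisection X)) : Env K X := charTmul K E.1 1 - charTmul K 1 E.1

theorem idemComm_commute (E F : Idem (Bisection X)) :
    Commute (idemComm K E) (idemComm K F) := by
  have h := idem_comm E.2 F.2
  simp only [Commute, SemiconjBy, idemComm, sub_mul, mul_sub, charTmul_mul, one_mul, mul_one, h]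
  abel

/-- The elements `1_E ⊗ 1` and `1 ⊗ 1_E` are commuting idempotents of the enveloping algebra. -/
theorem idemComm_cube (E : Idem (Bisection X)) :
    idemComm K E * idemComm K E * idemComm K E = idemComm K E :=
  sub_mul_sub_mul_sub (by simp only [charTmul_mul, E.2, mul_one])
    (by simp only [charTmul_mul, E.2, mul_one]) (by simp only [charTmul_mul, mul_one, one_mul])

/-- Moving `U` past `E` turns it into `U E U⁻¹`, since `E` commutes with `U⁻¹ U`. This makes the
span of the commutators stable under `S`. -/
theorem charTmul_mul_idemComm (U : Bisection X) (E : Idem (Bisection X)) :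
    charTmul K U U⁻¹ * idemComm K E = idemComm K (conjInv U E) * charTmul K U U⁻¹ := by
  simp only [idemComm, conjInv, mul_sub, sub_mul, charTmul_mul, mul_one, one_mul,
    mul_conj_mul U E.2, inv_mul_conj U E.2]

section Coinvariants

variable (X)

/-- A module over the enveloping algebra, regarded as a module over the monoid algebra of compact
open bisections, with `U` acting by `x ↦ 1_U · x · 1_{U⁻¹}`. -/
def ConjModule (_K : Type z) (X : Type u) [Groupoid.{v} X] [TopologicalSpace (Arr X)]
    (M : Type w) : Type w := M

variable (M : Type w) [AddCommGroup M] [Module (Env K X) M]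

instance : AddCommGroup (ConjModule K X M) := inferInstanceAs (AddCommGroup M)

instance : Module (MonoidAlgebra K (Bisection X)) (ConjModule K X M) :=
  Module.compHom M (conjAlgHom K X).toRingHom

variable {X} in
/-- The map `x ↦ 1_E · x - x · 1_E`. -/
def idemEnd (E : Idem (Bisection X)) : Module.End ℤ M := Module.toModuleEnd ℤ M (idemComm K E)

variable {X} in
theorem idemEnd_commute (E F : Idem (Bisection X)) :
    Commute (idemEnd K M E) (idemEnd K M F) :=
  (idemComm_commute K E F).map (Module.toModuleEnd ℤ M)

variable {X} in
theorem idemEnd_cube (E : Idem (Bisection X)) :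
    idemEnd K M E * idemEnd K M E * idemEnd K M E = idemEnd K M E := by
  rw [idemEnd, ← map_mul, ← map_mul, idemComm_cube]

variable {X M} in
theorem idemComm_smul (E : Idem (Bisection X)) (m : M) :
    idemComm K E • m = charTmul K E.1 1 • m - charTmul K 1 E.1 • m := sub_smul _ _ _

/-- The additive subgroup generated by the elements `1_E · x - x · 1_E`. -/
def idemCommRange : Submodule ℤ M :=
  ⨆ E : Idem (Bisection X), LinearMap.range (idemEnd K M E)

/-- The submodule generated by the elements `1_E · x - x · 1_E`. -/
def conjRelations : Submodule (MonoidAlgebra K (Bisection X)) (ConjModule K X M) where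
  __ := (idemCommRange K X M).toAddSubmonoid
  smul_mem' r m hm := by
    change conjAlgHom K X r • (show M from m) ∈ idemCommRange K X M
    change m ∈ idemCommRange K X M at hm
    -- An element that carries each commutator operator to another one preserves the sum of their
    -- images. It is used for `1_U ⊗ 1_{U⁻¹}` and for scalars, which generate the action.
    have key : ∀ (b : Env K X), (∀ E, ∃ F, b * idemComm K E = idemComm K F * b) →
        ∀ m ∈ idemCommRange K X M, b • m ∈ idemCommRange K X M := by
      intro b hb m hm
      induction hm using Submodule.iSup_induction' with
      | mem E m hm =>
        obtain ⟨m, rfl⟩ := hm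
        obtain ⟨F, hF⟩ := hb E
        refine Submodule.mem_iSup_of_mem F ⟨b • m, ?_⟩
        change idemComm K F • b • m = b • idemComm K E • m
        rw [smul_smul, smul_smul, hF]
      | zero => rw [smul_zero]; exact zero_mem _
      | add s t _ _ hs ht => rw [smul_add]; exact add_mem hs ht
    induction r using MonoidAlgebra.induction_on with
    | of U =>
      rw [conjAlgHom_of]
      exact key _ (fun E => ⟨_, charTmul_mul_idemComm K U E⟩) _ hm
    | add r s hr hs => rw [map_add, add_smul]; exact add_mem hr hs
    | smul k r hr =>
      have h := key (algebraMap K (Env K X) k) (fun E => ⟨E, Algebra.commutes _ _⟩) _ hr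
      rwa [smul_smul, ← Algebra.smul_def, ← map_smul] at h

/-- The quotient of a bimodule by its commutators with idempotents. -/
abbrev Coinvariants : Type w := ConjModule K X M ⧸ conjRelations K X M

variable {M}

/-- The class of an element in the quotient by commutators. -/
def coinvMk (m : M) : Coinvariants K X M :=
  (conjRelations K X M).mkQ m

theorem coinvMk_surjective : Function.Surjective (coinvMk K X (M := M)) :=
  (conjRelations K X M).mkQ_surjective

theorem coinvMk_add (m m' : M) : coinvMk K X (m + m') = coinvMk K X m + coinvMk K X m' := rfl

theorem coinvMk_zero : coinvMk K X (0 : M) = 0 := rfl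

theorem smul_coinvMk (r : MonoidAlgebra K (Bisection X)) (m : M) :
    r • coinvMk K X m = coinvMk K X (conjAlgHom K X r • m) := rfl

theorem coinvMk_eq_zero {m : M} : coinvMk K X m = 0 ↔ m ∈ idemCommRange K X M :=
  Submodule.Quotient.mk_eq_zero _

theorem coinvMk_eq_of_sub {m m' n : M} (E : Idem (Bisection X)) (h : m - m' = idemComm K E • n) :
    coinvMk K X m = coinvMk K X m' := by
  rw [← sub_eq_zero]
  exact (coinvMk_eq_zero K X).2 (Submodule.mem_iSup_of_mem E ⟨n, h.symm⟩)

variable {X}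

/-- Additive maps on the quotient by commutators. -/
def coinvLift {Z : Type*} [AddCommGroup Z] (f : M →ₗ[ℤ] Z)
    (hf : ∀ (E : Idem (Bisection X)) m, f (idemComm K E • m) = 0) :
    Coinvariants K X M →ₗ[ℤ] Z :=
  AddMonoidHom.toIntLinearMap (QuotientAddGroup.lift (conjRelations K X M).toAddSubgroup
    f.toAddMonoidHom (by
      intro m hm
      have h : idemCommRange K X M ≤ LinearMap.ker f := by
        refine iSup_le fun E => ?_
        rintro _ ⟨m, rfl⟩
        exact hf E m
      exact h hm))

@[simp] theorem coinvLift_mk {Z : Type*} [AddCommGroup Z] (f : M →ₗ[ℤ] Z)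
    (hf : ∀ (E : Idem (Bisection X)) m, f (idemComm K E • m) = 0) (m : M) :
    coinvLift K f hf (coinvMk K X m) = f m := rfl

variable {M' M'' : Type w} [AddCommGroup M'] [Module (Env K X) M'] [AddCommGroup M'']
  [Module (Env K X) M'']

/-- A map of bimodules, as a map of modules over the monoid algebra. -/
def conjMap (f : M →ₗ[Env K X] M') :
    ConjModule K X M →ₗ[MonoidAlgebra K (Bisection X)] ConjModule K X M' where
  toFun := f
  map_add' := map_add f
  map_smul' r m := f.map_smul (conjAlgHom K X r) m

theorem conjRelations_le_comap (f : M →ₗ[Env K X] M') :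
    conjRelations K X M ≤ (conjRelations K X M').comap (conjMap K f) := by
  have h : idemCommRange K X M ≤ (idemCommRange K X M').comap f.toAddMonoidHom.toIntLinearMap := by
    refine iSup_le fun E => ?_
    rintro _ ⟨m, rfl⟩
    exact Submodule.mem_iSup_of_mem E ⟨f m, (f.map_smul _ _).symm⟩
  exact fun m hm => h hm

/-- The map on quotients induced by a map of bimodules. -/
def coinvMap (f : M →ₗ[Env K X] M') :
    Coinvariants K X M →ₗ[MonoidAlgebra K (Bisection X)] Coinvariants K X M' :=
  Submodule.mapQ _ _ (conjMap K f) (conjRelations_le_comap K f)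

@[simp] theorem coinvMap_mk (f : M →ₗ[Env K X] M') (m : M) :
    coinvMap K f (coinvMk K X m) = coinvMk K X (f m) := rfl

/-- The lifting of commutators along `g` comes from the commuting operators with `d³ = d`, not from
surjectivity, so the functor preserves exactness in the middle of arbitrary sequences. -/
theorem coinvMap_exact {f : M →ₗ[Env K X] M'} {g : M' →ₗ[Env K X] M''}
    (hfg : Function.Exact f g) : Function.Exact (coinvMap K f) (coinvMap K g) := by
  refine NCTensor.mapQ_exact (f := conjMap K f) (g := conjMap K g) hfg
    (conjRelations_le_comap K f) (conjRelations_le_comap K g) fun n hn => ?_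
  obtain ⟨n', hn', e⟩ := exists_mem_iSup_range_of_map_mem (d := idemEnd K M')
    (idemEnd_commute K M'') (idemEnd_cube K M'') (f := g.toAddMonoidHom.toIntLinearMap)
    (fun E m => g.map_smul _ _) (show g n ∈ idemCommRange K X M'' from hn)
  exact ⟨n', hn', e⟩

theorem coinvMap_surjective {f : M →ₗ[Env K X] M'} (hf : Function.Surjective f) :
    Function.Surjective (coinvMap K f) := by
  intro t
  obtain ⟨m, rfl⟩ := coinvMk_surjective K X t
  obtain ⟨m, rfl⟩ := hf m
  exact ⟨coinvMk K X m, rfl⟩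

variable (X) in
/-- The functor that sends a bimodule to its quotient by commutators with idempotents. -/
def coinvFunctor : ModuleCat.{w} (Env K X) ⥤ ModuleCat.{w} (MonoidAlgebra K (Bisection X)) where
  obj M := ModuleCat.of _ (Coinvariants K X M)
  map f := ModuleCat.ofHom (coinvMap K f.hom)
  map_id M := ModuleCat.hom_ext (LinearMap.ext fun t => by
    obtain ⟨m, rfl⟩ := coinvMk_surjective K X t
    rfl)
  map_comp f g := ModuleCat.hom_ext (LinearMap.ext fun t => by
    obtain ⟨m, rfl⟩ := coinvMk_surjective K X t
    rfl)

instance : (coinvFunctor.{u, v, w, z} K X).Additive where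
  map_add {_ _ f g} := ModuleCat.hom_ext (LinearMap.ext fun t => by
    obtain ⟨m, rfl⟩ := coinvMk_surjective K X t
    rfl)

section Lift

variable {W : Type x} [AddCommGroup W] [Module K W] [Module (MonoidAlgebra K (Bisection X))ᵐᵒᵖ W]
  [IsScalarTower K (MonoidAlgebra K (Bisection X))ᵐᵒᵖ W] {Z : Type y} [AddCommGroup Z] [Module K Z]

open NCTensor

/-- Maps from the tensor product of a right module with the quotient by commutators. -/
def coinvTensorLift (f : W →ₗ[K] M →ₗ[ℤ] Z)
    (hk : ∀ w (k : K) m, f w (algebraMap K (Env K X) k • m) = k • f w m)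
    (hE : ∀ w (E : Idem (Bisection X)) m, f w (idemComm K E • m) = 0)
    (hU : ∀ w (U : Bisection X) m,
      f (MulOpposite.op (MonoidAlgebra.of K _ U) • w) m = f w (charTmul K U U⁻¹ • m)) :
    TensorOver K (MonoidAlgebra K (Bisection X)) W (Coinvariants K X M) →ₗ[K] Z :=
  NCTensor.lift
    { toFun := fun w => coinvLift K (f w) (hE w)
      map_add' := fun w w' => LinearMap.ext fun t => by
        obtain ⟨m, rfl⟩ := coinvMk_surjective K X t
        simp
      map_smul' := fun k w => LinearMap.ext fun t => by
        obtain ⟨m, rfl⟩ := coinvMk_surjective K X t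
        simp } (by
    intro w r t
    obtain ⟨m, rfl⟩ := coinvMk_surjective K X t
    rw [smul_coinvMk]
    change f (MulOpposite.op r • w) m = f w (conjAlgHom K X r • m)
    -- Balancing over `KS` reduces to `hU` on monoid elements; `hk` is needed for scalars because `f
    -- w` is only assumed additive.
    induction r using MonoidAlgebra.induction_on with
    | of U => rw [conjAlgHom_of, hU]
    | add r s hr hs =>
      rw [MulOpposite.op_add, add_smul, map_add, map_add, add_smul, map_add, ← hr, ← hs]
      rfl
    | smul k r hr =>
      rw [MulOpposite.op_smul, smul_assoc, f.map_smul k, map_smul (conjAlgHom K X) k,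
        Algebra.smul_def k (conjAlgHom K X r), mul_smul, hk, ← hr]
      rfl)

@[simp] theorem coinvTensorLift_tmul (f : W →ₗ[K] M →ₗ[ℤ] Z)
    (hk : ∀ w (k : K) m, f w (algebraMap K (Env K X) k • m) = k • f w m)
    (hE : ∀ w (E : Idem (Bisection X)) m, f w (idemComm K E • m) = 0)
    (hU : ∀ w (U : Bisection X) m,
      f (MulOpposite.op (MonoidAlgebra.of K _ U) • w) m = f w (charTmul K U U⁻¹ • m))
    (w : W) (m : M) : coinvTensorLift K f hk hE hU (tmul K _ w (coinvMk K X m)) = f w m := by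
  simp [coinvTensorLift]

theorem tmul_coinvMk_smul (w : W) (k : K) (m : M) :
    tmul K (MonoidAlgebra K (Bisection X)) w (coinvMk K X (algebraMap K (Env K X) k • m)) =
      k • tmul K (MonoidAlgebra K (Bisection X)) w (coinvMk K X m) := by
  have h : coinvMk K X (algebraMap K (Env K X) k • m) =
      algebraMap K (MonoidAlgebra K (Bisection X)) k • coinvMk K X m := by
    rw [smul_coinvMk, AlgHom.commutes]
  rw [h, ← op_smul_tmul, ← MulOpposite.algebraMap_apply, algebraMap_smul]
  rfl

theorem tmul_coinvMk_charTmul (w : W) (U : Bisection X) (m : M) :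
    tmul K (MonoidAlgebra K (Bisection X)) w (coinvMk K X (charTmul K U U⁻¹ • m)) =
      tmul K (MonoidAlgebra K (Bisection X)) (MulOpposite.op (MonoidAlgebra.of K _ U) • w)
        (coinvMk K X m) := by
  rw [op_smul_tmul, smul_coinvMk, conjAlgHom_of]

end Lift

end Coinvariants

end AmpleGroupoid

/-! ### Projective bimodules have flat quotients -/

namespace AmpleGroupoid

open scoped TensorProduct
open InverseMonoid Hochschild NCTensor

variable (K : Type z) [Field K] {X : Type u} [Groupoid.{v} X] [TopologicalSpace (Arr X)]

section Etale

variable [IsEtale X] [CompactSpace (UnitSpace X)]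

theorem Bisection.ofClopen_mul_self (E : Set (UnitSpace X)) (hE : IsClopen E) :
    Bisection.ofClopen E hE * Bisection.ofClopen E hE = Bisection.ofClopen E hE :=
  Bisection.ext (Set.ext fun c => by
    rw [Bisection.mem_mul_ofClopen]
    constructor
    · exact And.left
    · rintro ⟨x, hx, rfl⟩
      exact ⟨⟨x, hx, rfl⟩, hx⟩)

theorem char_mul_ofClopen_add (U : Bisection X) (E : Set (UnitSpace X)) (hE : IsClopen E) :
    SteinbergAlgebra.char K (U * Bisection.ofClopen E hE) +
      SteinbergAlgebra.char K (U * Bisection.ofClopen Eᶜ hE.compl) = SteinbergAlgebra.char K U := by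
  apply SteinbergAlgebra.ext
  funext c
  change charFn K _ c + charFn K _ c = charFn K _ c
  classical
  simp only [charFn, Set.indicator_apply, Bisection.mem_mul_ofClopen, Set.mem_compl_iff]
  by_cases h : c ∈ U.carrier <;> by_cases h' : src c ∈ E <;> simp [h, h']

section Twisted

theorem twist_ext (W : Type x) [AddCommGroup W] [Module K W] (V : Type y) [AddCommGroup V]
    [Module K V] {Z : Type*} [AddCommGroup Z] [Module K Z]
    {f g : W ⊗[K] (SteinbergAlgebra K X ⊗[K] V) →ₗ[K] Z}
    (h : ∀ w a v, f (w ⊗ₜ (a ⊗ₜ v)) = g (w ⊗ₜ (a ⊗ₜ v))) : f = g :=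
  TensorProduct.ext' fun w t => by
    induction t with
    | zero => simp
    | add s t hs ht => rw [TensorProduct.tmul_add, map_add, map_add, hs, ht]
    | tmul a v => exact h w a v

variable (W : Type x) [AddCommGroup W] [Module K W] [Module (MonoidAlgebra K (Bisection X))ᵐᵒᵖ W]
  [IsScalarTower K (MonoidAlgebra K (Bisection X))ᵐᵒᵖ W]
  (V : Type y) [AddCommGroup V] [Module K V]

/-- The right action of a bisection. -/
def rightAct (U : Bisection X) : W →ₗ[K] W :=
  Algebra.lsmul K K W (MulOpposite.op (MonoidAlgebra.of K _ U))

theorem rightAct_apply (U : Bisection X) (w : W) :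
    rightAct K W U w = MulOpposite.op (MonoidAlgebra.of K _ U) • w := rfl

theorem rightAct_rightAct (U U' : Bisection X) (w : W) :
    rightAct K W U (rightAct K W U' w) = rightAct K W (U' * U) w := by
  simp only [rightAct_apply, smul_smul, ← MulOpposite.op_mul, ← map_mul]

/-- Right multiplication by a characteristic function. -/
def mulChar (U : Bisection X) : SteinbergAlgebra K X →ₗ[K] SteinbergAlgebra K X :=
  LinearMap.mulRight K (SteinbergAlgebra.char K U)

theorem mulChar_mulChar (U U' : Bisection X) (a : SteinbergAlgebra K X) :
    mulChar K U (mulChar K U' a) = mulChar K (U' * U) a := by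
  simp [mulChar, mul_assoc, SteinbergAlgebra.char_mul]

/-- The endomorphism `w ⊗ a ⊗ v ↦ w E ⊗ a ⊗ v - w ⊗ a E ⊗ v`. -/
def twistEnd (E : Idem (Bisection X)) :
    Module.End K (W ⊗[K] (SteinbergAlgebra K X ⊗[K] V)) :=
  (rightAct K W E.1).rTensor _ - ((mulChar K E.1).rTensor V).lTensor W

theorem twistEnd_tmul (E : Idem (Bisection X)) (w : W) (a : SteinbergAlgebra K X) (v : V) :
    twistEnd K W V E (w ⊗ₜ (a ⊗ₜ v)) =
      rightAct K W E.1 w ⊗ₜ (a ⊗ₜ v) - w ⊗ₜ (mulChar K E.1 a ⊗ₜ v) := rfl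

theorem twistEnd_commute (E F : Idem (Bisection X)) :
    Commute (twistEnd K W V E) (twistEnd K W V F) := by
  refine twist_ext K W V fun w a v => ?_
  simp only [Module.End.mul_apply, twistEnd_tmul, map_sub, rightAct_rightAct, mulChar_mulChar,
    idem_comm E.2 F.2]
  abel

theorem twistEnd_cube (E : Idem (Bisection X)) :
    twistEnd K W V E * twistEnd K W V E * twistEnd K W V E = twistEnd K W V E :=
  sub_mul_sub_mul_sub
    (twist_ext K W V fun w a v => by simp [rightAct_rightAct, E.2])
    (twist_ext K W V fun w a v => by simp [mulChar_mulChar, E.2])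
    (twist_ext K W V fun w a v => by simp)

variable (X) in
/-- The quotient of `W ⊗ A ⊗ V` by the relations `w E ⊗ a ⊗ v = w ⊗ a E ⊗ v`. -/
abbrev Twisted : Type _ :=
  (W ⊗[K] (SteinbergAlgebra K X ⊗[K] V)) ⧸
    (⨆ E : Idem (Bisection X), LinearMap.range (twistEnd K W V E))

variable {W V}

/-- The class of a pure tensor. -/
def twistMk (w : W) (a : SteinbergAlgebra K X) (v : V) : Twisted K X W V :=
  Submodule.Quotient.mk (w ⊗ₜ (a ⊗ₜ v))

theorem twistMk_idem (w : W) (a : SteinbergAlgebra K X) (v : V) {E : Bisection X}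
    (hE : E * E = E) : twistMk K (rightAct K W E w) a v = twistMk K w (mulChar K E a) v :=
  (Submodule.Quotient.eq _).2 (Submodule.mem_iSup_of_mem ⟨E, hE⟩ ⟨w ⊗ₜ (a ⊗ₜ v), rfl⟩)

theorem twistMk_mul_idem (w : W) (a : SteinbergAlgebra K X) (v : V) (U U' : Bisection X)
    {E : Bisection X} (hE : E * E = E) :
    twistMk K (rightAct K W (U * E) w) (mulChar K U' a) v =
      twistMk K (rightAct K W U w) (mulChar K (U' * E) a) v := by
  rw [← rightAct_rightAct, twistMk_idem K _ _ _ hE, mulChar_mulChar]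

theorem twistMk_add (w : W) (a a' : SteinbergAlgebra K X) (v : V) :
    twistMk K w (a + a') v = twistMk K w a v + twistMk K w a' v := by
  rw [twistMk, TensorProduct.add_tmul, TensorProduct.tmul_add]
  rfl

/-- The map `Twisted K X W V → Twisted K X W' V` induced by a map of right modules. -/
theorem exists_twisted_map_injective {W' : Type x} [AddCommGroup W'] [Module K W']
    [Module (MonoidAlgebra K (Bisection X))ᵐᵒᵖ W']
    [IsScalarTower K (MonoidAlgebra K (Bisection X))ᵐᵒᵖ W']
    (f : W →ₗ[(MonoidAlgebra K (Bisection X))ᵐᵒᵖ] W') (hf : Function.Injective f) :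
    ∃ φ : Twisted K X W V →ₗ[K] Twisted K X W' V, Function.Injective φ ∧
      ∀ w a v, φ (twistMk K w a v) = twistMk K (f w) a v := by
  let f' := (f.restrictScalars K).rTensor (SteinbergAlgebra K X ⊗[K] V)
  have hf' : ∀ E t, f' (twistEnd K W V E t) = twistEnd K W' V E (f' t) := fun E =>
    LinearMap.congr_fun (show f' ∘ₗ twistEnd K W V E = twistEnd K W' V E ∘ₗ f' from
      twist_ext K W V fun w a v => by
        simp [f', twistEnd_tmul, rightAct_apply])
  have hle : (⨆ E, LinearMap.range (twistEnd K W V E)) ≤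
      (⨆ E, LinearMap.range (twistEnd K W' V E)).comap f' := by
    refine iSup_le fun E => ?_
    rintro _ ⟨t, rfl⟩
    exact Submodule.mem_iSup_of_mem E ⟨f' t, (hf' E t).symm⟩
  refine ⟨Submodule.mapQ _ _ f' hle, ?_, fun w a v => rfl⟩
  rw [injective_iff_map_eq_zero]
  intro t ht
  obtain ⟨t, rfl⟩ := Submodule.Quotient.mk_surjective _ t
  rw [Submodule.mapQ_apply, Submodule.Quotient.mk_eq_zero] at ht
  -- A relation hit by `f' t` is already the image of a relation `s` upstairs. Over a field `f'` is
  -- injective, so `t = s` is itself a relation.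
  obtain ⟨s, hs, e⟩ := exists_mem_iSup_range_of_map_mem (d := twistEnd K W V)
    (twistEnd_commute K W' V) (twistEnd_cube K W' V) hf' ht
  have : s = t := Module.Flat.rTensor_preserves_injective_linearMap
    (M := SteinbergAlgebra K X ⊗[K] V) (f.restrictScalars K) hf e
  rwa [← this, Submodule.Quotient.mk_eq_zero]

end Twisted

/-- Only the left factor is reduced to characteristic functions. Keeping `a` arbitrary lets a scalar
on the left be absorbed into `a`, so closure under scalars is not required of `p`. -/
theorem env_tmul_induction {V : Type y} [AddCommGroup V] [Module K V]
    {p : Env K X ⊗[K] V → Prop} (h0 : p 0) (ha : ∀ s t, p s → p t → p (s + t))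
    (hc : ∀ U (a : SteinbergAlgebra K X) v,
      p ((SteinbergAlgebra.char K U ⊗ₜ[K] MulOpposite.op a) ⊗ₜ v)) (t : Env K X ⊗[K] V) : p t := by
  induction t with
  | zero => exact h0
  | add s t hs ht => exact ha s t hs ht
  | tmul b v =>
    induction b using TensorProduct.induction_on with
    | zero => rw [TensorProduct.zero_tmul]; exact h0
    | add s t hs ht => rw [TensorProduct.add_tmul]; exact ha _ _ hs ht
    | tmul f a =>
      induction f using SteinbergAlgebra.induction generalizing a with
      | hc U => exact hc U a.unop v
      | h0 => rw [TensorProduct.zero_tmul, TensorProduct.zero_tmul]; exact h0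
      | ha f g hf hg =>
        rw [TensorProduct.add_tmul, TensorProduct.add_tmul]
        exact ha _ _ (hf a) (hg a)
      | hs k f hf =>
        rw [TensorProduct.smul_tmul]
        exact hf _

end Etale

section Ample

variable [IsAmple X] [CompactSpace (UnitSpace X)]
  (W : Type x) [AddCommGroup W] [Module K W] [Module (MonoidAlgebra K (Bisection X))ᵐᵒᵖ W]
  [IsScalarTower K (MonoidAlgebra K (Bisection X))ᵐᵒᵖ W]
  (V : Type y) [AddCommGroup V] [Module K V]

/-- The formula is given on bisections, and `exists_linearMap_char` extends it. For additivity, the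
factor `E` of `UE` crosses from `w` to `a`, where it is absorbed, giving `wU ⊗ a 1_{UE} ⊗ v`; the
terms for `E` and its complement then add up to `wU ⊗ a 1_U ⊗ v`. -/
theorem exists_twist_char : ∃ φ : W →ₗ[K] (Env K X ⊗[K] V) →ₗ[K] Twisted K X W V,
    ∀ w U a v, φ w ((SteinbergAlgebra.char K U ⊗ₜ[K] MulOpposite.op a) ⊗ₜ v) =
      twistMk K (rightAct K W U w) (mulChar K U a) v := by
  let ψ : Bisection X → ((SteinbergAlgebra K X)ᵐᵒᵖ ⊗[K] V →ₗ[K] W →ₗ[K] Twisted K X W V) :=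
    fun U => (TensorProduct.curry (Submodule.mkQ _ ∘ₗ TensorProduct.map (rightAct K W U)
      ((mulChar K U ∘ₗ (MulOpposite.opLinearEquiv K).symm.toLinearMap).rTensor V))).flip
  have hψ : ∀ U a v w, ψ U (MulOpposite.op a ⊗ₜ v) w =
      twistMk K (rightAct K W U w) (mulChar K U a) v := fun U a v w => rfl
  obtain ⟨G, hG⟩ := exists_linearMap_char K ψ (by
    intro U E hE
    refine TensorProduct.ext' fun a v => LinearMap.ext fun w => ?_
    rw [LinearMap.add_apply, LinearMap.add_apply, ← MulOpposite.op_unop a, hψ, hψ, hψ]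
    have h1 := Bisection.ofClopen_mul_self E hE
    have h2 := Bisection.ofClopen_mul_self Eᶜ hE.compl
    rw [twistMk_mul_idem K _ _ _ _ _ h1, twistMk_mul_idem K _ _ _ _ _ h2, mul_assoc, h1,
      mul_assoc, h2, ← twistMk_add, mulChar, mulChar, mulChar, LinearMap.mulRight_apply,
      LinearMap.mulRight_apply, LinearMap.mulRight_apply, ← mul_add, char_mul_ofClopen_add])
  refine ⟨(TensorProduct.lift G ∘ₗ (TensorProduct.assoc K _ _ _).toLinearMap).flip,
    fun w U a v => ?_⟩
  rw [← hψ, ← hG]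
  rfl

variable {V} in
theorem charTmul_smul_tmul (U₁ U₂ U : Bisection X) (a : SteinbergAlgebra K X) (v : V) :
    charTmul K U₁ U₂ • ((SteinbergAlgebra.char K U ⊗ₜ[K] MulOpposite.op a : Env K X) ⊗ₜ[K] v) =
      (SteinbergAlgebra.char K (U₁ * U) ⊗ₜ[K] MulOpposite.op (mulChar K U₂ a)) ⊗ₜ v := by
  rw [TensorProduct.smul_tmul', smul_eq_mul, Algebra.TensorProduct.tmul_mul_tmul,
    SteinbergAlgebra.char_mul]
  rfl

variable {V} in
theorem idemComm_smul_tmul (E : Idem (Bisection X)) (U : Bisection X) (a : SteinbergAlgebra K X)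
    (v : V) :
    idemComm K E • ((SteinbergAlgebra.char K U ⊗ₜ[K] MulOpposite.op a : Env K X) ⊗ₜ[K] v) =
      (SteinbergAlgebra.char K (E.1 * U) ⊗ₜ[K] MulOpposite.op a) ⊗ₜ v -
      (SteinbergAlgebra.char K U ⊗ₜ[K] MulOpposite.op (mulChar K E.1 a)) ⊗ₜ v := by
  have h : mulChar K (1 : Bisection X) a = a := by
    rw [mulChar, SteinbergAlgebra.char_one, LinearMap.mulRight_apply, mul_one]
  have h1 := charTmul_smul_tmul K E.1 1 U a v
  have h2 := charTmul_smul_tmul K 1 E.1 U a v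
  rw [h] at h1
  rw [one_mul] at h2
  rw [← h1, ← h2, TensorProduct.smul_tmul', TensorProduct.smul_tmul', TensorProduct.smul_tmul',
    ← TensorProduct.sub_tmul, idemComm, sub_smul]

theorem idem_mul_eq (U : Bisection X) (E : Idem (Bisection X)) :
    E.1 * U = U * (conj U E).1 := by
  have h := inv_mul_conj U⁻¹ E.2
  have h' := mul_conj_mul U⁻¹ E.2
  rw [inv_inv'] at h
  rw [← h]
  rfl

/-- The map of `exists_twist_char` kills commutators because `E U = U F` with `F = U⁻¹ E U`, and `F`
may cross the tensor sign. -/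
theorem exists_twist : ∃ φ : TensorOver K (MonoidAlgebra K (Bisection X)) W
      (Coinvariants K X (Env K X ⊗[K] V)) →ₗ[K] Twisted K X W V,
    ∀ w U a v, φ (tmul K _ w (coinvMk K X
      ((SteinbergAlgebra.char K U ⊗ₜ[K] MulOpposite.op a) ⊗ₜ v))) =
      twistMk K (rightAct K W U w) (mulChar K U a) v := by
  obtain ⟨φ, hφ⟩ := exists_twist_char K (X := X) W V
  refine ⟨coinvTensorLift K (LinearMap.restrictScalarsₗ ℤ K _ _ K ∘ₗ φ) ?_ ?_ ?_,
    fun w U a v => (coinvTensorLift_tmul K _ _ _ _ _ _).trans (hφ w U a v)⟩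
  · intro w k m
    have h : algebraMap K (Env K X) k • m = k • m := algebraMap_smul _ _ _
    rw [h]
    exact (φ w).map_smul k m
  · intro w E m
    change φ w (idemComm K E • m) = 0
    induction m using env_tmul_induction with
    | h0 => rw [smul_zero, map_zero]
    | ha s t hs ht => rw [smul_add, map_add, hs, ht, add_zero]
    | hc U a v =>
      rw [idemComm_smul_tmul, map_sub, hφ, hφ, sub_eq_zero, mulChar_mulChar, idem_mul_eq,
        twistMk_mul_idem K _ _ _ _ _ (conj U E).2, mul_assoc, (conj U E).2]
  · intro w U' m
    change φ _ m = φ w (charTmul K U' U'⁻¹ • m)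
    induction m using env_tmul_induction with
    | h0 => rw [smul_zero, map_zero, map_zero]
    | ha s t hs ht => rw [smul_add, map_add, map_add, hs, ht]
    | hc U a v =>
      rw [charTmul_smul_tmul, hφ, hφ, ← rightAct_apply, rightAct_rightAct, mulChar_mulChar]
      -- The two sides differ by the factor `U'⁻¹ U'` in front of `U`. Pulled through `U` it becomes
      -- `F`, which crosses over to `w` and is absorbed by `U' U = U' U F`.
      let F : Idem (Bisection X) := conj U ⟨U'⁻¹ * U', inv_mul_idem U'⟩
      have h1 : U'⁻¹ * (U' * U) = U * F.1 := by
        rw [← mul_assoc]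
        exact idem_mul_eq U ⟨U'⁻¹ * U', inv_mul_idem U'⟩
      have h2 : U' * U = U' * U * F.1 := by
        rw [mul_assoc, ← h1, ← mul_assoc, ← mul_assoc, mul_inv_mul]
      rw [h1, ← twistMk_mul_idem K _ _ _ _ _ F.2, ← h2]

/-- The map `a ⊗ v ↦ (1 ⊗ a) ⊗ v`. -/
def rightIncl : SteinbergAlgebra K X ⊗[K] V →ₗ[K] Env K X ⊗[K] V :=
  (Algebra.TensorProduct.includeRight.toLinearMap ∘ₗ
    (MulOpposite.opLinearEquiv K).toLinearMap).rTensor V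

variable {W V} in
-- The action of `U` on `1 ⊗ a 1_U` gives `1_U ⊗ a 1_{U U⁻¹}`, which differs from `1_U ⊗ a` by the
-- commutator with `U U⁻¹`. Hence every tensor can be brought into the image of `twistInv`.
theorem tmul_coinvMk_char (w : W) (U : Bisection X) (a : SteinbergAlgebra K X) (v : V) :
    tmul K (MonoidAlgebra K (Bisection X)) w (coinvMk K X
      ((SteinbergAlgebra.char K U ⊗ₜ[K] MulOpposite.op a) ⊗ₜ[K] v)) =
    tmul K _ (rightAct K W U w) (coinvMk K X (rightIncl K V (mulChar K U a ⊗ₜ v))) := by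
  change _ = tmul K _ (rightAct K W U w) (coinvMk K X
    ((SteinbergAlgebra.char K (1 : Bisection X) ⊗ₜ[K]
      MulOpposite.op (mulChar K U a) : Env K X) ⊗ₜ[K] v))
  rw [rightAct_apply, ← tmul_coinvMk_charTmul, charTmul_smul_tmul, mul_one, mulChar_mulChar]
  refine congrArg _ (coinvMk_eq_of_sub K X (E := ⟨U * U⁻¹, mul_inv_idem U⟩)
    (n := (SteinbergAlgebra.char K U ⊗ₜ[K] MulOpposite.op a) ⊗ₜ[K] v) ?_)
  rw [idemComm_smul_tmul, mul_inv_mul]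

variable {W V} in
-- Moving `E` across the tensor sign produces `1_E ⊗ a 1_E`, and this is `1 ⊗ a 1_E` modulo the
-- commutator with `E`. It shows that `twistInv` respects the defining relations of `Twisted`.
theorem tmul_coinvMk_idem (w : W) (E : Idem (Bisection X)) (a : SteinbergAlgebra K X) (v : V) :
    tmul K (MonoidAlgebra K (Bisection X)) (rightAct K W E.1 w)
      (coinvMk K X (rightIncl K V (a ⊗ₜ v))) =
    tmul K _ w (coinvMk K X (rightIncl K V (mulChar K E.1 a ⊗ₜ v))) := by
  change tmul K _ _ (coinvMk K X
    ((SteinbergAlgebra.char K (1 : Bisection X) ⊗ₜ[K] MulOpposite.op a : Env K X) ⊗ₜ[K]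
      v)) = tmul K _ _ (coinvMk K X
    ((SteinbergAlgebra.char K (1 : Bisection X) ⊗ₜ[K]
      MulOpposite.op (mulChar K E.1 a) : Env K X) ⊗ₜ[K] v))
  rw [rightAct_apply, ← tmul_coinvMk_charTmul, charTmul_smul_tmul, inv_idem E.2]
  refine congrArg _ (coinvMk_eq_of_sub K X (E := E)
    (n := (SteinbergAlgebra.char K (1 : Bisection X) ⊗ₜ[K]
      MulOpposite.op (mulChar K E.1 a) : Env K X) ⊗ₜ[K] v) ?_)
  rw [idemComm_smul_tmul, mulChar_mulChar, mul_one, E.2]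

/-- The map `w ⊗ a ⊗ v ↦ w ⊗ [(1 ⊗ a) ⊗ v]` on the tensor product over the ground field. -/
def twistInvAux : W ⊗[K] (SteinbergAlgebra K X ⊗[K] V) →ₗ[K]
    TensorOver K (MonoidAlgebra K (Bisection X)) W (Coinvariants K X (Env K X ⊗[K] V)) :=
  TensorProduct.lift (LinearMap.mk₂ K
    (fun w t => tmul K (MonoidAlgebra K (Bisection X)) w (coinvMk K X (rightIncl K V t)))
    (fun w w' t => add_tmul _ _ _) (fun k w t => smul_tmul _ _ _)
    (fun w t t' => by rw [map_add, coinvMk_add, tmul_add])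
    (fun k w t => by
      have h : rightIncl K V (k • t) = algebraMap K (Env K X) k • rightIncl K V t := by
        rw [map_smul, algebraMap_smul]
      rw [h, tmul_coinvMk_smul]))

theorem twistInvAux_tmul (w : W) (t : SteinbergAlgebra K X ⊗[K] V) :
    twistInvAux K W V (w ⊗ₜ t) = tmul K _ w (coinvMk K X (rightIncl K V t)) :=
  TensorProduct.lift.tmul _ _

theorem twistInvAux_comp_twistEnd (E : Idem (Bisection X)) :
    twistInvAux K W V ∘ₗ twistEnd K W V E = 0 :=
  twist_ext K W V fun w a v => by
    rw [LinearMap.comp_apply, twistEnd_tmul, map_sub, LinearMap.zero_apply, sub_eq_zero,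
      twistInvAux_tmul, twistInvAux_tmul, tmul_coinvMk_idem]

/-- The map `w ⊗ a ⊗ v ↦ w ⊗ [(1 ⊗ a) ⊗ v]`. -/
def twistInv : Twisted K X W V →ₗ[K]
    TensorOver K (MonoidAlgebra K (Bisection X)) W (Coinvariants K X (Env K X ⊗[K] V)) :=
  Submodule.liftQ _ (twistInvAux K W V)
    (iSup_le fun E => LinearMap.range_le_ker_iff.2 (twistInvAux_comp_twistEnd K W V E))

theorem twistInv_mk (w : W) (a : SteinbergAlgebra K X) (v : V) :
    twistInv K W V (twistMk K w a v) =
      tmul K _ w (coinvMk K X (rightIncl K V (a ⊗ₜ v))) := twistInvAux_tmul K W V w _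

theorem exists_twist_injective : ∃ φ : TensorOver K (MonoidAlgebra K (Bisection X)) W
      (Coinvariants K X (Env K X ⊗[K] V)) →ₗ[K] Twisted K X W V, Function.Injective φ ∧
    ∀ w U a v, φ (tmul K _ w (coinvMk K X
      ((SteinbergAlgebra.char K U ⊗ₜ[K] MulOpposite.op a) ⊗ₜ v))) =
      twistMk K (rightAct K W U w) (mulChar K U a) v := by
  obtain ⟨φ, hφ⟩ := exists_twist K (X := X) W V
  refine ⟨φ, Function.LeftInverse.injective (g := twistInv K W V) fun t => ?_, hφ⟩
  induction t using tensorOver_induction with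
  | h0 => simp only [map_zero]
  | ha s t hs ht => simp only [map_add, hs, ht]
  | ht w m =>
    obtain ⟨m, rfl⟩ := coinvMk_surjective K X m
    induction m using env_tmul_induction with
    | h0 => rw [coinvMk_zero, tmul_zero, map_zero, map_zero]
    | ha s t hs ht => rw [coinvMk_add, tmul_add, map_add, map_add, hs, ht]
    | hc U a v => rw [hφ, twistInv_mk, tmul_coinvMk_char]

/-- The embeddings into `Twisted` are compatible with `f`, so injectivity is inherited from
`exists_twisted_map_injective`. -/
theorem isFlat_coinvariants_free :
    IsFlat K (MonoidAlgebra K (Bisection X)) (Coinvariants K X (Env K X ⊗[K] V)) := by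
  intro W W' _ _ _ _ _ _ _ _ f hf
  obtain ⟨φ, hφ, hφc⟩ := exists_twist_injective K (X := X) W V
  obtain ⟨φ', -, hφc'⟩ := exists_twist_injective K (X := X) W' V
  obtain ⟨ψ, hψ, hψc⟩ := exists_twisted_map_injective K (V := V) f hf
  refine Function.Injective.of_comp (f := φ') ?_
  have h : ⇑φ' ∘ ⇑(mapLeft K _ _ f) = ⇑ψ ∘ ⇑φ := by
    funext t
    simp only [Function.comp_apply]
    induction t using tensorOver_induction with
    | h0 => simp only [map_zero]
    | ha s t hs ht => simp only [map_add, hs, ht]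
    | ht w m =>
      obtain ⟨m, rfl⟩ := coinvMk_surjective K X m
      induction m using env_tmul_induction with
      | h0 => simp only [coinvMk_zero, tmul_zero, map_zero]
      | ha s t hs ht => simp only [coinvMk_add, tmul_add, map_add, hs, ht]
      | hc U a v =>
        rw [mapLeft_tmul, hφc', hφc, hψc, rightAct_apply, rightAct_apply, f.map_smul]
  rw [h]
  exact hψ.comp hφ

/-- A splitting of the free cover of `P` survives the functor, so the quotient of `P` is a retract
of a flat module. -/
theorem isFlat_coinvariants {P : Type (max y u v z)} [AddCommGroup P] [Module K P]
    [Module (Env K X) P] [IsScalarTower K (Env K X) P] [Module.Projective (Env K X) P] :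
    IsFlat K (MonoidAlgebra K (Bisection X)) (Coinvariants K X P) := by
  obtain ⟨i, hi⟩ := Module.projective_lifting_property (freeCover K (Env K X) P) LinearMap.id
    freeCover_surjective
  refine (isFlat_coinvariants_free K (X := X) P).of_retract (coinvMap K i)
    (coinvMap K (freeCover K (Env K X) P)) fun n => ?_
  obtain ⟨n, rfl⟩ := coinvMk_surjective K X n
  rw [coinvMap_mk, coinvMap_mk]
  exact congrArg _ (LinearMap.congr_fun hi n)

end Ample

end AmpleGroupoid

instance (K : Type z) (S : Type u) [Field K] [InverseMonoid S] :
    IsScalarTower K (MonoidAlgebra K S)ᵐᵒᵖ (InverseMonoid.IdemModule K S) where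
  smul_assoc k r t := by
    change (MonoidAlgebra.lift K (Module.End K (InverseMonoid.Idem S →₀ K))ᵐᵒᵖ S
      (InverseMonoid.conjHom K S) (k • r.unop)).unop _ = k • (MonoidAlgebra.lift K
        (Module.End K (InverseMonoid.Idem S →₀ K))ᵐᵒᵖ S (InverseMonoid.conjHom K S) r.unop).unop _
    rw [map_smul, MulOpposite.unop_smul]
    rfl

/-! ### The isomorphism of tensor products in degree zero -/

namespace AmpleGroupoid

open scoped TensorProduct ModuleCat
open InverseMonoid Hochschild NCTensor

section Etale

variable (K : Type z) [Field K] {X : Type u} [Groupoid.{v} X] [TopologicalSpace (Arr X)]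
  [IsEtale X] [CompactSpace (UnitSpace X)] {M : Type w} [AddCommGroup M] [Module (Env K X) M]

/-- An idempotent, as a basis vector of the free module on idempotents. -/
def idemSingle (E : Idem (Bisection X)) : IdemModule K (Bisection X) := Finsupp.single E 1

variable (X) in
/-- The unit, as an idempotent. -/
def idemOne : Idem (Bisection X) := ⟨1, one_mul 1⟩

theorem tmul_idemOne_conj (U : Bisection X) (m : M) :
    tmul K (MonoidAlgebra K (Bisection X)) (idemSingle K (idemOne X))
      (coinvMk K X (charTmul K U U⁻¹ • m)) =
    tmul K _ (idemSingle K ⟨U⁻¹ * U, inv_mul_idem U⟩) (coinvMk K X m) := by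
  rw [tmul_coinvMk_charTmul]
  refine congrArg (fun t => tmul K _ t _) ((op_of_smul_single K _ U (idemOne X)).trans ?_)
  refine congrArg (idemSingle K) (Subtype.ext ?_)
  change U⁻¹ * 1 * U = U⁻¹ * U
  rw [mul_one]

/-- Since `E = 1 · E` in `KE(S)`, the left side is `1 ⊗ [E m E]`, and `[E m E] = [m E]` modulo the
commutator of `E` with `m E`. All tensors can therefore be written with the idempotent `1`. -/
theorem tmul_idemSingle_right (E : Idem (Bisection X)) (m : M) :
    tmul K (MonoidAlgebra K (Bisection X)) (idemSingle K E) (coinvMk K X m) =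
    tmul K _ (idemSingle K (idemOne X)) (coinvMk K X (charTmul K 1 E.1 • m)) := by
  have h : coinvMk K X (charTmul K 1 E.1 • m) = coinvMk K X (charTmul K E.1 E.1⁻¹ • m) := by
    symm
    refine coinvMk_eq_of_sub K X E (n := charTmul K 1 E.1 • m) ?_
    rw [idemComm_smul, smul_smul, smul_smul, charTmul_mul, charTmul_mul, inv_idem E.2, E.2,
      mul_one, mul_one]
  rw [h, tmul_idemOne_conj]
  refine congrArg (fun t => tmul K _ (idemSingle K t) _) (Subtype.ext ?_)
  change E.1 = E.1⁻¹ * E.1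
  rw [inv_idem E.2, E.2]

theorem tmul_idemSingle_left (E : Idem (Bisection X)) (m : M) :
    tmul K (MonoidAlgebra K (Bisection X)) (idemSingle K E) (coinvMk K X m) =
    tmul K _ (idemSingle K (idemOne X)) (coinvMk K X (charTmul K E.1 1 • m)) := by
  rw [tmul_idemSingle_right, ← coinvMk_eq_of_sub K X E (n := m) (idemComm_smul K E m).symm]

/-- The trace property. Modulo commutators `U m = U U⁻¹ U m` equals `U m U U⁻¹`, the action of `U`
on `m U`; transferring `U` to the left factor replaces `1` by `U⁻¹ U`, which is then absorbed into
`m U`. -/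
theorem tmul_idemOne_comm_char (U : Bisection X) (m : M) :
    tmul K (MonoidAlgebra K (Bisection X)) (idemSingle K (idemOne X))
      (coinvMk K X (charTmul K U 1 • m)) =
    tmul K _ (idemSingle K (idemOne X)) (coinvMk K X (charTmul K 1 U • m)) := by
  have h : coinvMk K X (charTmul K U 1 • m) =
      coinvMk K X (charTmul K U U⁻¹ • charTmul K 1 U • m) := by
    refine coinvMk_eq_of_sub K X ⟨U * U⁻¹, mul_inv_idem U⟩ (n := charTmul K U 1 • m) ?_
    rw [idemComm_smul, smul_smul, smul_smul, smul_smul, charTmul_mul, charTmul_mul, charTmul_mul,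
      mul_inv_mul, mul_one, mul_one, one_mul, one_mul]
  rw [h, tmul_idemOne_conj, tmul_idemSingle_right, smul_smul, charTmul_mul, mul_one, ← mul_assoc,
    mul_inv_mul]

variable (X M) in
/-- The map `m ↦ 1 ⊗ [m]`. -/
def idemOneTmul : M →ₗ[ℤ]
    TensorOver K (MonoidAlgebra K (Bisection X)) (IdemModule K (Bisection X))
      (Coinvariants K X M) :=
  AddMonoidHom.toIntLinearMap
    { toFun := fun m => tmul K _ (idemSingle K (idemOne X)) (coinvMk K X m)
      map_zero' := by rw [coinvMk_zero, tmul_zero]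
      map_add' := fun m m' => by rw [coinvMk_add, tmul_add] }

theorem idemOneTmul_apply (m : M) : idemOneTmul K X M m =
    tmul K _ (idemSingle K (idemOne X)) (coinvMk K X m) := rfl

theorem idemOneTmul_smul (k : K) (b : Env K X) (m : M) :
    idemOneTmul K X M ((k • b) • m) = k • idemOneTmul K X M (b • m) := by
  have h : k • b = algebraMap K (Env K X) k * b := Algebra.smul_def k b
  rw [h, mul_smul, idemOneTmul_apply, tmul_coinvMk_smul, idemOneTmul_apply]

theorem idemOneTmul_comm (a : SteinbergAlgebra K X) (m : M) :
    idemOneTmul K X M ((a ⊗ₜ[K] 1 : Env K X) • m) =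
      idemOneTmul K X M ((1 ⊗ₜ[K] MulOpposite.op a : Env K X) • m) := by
  induction a using SteinbergAlgebra.induction with
  | hc U => exact tmul_idemOne_comm_char K U m
  | h0 => rw [TensorProduct.zero_tmul, MulOpposite.op_zero, TensorProduct.tmul_zero]
  | ha f g hf hg =>
    rw [TensorProduct.add_tmul, MulOpposite.op_add, TensorProduct.tmul_add, add_smul, add_smul,
      map_add, map_add, hf, hg]
  | hs k f hf =>
    rw [← TensorProduct.smul_tmul', MulOpposite.op_smul, TensorProduct.tmul_smul,
      idemOneTmul_smul, idemOneTmul_smul, hf]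

variable (X M) in
/-- The pairing `(a, m) ↦ 1 ⊗ [a · m]`. -/
def idemOnePairing : SteinbergAlgebra K X →ₗ[K] M →ₗ[ℤ]
    TensorOver K (MonoidAlgebra K (Bisection X)) (IdemModule K (Bisection X))
      (Coinvariants K X M) where
  toFun a := idemOneTmul K X M ∘ₗ Module.toModuleEnd ℤ M (a ⊗ₜ[K] 1 : Env K X)
  map_add' a a' := LinearMap.ext fun m => by
    have h : ((a + a') ⊗ₜ[K] 1 : Env K X) • m =
        (a ⊗ₜ[K] 1 : Env K X) • m + (a' ⊗ₜ[K] 1 : Env K X) • m := by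
      rw [TensorProduct.add_tmul, add_smul]
    exact (congrArg (idemOneTmul K X M) h).trans (map_add _ _ _)
  map_smul' k a := LinearMap.ext fun m => idemOneTmul_smul K k (a ⊗ₜ[K] 1) m

theorem idemOnePairing_apply (a : SteinbergAlgebra K X) (m : M) :
    idemOnePairing K X M a m = idemOneTmul K X M ((a ⊗ₜ[K] 1 : Env K X) • m) := rfl

/-- The trace property moves `c` from the left of `a b m` to its right; this is the balancing over
the enveloping algebra needed for `envToIdem`. -/
theorem idemOnePairing_mul_mul (a b c : SteinbergAlgebra K X) (m : M) :
    idemOnePairing K X M (c * a * b) m =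
      idemOnePairing K X M a ((b ⊗ₜ[K] MulOpposite.op c : Env K X) • m) := by
  have h := idemOneTmul_comm K c (((a * b) ⊗ₜ[K] 1 : Env K X) • m)
  rw [smul_smul, smul_smul, Algebra.TensorProduct.tmul_mul_tmul,
    Algebra.TensorProduct.tmul_mul_tmul, one_mul, one_mul, mul_one, ← mul_assoc] at h
  rw [idemOnePairing_apply, idemOnePairing_apply, h, smul_smul,
    Algebra.TensorProduct.tmul_mul_tmul, one_mul]

variable (X) in
/-- An element of the Steinberg algebra, as an element of the right module over the enveloping
algebra. -/
def toRightEnv : SteinbergAlgebra K X ≃ₗ[K] RightEnv K (SteinbergAlgebra K X) :=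
  LinearEquiv.refl K (SteinbergAlgebra K X)

theorem op_tmul_smul_toRightEnv (a b c : SteinbergAlgebra K X) :
    MulOpposite.op (b ⊗ₜ[K] MulOpposite.op c : Env K X) • toRightEnv K X a =
      toRightEnv K X (c * a * b) := op_tmul_smul K _ b _ a

variable (X M) in
/-- The map `a ⊗ m ↦ 1 ⊗ [a · m]`. -/
def envToIdem : TensorOver K (Env K X) (RightEnv K (SteinbergAlgebra K X)) M →ₗ[K]
    TensorOver K (MonoidAlgebra K (Bisection X)) (IdemModule K (Bisection X))
      (Coinvariants K X M) :=
  NCTensor.lift (idemOnePairing K X M ∘ₗ (toRightEnv K X).symm.toLinearMap) (by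
    intro a r m
    have h : ∀ b c, (idemOnePairing K X M ∘ₗ (toRightEnv K X).symm.toLinearMap)
        (MulOpposite.op (b ⊗ₜ[K] c : Env K X) • a) m =
        (idemOnePairing K X M ∘ₗ (toRightEnv K X).symm.toLinearMap) a
          ((b ⊗ₜ[K] c : Env K X) • m) := fun b c => by
      obtain ⟨a, rfl⟩ := (toRightEnv K X).surjective a
      rw [← MulOpposite.op_unop c, op_tmul_smul_toRightEnv]
      exact idemOnePairing_mul_mul K a b c.unop m
    induction r using TensorProduct.induction_on with
    | zero => simpa only [TensorProduct.zero_tmul] using h 0 0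
    | add r s hr hs =>
      rw [MulOpposite.op_add, add_smul, add_smul, map_add, map_add, LinearMap.add_apply, hr, hs]
    | tmul b c => exact h b c)

theorem envToIdem_tmul (a : SteinbergAlgebra K X) (m : M) :
    envToIdem K X M (tmul K (Env K X) (toRightEnv K X a) m) =
      idemOneTmul K X M ((a ⊗ₜ[K] 1 : Env K X) • m) :=
  lift_tmul _ _ _ m

variable (X M) in
/-- The pairing `(a, m) ↦ a ⊗ m`. -/
def envPairing : SteinbergAlgebra K X →ₗ[K] M →ₗ[ℤ]
    TensorOver K (Env K X) (RightEnv K (SteinbergAlgebra K X)) M where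
  toFun a := AddMonoidHom.toIntLinearMap
    { toFun := fun m => tmul K (Env K X) (toRightEnv K X a) m
      map_zero' := tmul_zero _
      map_add' := tmul_add _ }
  map_add' a a' := LinearMap.ext fun m => add_tmul (toRightEnv K X a) (toRightEnv K X a') m
  map_smul' k a := LinearMap.ext fun m => smul_tmul k (toRightEnv K X a) m

theorem envPairing_apply (a : SteinbergAlgebra K X) (m : M) :
    envPairing K X M a m = tmul K (Env K X) (toRightEnv K X a) m := rfl

theorem envPairing_smul (a b c : SteinbergAlgebra K X) (m : M) :
    envPairing K X M a ((b ⊗ₜ[K] MulOpposite.op c : Env K X) • m) =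
      envPairing K X M (c * a * b) m := by
  rw [envPairing_apply, envPairing_apply, ← op_smul_tmul, op_tmul_smul_toRightEnv]

theorem smul_envPairing (k : K) (a : SteinbergAlgebra K X) (m : M) :
    envPairing K X M (k • a) m = k • envPairing K X M a m := smul_tmul k (toRightEnv K X a) m

theorem envPairing_charTmul (E U V : Bisection X) (m : M) :
    envPairing K X M (SteinbergAlgebra.char K E) (charTmul K U V • m) =
      envPairing K X M (SteinbergAlgebra.char K (V * E * U)) m := by
  rw [envPairing_smul, SteinbergAlgebra.char_mul, SteinbergAlgebra.char_mul]

variable (X) in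
/-- The map from the free module on idempotents to the Steinberg algebra. -/
def idemChar : IdemModule K (Bisection X) →ₗ[K] SteinbergAlgebra K X :=
  Finsupp.linearCombination K fun E : Idem (Bisection X) => SteinbergAlgebra.char K E.1

theorem idemChar_single (E : Idem (Bisection X)) :
    idemChar K X (idemSingle K E) = SteinbergAlgebra.char K E.1 :=
  (Finsupp.linearCombination_single K 1 E).trans (one_smul _ _)

theorem idemModule_induction {p : IdemModule K (Bisection X) → Prop} (h0 : p 0)
    (ha : ∀ s t, p s → p t → p (s + t)) (hs : ∀ (k : K) E, p (k • idemSingle K E))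
    (t : IdemModule K (Bisection X)) : p t := by
  refine Finsupp.induction_linear (motive := p) t h0 ha fun E k => ?_
  have h : (Finsupp.single E k : Idem (Bisection X) →₀ K) = k • Finsupp.single E 1 := by
    rw [Finsupp.smul_single, smul_eq_mul, mul_one]
  exact h ▸ hs k E

variable (X M) in
/-- The map `E ⊗ [m] ↦ 1_E ⊗ m`. -/
def idemToEnv : TensorOver K (MonoidAlgebra K (Bisection X)) (IdemModule K (Bisection X))
      (Coinvariants K X M) →ₗ[K]
    TensorOver K (Env K X) (RightEnv K (SteinbergAlgebra K X)) M :=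
  coinvTensorLift K (envPairing K X M ∘ₗ idemChar K X)
    (fun w k m => by
      rw [LinearMap.comp_apply, Algebra.TensorProduct.algebraMap_apply]
      refine (envPairing_smul K _ _ 1 m).trans ?_
      rw [one_mul, ← Algebra.commutes, ← Algebra.smul_def, smul_envPairing])
    (fun w E m => by
      rw [LinearMap.comp_apply]
      induction w using idemModule_induction with
      | h0 => rw [map_zero, map_zero, LinearMap.zero_apply]
      | ha s t hs ht => rw [map_add, map_add, LinearMap.add_apply, hs, ht, add_zero]
      | hs k F =>
        -- A commutator with `E` paired with `1_F` gives `1_{FE} - 1_{EF}`, which vanishes because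
        -- idempotents commute.
        rw [(idemChar K X).map_smul, smul_envPairing, idemChar_single, idemComm_smul, map_sub,
          envPairing_charTmul, envPairing_charTmul, one_mul, mul_one, idem_comm E.2 F.2, sub_self,
          smul_zero])
    (fun w U m => by
      rw [LinearMap.comp_apply, LinearMap.comp_apply]
      induction w using idemModule_induction with
      | h0 => rw [smul_zero, map_zero, map_zero, LinearMap.zero_apply, LinearMap.zero_apply]
      | ha s t hs ht =>
        rw [smul_add, map_add, map_add, map_add, map_add, LinearMap.add_apply,
          LinearMap.add_apply, hs, ht]
      | hs k F =>
        have h : MulOpposite.op (MonoidAlgebra.of K _ U) • idemSingle K F =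
          idemSingle K (conj U F) := op_of_smul_single K _ U F
        rw [← smul_comm k, h, (idemChar K X).map_smul, (idemChar K X).map_smul, smul_envPairing,
          smul_envPairing, idemChar_single, idemChar_single, envPairing_charTmul]
        rfl)

theorem idemToEnv_tmul (E : Idem (Bisection X)) (m : M) :
    idemToEnv K X M (tmul K _ (idemSingle K E) (coinvMk K X m)) =
      envPairing K X M (SteinbergAlgebra.char K E.1) m :=
  (coinvTensorLift_tmul K _ _ _ _ _ _).trans
    (congrArg (fun a => envPairing K X M a m) (idemChar_single K E))

variable (X M) in
/-- The isomorphism `A ⊗_{A ⊗ Aᵒᵖ} M ≃ K E(S) ⊗_{K S} M / [L, M]`. -/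
def envEquivIdem : TensorOver K (Env K X) (RightEnv K (SteinbergAlgebra K X)) M ≃ₗ[K]
    TensorOver K (MonoidAlgebra K (Bisection X)) (IdemModule K (Bisection X))
      (Coinvariants K X M) :=
  LinearEquiv.ofLinearMap (envToIdem K X M) (idemToEnv K X M)
    (LinearMap.ext fun t => by
      rw [LinearMap.comp_apply, LinearMap.id_apply]
      induction t using tensorOver_induction with
      | h0 => rw [map_zero, map_zero]
      | ha s t hs ht => rw [map_add, map_add, hs, ht]
      | ht w m =>
        obtain ⟨m, rfl⟩ := coinvMk_surjective K X m
        induction w using idemModule_induction with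
        | h0 => rw [zero_tmul, map_zero, map_zero]
        | ha s t hs ht => rw [add_tmul, map_add, map_add, hs, ht]
        | hs k E =>
          rw [smul_tmul, map_smul, map_smul, idemToEnv_tmul, tmul_idemSingle_left]
          exact congrArg (k • ·) (envToIdem_tmul K _ m))
    (LinearMap.ext fun t => by
      rw [LinearMap.comp_apply, LinearMap.id_apply]
      induction t using tensorOver_induction with
      | h0 => rw [map_zero, map_zero]
      | ha s t hs ht => rw [map_add, map_add, hs, ht]
      | ht a m =>
        obtain ⟨a, rfl⟩ := (toRightEnv K X).surjective a
        rw [envToIdem_tmul]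
        refine (idemToEnv_tmul K _ _).trans ((envPairing_smul K _ a 1 m).trans ?_)
        rw [one_mul, envPairing_apply]
        change tmul _ _ (toRightEnv K X (1 * a)) m = _
        rw [one_mul])

end Etale

end AmpleGroupoid

/-! ### Naturality of the comparison, and its extension to complexes -/

namespace AmpleGroupoid

open scoped TensorProduct ModuleCat
open InverseMonoid Hochschild NCTensor

section Comparison

variable (K : Type z) [Field K] {X : Type u} [Groupoid.{v} X] [TopologicalSpace (Arr X)]
  [IsEtale X] [CompactSpace (UnitSpace X)]

variable (X) in
/-- The natural isomorphism `A ⊗_{A ⊗ Aᵒᵖ} M ≅ K E(S) ⊗_{K S} M / [L, M]`. -/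
def tensorFunctorIso :
    tensorFunctor.{max u v z, max u v z, w, z} K (Env K X)
        (RightEnv K (SteinbergAlgebra K X)) ≅
      coinvFunctor.{u, v, w, z} K X ⋙ tensorFunctor.{max u v z, max u v z, w, z} K
        (MonoidAlgebra K (Bisection X)) (IdemModule K (Bisection X)) :=
  NatIso.ofComponents (fun M => (envEquivIdem K X M).toModuleIso) fun {M N} f =>
    ModuleCat.hom_ext (LinearMap.ext fun t => by
      change envToIdem K X N (mapRight K _ _ f.hom t) =
        mapRight K _ _ (coinvMap K f.hom) (envToIdem K X M t)
      induction t using tensorOver_induction with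
      | h0 => simp only [map_zero]
      | ha s t hs ht => simp only [map_add, hs, ht]
      | ht a m =>
        obtain ⟨a, rfl⟩ := (toRightEnv K X).surjective a
        rw [mapRight_tmul, envToIdem_tmul, envToIdem_tmul, ← f.hom.map_smul]
        rfl)

variable (X) in
/-- The isomorphism of complexes induced by `tensorFunctorIso`. -/
def tensorComplexIso (C : ChainComplex (ModuleCat.{w} (Env K X)) ℕ) :
    ((tensorFunctor.{max u v z, max u v z, w, z} K (Env K X)
      (RightEnv K (SteinbergAlgebra K X))).mapHomologicalComplex (ComplexShape.down ℕ)).obj C ≅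
    tensorComplex K (IdemModule K (Bisection X))
      (((coinvFunctor.{u, v, w, z} K X).mapHomologicalComplex (ComplexShape.down ℕ)).obj C) :=
  HomologicalComplex.Hom.isoOfComponents (fun i => (tensorFunctorIso.{u, v, w, z} K X).app (C.X i))
    fun i j _ => ((tensorFunctorIso.{u, v, w, z} K X).hom.naturality (C.d i j)).symm

end Comparison

/-! ### Commutators with idempotents span `[L, M]` -/

section Quotient

variable (K : Type z) [Field K] {X : Type u} [Groupoid.{v} X] [TopologicalSpace (Arr X)]
  [IsEtale X] [CompactSpace (UnitSpace X)] (M : Type w) [AddCommGroup M] [Module K M]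
  [Module (SteinbergAlgebra K X) M] [Module (SteinbergAlgebra K X)ᵐᵒᵖ M]
  [SMulCommClass (SteinbergAlgebra K X) (SteinbergAlgebra K X)ᵐᵒᵖ M]
  [IsScalarTower K (SteinbergAlgebra K X) M] [IsScalarTower K (SteinbergAlgebra K X)ᵐᵒᵖ M]

variable {M} in
theorem tmul_smul_leftEnv (a b : SteinbergAlgebra K X) (m : M) :
    (a ⊗ₜ[K] MulOpposite.op b : Env K X) • (show LeftEnv K (SteinbergAlgebra K X) M from m) =
      (show LeftEnv K (SteinbergAlgebra K X) M from a • MulOpposite.op b • m) :=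
  TensorProduct.Algebra.smul_def a (MulOpposite.op b) m

variable (X) in
/-- A bimodule, as a module over the enveloping algebra in a larger universe. -/
abbrev LiftEnv : Type (max u v w z) :=
  ULift.{max u v z, w} (LeftEnv K (SteinbergAlgebra K X) M)

variable (X) {M} in
/-- The identification of a bimodule with the associated module over the enveloping algebra. -/
def toLiftEnv : M ≃+ LiftEnv K X M :=
  (AddEquiv.ulift (α := LeftEnv K (SteinbergAlgebra K X) M)).symm

variable {M} in
theorem charTmul_smul_up (U V : Bisection X) (m : M) :
    charTmul K U V • toLiftEnv K X m =
      toLiftEnv K X (SteinbergAlgebra.char K U • MulOpposite.op (SteinbergAlgebra.char K V) • m) :=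
  congrArg ULift.up (tmul_smul_leftEnv K _ _ m)

theorem idemComm_smul_up (E : Idem (Bisection X)) (m : M) :
    idemComm K E • toLiftEnv K X m =
      toLiftEnv K X (SteinbergAlgebra.char K E.1 • m -
        MulOpposite.op (SteinbergAlgebra.char K E.1) • m) := by
  rw [idemComm_smul, charTmul_smul_up, charTmul_smul_up, SteinbergAlgebra.char_one,
    MulOpposite.op_one, one_smul, one_smul, map_sub]

variable {M} in
theorem algebraMap_smul_up (k : K) (m : M) :
    algebraMap K (Env K X) k • toLiftEnv K X m = toLiftEnv K X (k • m) := by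
  refine (congrArg ULift.up (tmul_smul_leftEnv K _ 1 m)).trans (congrArg ULift.up ?_)
  change algebraMap K (SteinbergAlgebra K X) k • MulOpposite.op (1 : SteinbergAlgebra K X) • m = _
  rw [MulOpposite.op_one, one_smul, algebraMap_smul]

variable (X) in
/-- The quotient map from a bimodule to `M / [L, M]`. -/
def liftEnvMk : LiftEnv K X M →+ (quotientRep K X M).asModule where
  toFun m := (quotientRep K X M).asModuleEquiv.symm ((commutator K X M).mkQ m.down)
  map_zero' := map_zero ((quotientRep K X M).asModuleEquiv.symm.toLinearMap ∘ₗ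
    (commutator K X M).mkQ)
  map_add' m m' := map_add ((quotientRep K X M).asModuleEquiv.symm.toLinearMap ∘ₗ
    (commutator K X M).mkQ) m.down m'.down

variable {M}

theorem liftEnvMk_up (m : M) : liftEnvMk K X M (toLiftEnv K X m) =
    (quotientRep K X M).asModuleEquiv.symm ((commutator K X M).mkQ m) := rfl

theorem liftEnvMk_up_eq_zero {m : M} :
    liftEnvMk K X M (toLiftEnv K X m) = 0 ↔ m ∈ commutator K X M := by
  rw [liftEnvMk_up, LinearEquiv.map_eq_zero_iff, Submodule.mkQ_apply,
    Submodule.Quotient.mk_eq_zero]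

theorem conjAlgHom_smul_smul {N : Type*} [AddCommGroup N] [Module (Env K X) N] (k : K)
    (r : MonoidAlgebra K (Bisection X)) (m : N) :
    conjAlgHom K X (k • r) • m = algebraMap K (Env K X) k • conjAlgHom K X r • m := by
  have h : conjAlgHom K X (k • r) = algebraMap K (Env K X) k * conjAlgHom K X r := by
    rw [Algebra.smul_def, map_mul, AlgHom.commutes]
  rw [h, mul_smul]

theorem liftEnvMk_smul (r : MonoidAlgebra K (Bisection X)) (m : LiftEnv K X M) :
    liftEnvMk K X M (conjAlgHom K X r • m) = r • liftEnvMk K X M m := by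
  induction r using MonoidAlgebra.induction_on generalizing m with
  | of U =>
    obtain ⟨m, rfl⟩ := (toLiftEnv K X).surjective m
    rw [conjAlgHom_of, charTmul_smul_up]
    refine Eq.trans ?_ ((quotientRep K X M).asModuleEquiv_symm_map_rho U
      ((commutator K X M).mkQ m))
    rw [liftEnvMk_up, ← sliceElt_eq_char, ← sliceElt_eq_char]
    rfl
  | add r s hr hs => rw [map_add, add_smul, add_smul, map_add, hr, hs]
  | smul k r hr =>
    have h : ∀ m : LiftEnv K X M, liftEnvMk K X M (algebraMap K (Env K X) k • m) =
        algebraMap K (MonoidAlgebra K (Bisection X)) k • liftEnvMk K X M m := by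
      intro m
      obtain ⟨m, rfl⟩ := (toLiftEnv K X).surjective m
      rw [algebraMap_smul_up, liftEnvMk_up, map_smul]
      exact (quotientRep K X M).asModuleEquiv_symm_map_smul k _
    have e : conjAlgHom K X (k • r) • m = algebraMap K (Env K X) k • conjAlgHom K X r • m :=
      conjAlgHom_smul_smul K k r m
    rw [e, h, hr, Algebra.smul_def, mul_smul]

theorem char_sub_mem_conjRelations {E : Bisection X} (hE : E * E = E) (m : M) :
    toLiftEnv K X (SteinbergAlgebra.char K E • m - MulOpposite.op (SteinbergAlgebra.char K E) • m) ∈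
      conjRelations K X (LiftEnv K X M) :=
  Submodule.mem_iSup_of_mem (p := fun E => LinearMap.range (idemEnd K (LiftEnv K X M) E)) ⟨E, hE⟩
    ⟨toLiftEnv K X m, idemComm_smul_up K M ⟨E, hE⟩ m⟩

/-- A locally constant function on the compact unit space is a finite linear combination of
characteristic functions of clopen sets, and these are idempotent bisections. -/
theorem up_mem_conjRelations {m : M} (hm : m ∈ commutator K X M) :
    toLiftEnv K X m ∈ conjRelations K X (LiftEnv K X M) := by
  have hs : ∀ (k : K) (m : M), toLiftEnv K X m ∈ conjRelations K X _ →
      toLiftEnv K X (k • m) ∈ conjRelations K X (LiftEnv K X M) := by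
    intro k m hm
    have h := (conjRelations K X (LiftEnv K X M)).smul_mem
      (algebraMap K (MonoidAlgebra K (Bisection X)) k) hm
    have e : toLiftEnv K X (k • m) =
        conjAlgHom K X (algebraMap K _ k) • toLiftEnv K X m := by
      rw [AlgHom.commutes]
      exact (algebraMap_smul_up K k m).symm
    rw [e]
    exact h
  refine Submodule.span_induction
    (p := fun m _ => toLiftEnv K X m ∈ conjRelations K X (LiftEnv K X M))
    ?_ ?_ ?_ ?_ hm
  · rintro _ ⟨f, m, rfl⟩
    rw [ofLocallyConstant_eq_sum]
    refine Finset.sum_induction _ (fun a : SteinbergAlgebra K X =>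
      toLiftEnv K X (a • m - MulOpposite.op a • m) ∈ conjRelations K X (LiftEnv K X M)) ?_ ?_ ?_
    · intro a b ha hb
      rw [add_smul, MulOpposite.op_add, add_smul, add_sub_add_comm, map_add]
      exact add_mem ha hb
    · rw [zero_smul, MulOpposite.op_zero, zero_smul, sub_zero, map_zero]
      exact zero_mem (conjRelations K X (LiftEnv K X M))
    · intro k _
      rw [MulOpposite.op_smul, smul_assoc, smul_assoc, ← smul_sub]
      exact hs k _ (char_sub_mem_conjRelations K (Bisection.ofClopen_mul_self _ _) m)
  · rw [map_zero]
    exact zero_mem (conjRelations K X (LiftEnv K X M))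
  · intro a b _ _ ha hb
    rw [map_add]
    exact add_mem (S := Submodule _ (ConjModule K X (LiftEnv K X M))) ha hb
  · exact fun k m _ hm => hs k m hm

variable (M)

variable (X) in
/-- The quotient map from a bimodule to `M / [L, M]`, as a map of modules over the monoid algebra
of compact open bisections. -/
def conjModuleMk : ConjModule K X (LiftEnv K X M) →ₗ[MonoidAlgebra K (Bisection X)]
    ULift.{max u v z} (quotientRep K X M).asModule where
  toFun m := ULift.up (liftEnvMk K X M m)
  map_add' m m' := congrArg ULift.up (map_add (liftEnvMk K X M) m m')
  map_smul' r m := congrArg ULift.up (liftEnvMk_smul K r m)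

/-- Both subspaces have the same span. One inclusion is `up_mem_conjRelations`; the other holds
because each idempotent bisection is a clopen set of units, whose characteristic function is locally
constant. -/
theorem ker_conjModuleMk : LinearMap.ker (conjModuleMk K X M) =
    conjRelations K X (LiftEnv K X M) := by
  refine le_antisymm ?_ ?_
  · intro m hm
    obtain ⟨m, rfl⟩ := (toLiftEnv K X).surjective m
    exact up_mem_conjRelations K ((liftEnvMk_up_eq_zero K).1 (congrArg ULift.down hm))
  · have h : idemCommRange K X (LiftEnv K X M) ≤
        LinearMap.ker (liftEnvMk K X M).toIntLinearMap := by
      refine iSup_le fun E => ?_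
      rintro _ ⟨m, rfl⟩
      obtain ⟨m, rfl⟩ := (toLiftEnv K X).surjective m
      obtain ⟨f, hf⟩ := exists_ofLocallyConstant_eq_char (K := K) E.2
      refine (congrArg (liftEnvMk K X M) (idemComm_smul_up K M E m)).trans
        ((liftEnvMk_up_eq_zero K).2 (Submodule.subset_span ⟨f, m, ?_⟩))
      rw [hf]
    exact fun m hm => congrArg ULift.up (h hm)

theorem conjModuleMk_surjective : Function.Surjective (conjModuleMk K X M) := by
  rintro ⟨t⟩
  obtain ⟨t, rfl⟩ := (quotientRep K X M).asModuleEquiv.symm.surjective t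
  obtain ⟨m, rfl⟩ := (commutator K X M).mkQ_surjective t
  exact ⟨toLiftEnv K X m, rfl⟩

variable (X) in
/-- The quotient by commutators with idempotents is `M / [L, M]`. -/
def coinvEquiv : Coinvariants K X (LiftEnv K X M) ≃ₗ[MonoidAlgebra K (Bisection X)]
    ULift.{max u v z} (quotientRep K X M).asModule :=
  (Submodule.quotEquivOfEq _ _ (ker_conjModuleMk K M).symm).trans
    ((conjModuleMk K X M).quotKerEquivOfSurjective (conjModuleMk_surjective K M))

variable (X) in
/-- `coinvEquiv` as an isomorphism in the category of modules. -/
def coinvIso : (coinvFunctor.{u, v, max u v w z, z} K X).obj (ModuleCat.of _ (LiftEnv K X M)) ≅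
    ModuleCat.of (MonoidAlgebra K (Bisection X))
      (ULift.{max u v z} (quotientRep K X M).asModule) :=
  LinearEquiv.toModuleIso.{max u v w z, max u v z} (coinvEquiv K X M)

end Quotient

/-! ### The flat resolution of the quotient, and the comparison of homology -/

section Resolution

variable (K : Type z) [Field K] {X : Type u} [Groupoid.{v} X] [TopologicalSpace (Arr X)]
  [IsAmple X] [CompactSpace (UnitSpace X)]

/-- The quotient by commutators of a projective resolution of bimodules is a flat resolution. -/
def coinvResolution {Y : ModuleCat.{max u v w z} (Env K X)} (P : ProjectiveResolution Y) :
    FlatResolution K (MonoidAlgebra K (Bisection X)) ((coinvFunctor K X).obj Y) where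
  complex := ((coinvFunctor.{u, v, max u v w z, z} K X).mapHomologicalComplex
    (ComplexShape.down ℕ)).obj P.complex
  augmentation := (coinvFunctor K X).map (P.π.f 0)
  flat n := by
    have : Module.Projective (Env K X) (P.complex.X n) :=
      (IsProjective.iff_projective _).2 (P.projective n)
    exact isFlat_coinvariants.{u, v, max u v w z, z} K
  exact_succ n := coinvMap_exact K
    ((ShortComplex.ShortExact.moduleCat_exact_iff_function_exact _).1 (P.exact_succ n))
  exact_zero := coinvMap_exact K
    ((ShortComplex.ShortExact.moduleCat_exact_iff_function_exact _).1 P.exact₀)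
  surjective := coinvMap_surjective K
    ((ModuleCat.epi_iff_surjective _).1 (inferInstanceAs (Epi (P.π.f 0))))

end Resolution

end AmpleGroupoid

end

theorem mainTheorem5 {X : Type u} [Groupoid.{v} X] [TopologicalSpace (AmpleGroupoid.Arr X)]
    [AmpleGroupoid.IsAmple X] [CompactSpace (AmpleGroupoid.UnitSpace X)]
    (K : Type z) [Field K] (M : Type w) [AddCommGroup M] [Module K M]
    [Module (AmpleGroupoid.SteinbergAlgebra K X) M]
    [Module (AmpleGroupoid.SteinbergAlgebra K X)ᵐᵒᵖ M]
    [SMulCommClass (AmpleGroupoid.SteinbergAlgebra K X)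
      (AmpleGroupoid.SteinbergAlgebra K X)ᵐᵒᵖ M]
    [IsScalarTower K (AmpleGroupoid.SteinbergAlgebra K X) M]
    [IsScalarTower K (AmpleGroupoid.SteinbergAlgebra K X)ᵐᵒᵖ M] (n : ℕ) :
    Nonempty
      (Hochschild.homology K (AmpleGroupoid.SteinbergAlgebra K X) M n ≃ₗ[K]
        InverseMonoid.homology K (AmpleGroupoid.Bisection X)
          (AmpleGroupoid.quotientRep K X M).asModule n) := by
  let P := projectiveResolution (ModuleCat.of (AmpleGroupoid.Env K X)
    (AmpleGroupoid.LiftEnv.{u, v, w, z} K X M))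
  let C := AmpleGroupoid.coinvResolution.{u, v, w, z} K P
  -- `C` and `Q` resolve the same `KS`-module, the former by flat and the latter by projective
  -- modules. This module is `Coinvariants`, which `l` below replaces by `M / [L, M]`.
  let Q := projectiveResolution ((AmpleGroupoid.coinvFunctor.{u, v, max u v w z, z} K X).obj
    (ModuleCat.of (AmpleGroupoid.Env K X) (AmpleGroupoid.LiftEnv.{u, v, w, z} K X M)))
  obtain ⟨e⟩ := C.exists_homology_equiv
    (NCTensor.FlatResolution.ofProjective.{max u v z, max u v w z, z} Q) n
    (InverseMonoid.IdemModule K (AmpleGroupoid.Bisection X))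
  let i := P.isoLeftDerivedObj (NCTensor.tensorFunctor.{max u v z, max u v z, max u v w z, z} K
    (AmpleGroupoid.Env K X) (Hochschild.RightEnv K (AmpleGroupoid.SteinbergAlgebra K X))) n
  let j := Q.isoLeftDerivedObj (NCTensor.tensorFunctor.{max u v z, max u v z, max u v w z, z} K
    (MonoidAlgebra K (AmpleGroupoid.Bisection X))
    (InverseMonoid.IdemModule K (AmpleGroupoid.Bisection X))) n
  let k := (HomologicalComplex.homologyFunctor _ _ n).mapIso
    (AmpleGroupoid.tensorComplexIso.{u, v, max u v w z, z} K X P.complex)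
  let l := ((NCTensor.tensorFunctor.{max u v z, max u v z, max u v w z, z} K
    (MonoidAlgebra K (AmpleGroupoid.Bisection X))
    (InverseMonoid.IdemModule K (AmpleGroupoid.Bisection X))).leftDerived n).mapIso
      (AmpleGroupoid.coinvIso.{u, v, w, z} K X M)
  -- Hochschild homology is computed by `P`; `k` turns its complex into `KE(S) ⊗ C`, `e` exchanges
  -- `C` for `Q`, and `j` returns to `Tor` over `KS`.
  exact ⟨(i ≪≫ k).toLinearEquiv.trans (e.trans (j.symm ≪≫ l).toLinearEquiv)⟩
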